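/- Let $M\in\{1,2\}$, $L\ge 0$, $A\in\mathbb R^{2\times2}$ and $B=(b_1,\dots,b_M)\in\mathbb R^{2\times M}$ with $\operatorname{rank}[b_i,Ab_i]=2$ for $i=1,\dots,M$. Then there is a time $\mathcal T>0$, depending only on $L$, $A$ and $B$, such that the following holds for all $F:\mathbb R^2\to\mathbb R^2$ and $G=(G_1,\dots,G_M):\mathbb R^2\to\mathbb R^{2\times M}$ of class $\mathcal C^{1,1}$ whose first-order partial derivatives are Lipschitz with constant $L$ and which satisfy $F(0)=0$, $DF(0)=A$, $G(0)=B$, $DG(0)=0$, and for all $0<\tau<\mathcal T$. Consider the control system $\dot y=F(y)+G(y)u$ with measurable controls $u(t)\in[-1,1]^M$. Let $T(x)\in[0,+\infty]$ be the minimum time to steer $x$ to the origin, let $\mathcal R_t$ be the set of points which can be steered to the origin within the time $t$, and let $h(x,p)=\min\{\langle p,F(x)+G(x)w\rangle : w\in[-1,1]^M\}$. For $K\subset\mathbb R^2$ and $x\in K$ let $N_K(x)$ be the proximal normal cone, i.e. the set of $v$ such that, for some $\sigma\ge0$, $\langle v,y-x\rangle\le\sigma\|y-x\|^2$ for all $y\in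 K$. Put $$S=\{x\in\mathcal R_\tau:\ \text{there is } \zeta\in N_{\mathcal R_{T(x)}}(x),\ \|\zeta\|=1,\ \text{with } h(x,\zeta)=0\}.$$ Then: 1. $S$ is exactly the set of those $x\in\mathcal R_\tau$ at which $T$ is non-Lipschitz, i.e. for which there are sequences $x_i\ne y_i$ of points where $T$ is finite, both converging to $x$, with $\limsup_i |T(y_i)-T(x_i)|/\|y_i-x_i\|=+\infty$. 2. $S$ is countably $\mathcal H^1$-rectifiable: it is $\mathcal H^1$-measurable and, up to an $\mathcal H^1$-null set, it is covered by countably many Lipschitz images of $\mathbb R$. 3. Either $S$ is empty or it consists of exactly two optimal trajectories of the reversed dynamics: there are two distinct trajectories $x_1,x_2$ on $[0,\tau]$ of $\dot x=-F(x)-G(x)u$, $x(0)=0$, $u\in[-1,1]^M$, with $T(x_j(\tau))=\tau$ for $j=1,2$, such that $S=x_1([0,\tau])\cup x_2([0,\tau])$. 4. For every $\bar x\in S$ there is $\delta>0$ such that $\mathcal H^1(S\cap B(\bar x,\delta))>0$. -/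

import Mathlib

open MeasureTheory Set Filter Topology
open scoped NNReal ENNReal

noncomputable section

namespace MinTime

/-- The state space `ℝ²` with its Euclidean norm. -/
abbrev Plane : Type := EuclideanSpace ℝ (Fin 2)

/-- `F` is of class `C^{1,1}` on the plane, and all first order partial derivatives of its
components are Lipschitz with constant `L`. -/
def IsC11 (L : ℝ≥0) (F : Plane → Plane) : Prop :=
  ContDiff ℝ 1 F ∧
    ∀ j k : Fin 2, LipschitzWith L (fun x => fderiv ℝ F x (EuclideanSpace.single k 1) j)

/-- The `2 × 2` matrix with columns `v` and `w`. -/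
def columns (v w : Plane) : Matrix (Fin 2) (Fin 2) ℝ :=
  Matrix.of fun j k => (![v, w] k) j

/-- The control-affine dynamics `F x + G x w`, where `G i` is the `i`-th column of `G`. -/
def dynamics {M : ℕ} (F : Plane → Plane) (G : Fin M → Plane → Plane)
    (x : Plane) (w : Fin M → ℝ) : Plane :=
  F x + ∑ i, w i • G i x

/-- Admissible controls: measurable functions of time with values in `[-1,1]^M` a.e. -/
def IsControl {M : ℕ} (u : ℝ → Fin M → ℝ) : Prop :=
  Measurable u ∧ ∀ᵐ s : ℝ, u s ∈ Icc (-1 : Fin M → ℝ) 1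

/-- `y` is a Carathéodory solution on `[0,t]` of `y' = f(y,u)`, `y(0) = x`, in integral form.
(For continuous `f`, continuous `y` and an admissible `u` the integrand is bounded and measurable,
so that this says that `y` is absolutely continuous and solves the equation a.e.) -/
def IsTrajectory {M : ℕ} (f : Plane → (Fin M → ℝ) → Plane) (u : ℝ → Fin M → ℝ)
    (x : Plane) (t : ℝ) (y : ℝ → Plane) : Prop :=
  ContinuousOn y (Icc 0 t) ∧ ∀ r ∈ Icc 0 t, y r = x + ∫ s in (0 : ℝ)..r, f (y s) (u s)

/-- Some admissible control steers `x` to the origin at time `t`. -/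
def Steers {M : ℕ} (F : Plane → Plane) (G : Fin M → Plane → Plane) (x : Plane) (t : ℝ) : Prop :=
  0 ≤ t ∧ ∃ u : ℝ → Fin M → ℝ, IsControl u ∧
    ∃ y : ℝ → Plane, IsTrajectory (dynamics F G) u x t y ∧ y t = 0

/-- The minimum time to reach the origin (`⊤` if the origin cannot be reached from `x`). -/
def minTime {M : ℕ} (F : Plane → Plane) (G : Fin M → Plane → Plane) (x : Plane) : ℝ≥0∞ :=
  ⨅ (t : ℝ) (_ : Steers F G x t), ENNReal.ofReal t

/-- The set of points which can be steered to the origin within the time `t`. -/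
def reachable {M : ℕ} (F : Plane → Plane) (G : Fin M → Plane → Plane) (t : ℝ) : Set Plane :=
  {x | ∃ s ≤ t, Steers F G x s}

/-- The minimized Hamiltonian, the minimum of `⟨p, F x + G x w⟩` over `w ∈ [-1,1]^M`
(attained, since the cube is compact and nonempty). -/
def minHamiltonian {M : ℕ} (F : Plane → Plane) (G : Fin M → Plane → Plane) (x p : Plane) : ℝ :=
  sInf ((fun w : Fin M → ℝ => inner ℝ p (dynamics F G x w)) '' Icc (-1) 1)

/-- The proximal normal cone to `K` at a point `x` of `K`. -/
def proximalNormals (K : Set Plane) (x : Plane) : Set Plane :=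
  {v | x ∈ K ∧ ∃ σ : ℝ, 0 ≤ σ ∧ ∀ y ∈ K, inner ℝ v (y - x) ≤ σ * ‖y - x‖ ^ 2}

/-- The points `x` of `R_τ` at which some unit proximal normal to the sublevel `R_{T(x)}`
annihilates the minimized Hamiltonian. -/
def singularSet {M : ℕ} (F : Plane → Plane) (G : Fin M → Plane → Plane) (τ : ℝ) : Set Plane :=
  {x | x ∈ reachable F G τ ∧
    ∃ ζ : Plane, ‖ζ‖ = 1 ∧ ζ ∈ proximalNormals (reachable F G (minTime F G x).toReal) x ∧
      minHamiltonian F G x ζ = 0}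

/-- `f` is non-Lipschitz at `x`: there are points `a i ≠ b i` of the domain `{f < ⊤}`, converging
to `x`, along which the difference quotients of `f` have upper limit `+∞`. -/
def NonLipschitzAt (f : Plane → ℝ≥0∞) (x : Plane) : Prop :=
  ∃ a b : ℕ → Plane, (∀ i, a i ≠ b i) ∧ (∀ i, f (a i) ≠ ⊤) ∧ (∀ i, f (b i) ≠ ⊤) ∧
    Tendsto a atTop (𝓝 x) ∧ Tendsto b atTop (𝓝 x) ∧
    limsup (fun i => ((|(f (b i)).toReal - (f (a i)).toReal| / ‖b i - a i‖ : ℝ) : EReal)) atTop = ⊤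

/-- `x` is, on `[0,τ]`, an optimal trajectory of the reversed dynamics `x' = -F(x) - G(x) u`,
`x(0) = 0`: it reaches its endpoint `x(τ)` in the minimum time. -/
def IsOptimalReversed {M : ℕ} (F : Plane → Plane) (G : Fin M → Plane → Plane) (τ : ℝ)
    (x : ℝ → Plane) : Prop :=
  (∃ u : ℝ → Fin M → ℝ, IsControl u ∧ IsTrajectory (fun z w => -dynamics F G z w) u 0 τ x) ∧
    minTime F G (x τ) = ENNReal.ofReal τ

/-- Countable `H^k`-rectifiability: `E` is `H^k`-measurable and is covered, up to an `H^k`-null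
set, by countably many Lipschitz images of `ℝ^k`. -/
def CountablyRectifiable (k : ℕ) (E : Set Plane) : Prop :=
  (Measure.hausdorffMeasure (k : ℝ) : Measure Plane).toOuterMeasure.IsCaratheodory E ∧
    ∃ f : ℕ → EuclideanSpace ℝ (Fin k) → Plane,
      (∀ n, ∃ K : ℝ≥0, LipschitzWith K (f n)) ∧
        Measure.hausdorffMeasure (k : ℝ) (E \ ⋃ n, range (f n)) = 0

end MinTime

end

/-!
If two of the vectors `B i` are independent, small points are steered to the origin along segments,
in a time proportional to their norm. Hence the minimum time is Lipschitz and the singular set is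
empty.

Otherwise every `B i` is a multiple `β i • e` of one unit vector `e`, where `e` and `A e` are
independent. The only candidates for singular points are the two reversed trajectories with the
constant controls `signs β` and `-signs β`. Along such an extremal `X`, the area form multiplied by
the integrating factor of Liouville's formula shows that every point reachable within the time `t`
lies on one side of the tangent at `X t`, up to a quadratic error. So the extremal is time optimal,
and the normal to its velocity is a proximal normal which annihilates the minimized Hamiltonian.

Any other point is reached with a control which stays away from both constant controls. Running
the trajectory backwards from a nearby point, and tilting the control towards `signs β` or towards
`-signs β`, moves the starting point to the two sides of the curve formed by the two extremals, so
some tilted trajectory starts on that curve, with a delay proportional to the perturbation. Hence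
the minimum time is Lipschitz there. At a singular point it is not: as the Hamiltonian vanishes,
the reachable sets grow in the direction of the normal only to second order in time.
-/

noncomputable section

namespace MinTime

/-! ### The area form and first-order bounds -/

section Plane

instance : Fact (Module.finrank ℝ Plane = 2) := ⟨by simp⟩

/-- The counterclockwise orientation of the plane. -/
def orientation : Orientation ℝ Plane (Fin 2) :=
  (EuclideanSpace.basisFun (Fin 2) ℝ).toBasis.orientation

/-- The area form of the plane, as a continuous bilinear map: `wedge x y = det (x, y)`. -/
def wedge : Plane →L[ℝ] Plane →L[ℝ] ℝ := orientation.areaForm'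

/-- The trace of an endomorphism of the plane. -/
def planeTrace (D : Plane →L[ℝ] Plane) : ℝ := LinearMap.trace ℝ Plane D

theorem wedge_eq_areaForm (x y : Plane) : wedge x y = orientation.areaForm x y := rfl

theorem wedge_apply (x y : Plane) : wedge x y = x 0 * y 1 - x 1 * y 0 := by
  rw [wedge_eq_areaForm, Orientation.areaForm_to_volumeForm,
    orientation.volumeForm_robust (EuclideanSpace.basisFun (Fin 2) ℝ) rfl,
    Module.Basis.det_apply, Matrix.det_fin_two]
  simp [Module.Basis.toMatrix_apply]
  ring

@[simp]
theorem wedge_self (x : Plane) : wedge x x = 0 := orientation.areaForm_apply_self x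

theorem wedge_swap (x y : Plane) : wedge x y = -wedge y x := orientation.areaForm_swap x y

theorem abs_apply_le_norm (x : Plane) (j : Fin 2) : |x j| ≤ ‖x‖ := by
  simpa using PiLp.norm_apply_le x j

theorem inner_sq_add_wedge_sq (x y : Plane) :
    (inner ℝ x y : ℝ) ^ 2 + wedge x y ^ 2 = ‖x‖ ^ 2 * ‖y‖ ^ 2 :=
  orientation.inner_sq_add_areaForm_sq x y

theorem abs_wedge_le (x y : Plane) : |wedge x y| ≤ ‖x‖ * ‖y‖ := orientation.abs_areaForm_le x y

theorem planeTrace_eq (D : Plane →L[ℝ] Plane) :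
    planeTrace D = D (EuclideanSpace.single 0 1) 0 + D (EuclideanSpace.single 1 1) 1 := by
  rw [planeTrace, LinearMap.trace_eq_matrix_trace ℝ (EuclideanSpace.basisFun (Fin 2) ℝ).toBasis,
    Matrix.trace_fin_two]
  simp [LinearMap.toMatrix_apply]

theorem map_plane_apply (D : Plane →L[ℝ] Plane) (v : Plane) (j : Fin 2) :
    D v j = v 0 * D (EuclideanSpace.single 0 1) j + v 1 * D (EuclideanSpace.single 1 1) j := by
  have hv : v = v 0 • EuclideanSpace.single 0 1 + v 1 • EuclideanSpace.single 1 1 := by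
    ext i; fin_cases i <;> simp
  conv_lhs => rw [hv]
  simp

theorem wedge_map_left_add_wedge_map_right (D : Plane →L[ℝ] Plane) (v z : Plane) :
    wedge (D v) z + wedge v (D z) = planeTrace D * wedge v z := by
  simp only [wedge_apply, planeTrace_eq]
  rw [map_plane_apply D v 0, map_plane_apply D v 1, map_plane_apply D z 0, map_plane_apply D z 1]
  ring

theorem continuous_planeTrace : Continuous planeTrace := by
  simp_rw [funext planeTrace_eq]
  fun_prop

theorem abs_planeTrace_le (D : Plane →L[ℝ] Plane) : |planeTrace D| ≤ 2 * ‖D‖ := by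
  have hcoord : ∀ k : Fin 2, |D (EuclideanSpace.single k 1) k| ≤ ‖D‖ := fun k =>
    calc _ ≤ ‖D (EuclideanSpace.single k 1)‖ := abs_apply_le_norm _ k
      _ ≤ ‖D‖ := by simpa using D.le_opNorm (EuclideanSpace.single k 1)
  rw [planeTrace_eq]
  linarith [abs_add_le (D (EuclideanSpace.single 0 1) 0) (D (EuclideanSpace.single 1 1) 1),
    hcoord 0, hcoord 1]

theorem hasDerivAt_wedge {a b : ℝ → Plane} {a' b' : Plane} {s : ℝ}
    (ha : HasDerivAt a a' s) (hb : HasDerivAt b b' s) :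
    HasDerivAt (fun r => wedge (a r) (b r)) (wedge (a s) b' + wedge a' (b s)) s :=
  ContinuousLinearMap.hasDerivAt_of_bilinear (fun _ => ha) fun _ => hb

theorem eq_inner_smul_of_wedge_eq_zero {e x : Plane} (he : ‖e‖ = 1) (h : wedge e x = 0) :
    x = (inner ℝ e x : ℝ) • e := by
  have hsq := inner_sq_add_wedge_sq e x
  rw [h, he] at hsq
  have hdist : ‖x - (inner ℝ e x : ℝ) • e‖ ^ 2 = 0 := by
    rw [norm_sub_sq_real, inner_smul_right, norm_smul, he, mul_one, Real.norm_eq_abs, sq_abs,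
      real_inner_comm e x]
    linarith
  exact sub_eq_zero.1 (norm_eq_zero.1 (pow_eq_zero_iff two_ne_zero |>.1 hdist))

theorem wedge_ne_zero_of_rank_columns {v w : Plane} (h : (columns v w).rank = 2) :
    wedge v w ≠ 0 := by
  intro hzero
  have hdet : (columns v w).det = 0 := by
    rw [Matrix.det_fin_two, ← hzero, wedge_apply]
    simp [columns]
    ring
  obtain ⟨x, hx, hx0⟩ := Matrix.exists_mulVec_eq_zero_iff.2 hdet
  have hrange : LinearMap.range (columns v w).mulVecLin = ⊤ :=
    Submodule.eq_top_of_finrank_eq (by simpa [Matrix.rank] using h)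
  have hinj := LinearMap.injective_iff_surjective.2 (LinearMap.range_eq_top.1 hrange)
  exact hx (hinj (by simpa using hx0))

end Plane

section FirstOrderData

variable {L : ℝ≥0} {F : Plane → Plane}

theorem IsC11.differentiable (h : IsC11 L F) : Differentiable ℝ F := h.1.differentiable (by simp)

theorem IsC11.norm_fderiv_sub_le (h : IsC11 L F) (x y : Plane) :
    ‖fderiv ℝ F x - fderiv ℝ F y‖ ≤ 4 * L * ‖x - y‖ := by
  set D := fderiv ℝ F x - fderiv ℝ F y with hD
  have hentry : ∀ j k, |D (EuclideanSpace.single k 1) j| ≤ L * ‖x - y‖ := fun j k => by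
    simpa [hD, Real.dist_eq, dist_eq_norm] using (h.2 j k).dist_le_mul x y
  refine D.opNorm_le_bound (by positivity) fun v => ?_
  have hrow : ∀ j, |D v j| ≤ 2 * L * ‖x - y‖ * ‖v‖ := fun j =>
    calc |D v j| ≤ |v 0| * |D (EuclideanSpace.single 0 1) j| +
          |v 1| * |D (EuclideanSpace.single 1 1) j| := by
          rw [map_plane_apply, ← abs_mul, ← abs_mul]; exact abs_add_le _ _
      _ ≤ ‖v‖ * (L * ‖x - y‖) + ‖v‖ * (L * ‖x - y‖) := by
          gcongr
          exacts [abs_apply_le_norm v 0, hentry j 0, abs_apply_le_norm v 1, hentry j 1]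
      _ = 2 * L * ‖x - y‖ * ‖v‖ := by ring
  calc ‖D v‖ ≤ |D v 0| + |D v 1| := by
        refine le_of_sq_le_sq ?_ (by positivity)
        rw [EuclideanSpace.norm_sq_eq, Fin.sum_univ_two, Real.norm_eq_abs, Real.norm_eq_abs]
        nlinarith [abs_nonneg (D v 0), abs_nonneg (D v 1)]
    _ ≤ 2 * L * ‖x - y‖ * ‖v‖ + 2 * L * ‖x - y‖ * ‖v‖ := add_le_add (hrow 0) (hrow 1)
    _ = 4 * L * ‖x - y‖ * ‖v‖ := by ring

theorem IsC11.norm_sub_sub_fderiv_zero_le (h : IsC11 L F) {r : ℝ} {x y : Plane}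
    (hx : ‖x‖ ≤ r) (hy : ‖y‖ ≤ r) :
    ‖F x - F y - fderiv ℝ F 0 (x - y)‖ ≤ 4 * L * r * ‖x - y‖ := by
  refine (convex_closedBall (0 : Plane) r).norm_image_sub_le_of_norm_fderiv_le'
    (fun z _ => h.differentiable z) (fun z hz => ?_) (by simpa using hy) (by simpa using hx)
  calc _ ≤ 4 * L * ‖z - 0‖ := h.norm_fderiv_sub_le z 0
    _ ≤ _ := by gcongr; simpa using hz

theorem IsC11.norm_sub_le (h : IsC11 L F) {x y : Plane} (hx : ‖x‖ ≤ 1) (hy : ‖y‖ ≤ 1) :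
    ‖F x - F y‖ ≤ (‖fderiv ℝ F 0‖ + 4 * L) * ‖x - y‖ :=
  calc _ ≤ ‖fderiv ℝ F 0 (x - y)‖ + ‖F x - F y - fderiv ℝ F 0 (x - y)‖ := norm_le_insert' _ _
    _ ≤ ‖fderiv ℝ F 0‖ * ‖x - y‖ + 4 * L * 1 * ‖x - y‖ :=
        add_le_add (ContinuousLinearMap.le_opNorm _ _) (h.norm_sub_sub_fderiv_zero_le hx hy)
    _ = _ := by ring

theorem IsC11.norm_le (h : IsC11 L F) {x : Plane} (hx : ‖x‖ ≤ 1) :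
    ‖F x‖ ≤ ‖F 0‖ + (‖fderiv ℝ F 0‖ + 4 * L) :=
  calc ‖F x‖ ≤ ‖F 0‖ + ‖F x - F 0‖ := norm_le_insert' _ _
    _ ≤ ‖F 0‖ + (‖fderiv ℝ F 0‖ + 4 * L) * ‖x - 0‖ := by gcongr; exact h.norm_sub_le hx (by simp)
    _ ≤ _ := by
        gcongr
        exact mul_le_of_le_one_right (by positivity) (by simpa using hx)

theorem IsC11.norm_taylor_le (h : IsC11 L F) (x y : Plane) :
    ‖F y - F x - fderiv ℝ F x (y - x)‖ ≤ 4 * L * ‖y - x‖ ^ 2 := by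
  rw [pow_two, ← mul_assoc]
  refine (convex_closedBall x ‖y - x‖).norm_image_sub_le_of_norm_fderiv_le'
    (fun z _ => h.differentiable z) (fun z hz => ?_) (Metric.mem_closedBall_self (norm_nonneg _))
    (by simp [dist_eq_norm])
  calc _ ≤ 4 * L * ‖z - x‖ := h.norm_fderiv_sub_le z x
    _ ≤ _ := by gcongr; simpa [dist_eq_norm] using hz

variable {M : ℕ} {G : Fin M → Plane → Plane} {w : Fin M → ℝ}

theorem abs_le_one_of_mem_cube (hw : w ∈ Icc (-1 : Fin M → ℝ) 1) (i : Fin M) : |w i| ≤ 1 :=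
  abs_le.2 ⟨by simpa using hw.1 i, by simpa using hw.2 i⟩

theorem mem_cube_of_abs_le_one (hw : ∀ i, |w i| ≤ 1) : w ∈ Icc (-1 : Fin M → ℝ) 1 :=
  ⟨fun i => by simpa using (abs_le.1 (hw i)).1, fun i => by simpa using (abs_le.1 (hw i)).2⟩

theorem norm_sum_smul_le (hw : w ∈ Icc (-1 : Fin M → ℝ) 1) {g : Fin M → Plane} {a : ℝ}
    (hg : ∀ i, ‖g i‖ ≤ a) : ‖∑ i, w i • g i‖ ≤ M * a :=
  calc _ ≤ ∑ _i : Fin M, a := norm_sum_le_of_le _ fun i _ => by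
        rw [norm_smul, Real.norm_eq_abs]
        exact (mul_le_of_le_one_left (norm_nonneg _) (abs_le_one_of_mem_cube hw i)).trans (hg i)
    _ = _ := by simp

theorem norm_add_sum_smul_le (hw : w ∈ Icc (-1 : Fin M → ℝ) 1) {p : Plane} {g : Fin M → Plane}
    {a b : ℝ} (hp : ‖p‖ ≤ a) (hg : ∀ i, ‖g i‖ ≤ b) : ‖p + ∑ i, w i • g i‖ ≤ a + M * b :=
  norm_add_le_of_le hp (norm_sum_smul_le hw hg)

theorem dynamics_sub (F : Plane → Plane) (G : Fin M → Plane → Plane) (x y : Plane)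
    (w : Fin M → ℝ) :
    dynamics F G x w - dynamics F G y w = (F x - F y) + ∑ i, w i • (G i x - G i y) := by
  simp only [dynamics, smul_sub, Finset.sum_sub_distrib]
  abel

theorem fderiv_dynamics_apply {x : Plane} (hF : DifferentiableAt ℝ F x)
    (hG : ∀ i, DifferentiableAt ℝ (G i) x) (w : Fin M → ℝ) (v : Plane) :
    fderiv ℝ (fun z => dynamics F G z w) x v =
      fderiv ℝ F x v + ∑ i, w i • fderiv ℝ (G i) x v := by
  have hderiv : HasFDerivAt (fun z => dynamics F G z w)
      (fderiv ℝ F x + ∑ i, w i • fderiv ℝ (G i) x) x :=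
    hF.hasFDerivAt.fun_add (HasFDerivAt.fun_sum fun i _ =>
      (hG i).hasFDerivAt.fun_const_smul (w i))
  simp [hderiv.fderiv]

theorem IsC11.norm_dynamics_sub_le (hF : IsC11 L F) (hG : ∀ i, IsC11 L (G i))
    (hDG : ∀ i, fderiv ℝ (G i) 0 = 0) (hw : w ∈ Icc (-1 : Fin M → ℝ) 1) {x y : Plane}
    (hx : ‖x‖ ≤ 1) (hy : ‖y‖ ≤ 1) :
    ‖dynamics F G x w - dynamics F G y w‖ ≤
      (‖fderiv ℝ F 0‖ + 4 * L + M * (4 * L)) * ‖x - y‖ := by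
  rw [dynamics_sub, add_mul, mul_assoc (M : ℝ)]
  exact norm_add_sum_smul_le hw (hF.norm_sub_le hx hy) fun i => by
    simpa [hDG] using (hG i).norm_sub_le hx hy

theorem IsC11.norm_dynamics_taylor_le (hF : IsC11 L F) (hG : ∀ i, IsC11 L (G i))
    (hw : w ∈ Icc (-1 : Fin M → ℝ) 1) (x y : Plane) :
    ‖dynamics F G y w - dynamics F G x w - fderiv ℝ (fun z => dynamics F G z w) x (y - x)‖ ≤
      (4 * L + M * (4 * L)) * ‖y - x‖ ^ 2 := by
  have hsplit : dynamics F G y w - dynamics F G x w -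
      fderiv ℝ (fun z => dynamics F G z w) x (y - x) = (F y - F x - fderiv ℝ F x (y - x)) +
        ∑ i, w i • (G i y - G i x - fderiv ℝ (G i) x (y - x)) := by
    rw [dynamics_sub, fderiv_dynamics_apply (hF.differentiable x) fun i => (hG i).differentiable x]
    simp only [smul_sub, Finset.sum_sub_distrib]
    abel
  rw [hsplit, add_mul, mul_assoc (M : ℝ)]
  exact norm_add_sum_smul_le hw (hF.norm_taylor_le x y) fun i => (hG i).norm_taylor_le x y

/-- A system `y' = F y + G y u` with first order data `A = DF(0)`, `B = G(0)` and `DG(0) = 0` at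
the equilibrium `0`, all of whose size, Lipschitz and Taylor constants on the unit ball are
bounded by `C`. -/
structure SystemBounds (F : Plane → Plane) (G : Fin M → Plane → Plane)
    (A : Plane →L[ℝ] Plane) (B : Fin M → Plane) (C : ℝ) : Prop where
  one_le : 1 ≤ C
  card_le : (M : ℝ) ≤ C
  norm_A : ‖A‖ ≤ C
  F_zero : F 0 = 0
  G_zero : ∀ i, G i 0 = B i
  F_contDiff : ContDiff ℝ 1 F
  G_contDiff : ∀ i, ContDiff ℝ 1 (G i)
  F_sub : ∀ r ≤ 1, ∀ x y : Plane, ‖x‖ ≤ r → ‖y‖ ≤ r → ‖F x - F y - A (x - y)‖ ≤ C * r * ‖x - y‖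
  G_sub : ∀ i, ∀ r ≤ 1, ∀ x y : Plane, ‖x‖ ≤ r → ‖y‖ ≤ r → ‖G i x - G i y‖ ≤ C * r * ‖x - y‖
  norm_G : ∀ i, ∀ x : Plane, ‖x‖ ≤ 1 → ‖G i x‖ ≤ C
  norm_le : ∀ x : Plane, ‖x‖ ≤ 1 → ∀ w ∈ Icc (-1 : Fin M → ℝ) 1, ‖dynamics F G x w‖ ≤ C
  lip : ∀ x y : Plane, ‖x‖ ≤ 1 → ‖y‖ ≤ 1 → ∀ w ∈ Icc (-1 : Fin M → ℝ) 1,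
    ‖dynamics F G x w - dynamics F G y w‖ ≤ C * ‖x - y‖
  taylor : ∀ w ∈ Icc (-1 : Fin M → ℝ) 1, ∀ x y : Plane,
    ‖dynamics F G y w - dynamics F G x w - fderiv ℝ (fun z => dynamics F G z w) x (y - x)‖ ≤
      C * ‖y - x‖ ^ 2

theorem systemBounds_of_isC11 {A : Plane →L[ℝ] Plane} {B : Fin M → Plane}
    (hF : IsC11 L F) (hG : ∀ i, IsC11 L (G i)) (hF0 : F 0 = 0) (hDF : fderiv ℝ F 0 = A)
    (hG0 : ∀ i, G i 0 = B i) (hDG : ∀ i, fderiv ℝ (G i) 0 = 0) :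
    SystemBounds F G A B (1 + M + ‖A‖ + 4 * L + ∑ i, ‖B i‖ + M * (∑ i, ‖B i‖ + 4 * L)) := by
  set b : ℝ := ∑ i, ‖B i‖
  have hB : ∀ i, ‖B i‖ ≤ b := fun i =>
    Finset.single_le_sum (f := fun i => ‖B i‖) (fun i _ => norm_nonneg _) (Finset.mem_univ i)
  have hb : 0 ≤ b := Finset.sum_nonneg fun i _ => norm_nonneg _
  have hA := norm_nonneg A
  have : (0 : ℝ) ≤ L := L.2
  have : (0 : ℝ) ≤ M := Nat.cast_nonneg _
  have hMb : 0 ≤ M * b := by positivity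
  have hML : 0 ≤ M * (4 * L : ℝ) := by positivity
  have : (M : ℝ) * (b + 4 * L) = M * b + M * (4 * L) := by ring
  have hGnorm : ∀ i, ∀ x : Plane, ‖x‖ ≤ 1 → ‖G i x‖ ≤ b + 4 * L := fun i x hx => by
    have := (hG i).norm_le hx
    rw [hDG, norm_zero, zero_add, hG0] at this
    linarith [hB i]
  refine ⟨by linarith, by linarith, by linarith, hF0, hG0, hF.1, fun i => (hG i).1,
    fun r _ x y hx hy => ?_, fun i r _ x y hx hy => ?_, fun i x hx => ?_, fun x hx w hw => ?_,
    fun x y hx hy w hw => ?_, fun w hw x y => ?_⟩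
  · have hr : 0 ≤ r := (norm_nonneg _).trans hx
    calc _ ≤ 4 * L * r * ‖x - y‖ := hDF ▸ hF.norm_sub_sub_fderiv_zero_le hx hy
      _ ≤ _ := by gcongr; linarith
  · have hr : 0 ≤ r := (norm_nonneg _).trans hx
    calc _ ≤ 4 * L * r * ‖x - y‖ := by
          simpa [hDG] using (hG i).norm_sub_sub_fderiv_zero_le hx hy
      _ ≤ _ := by gcongr; linarith
  · linarith [hGnorm i x hx]
  · have hFx := hF.norm_le hx
    rw [hF0, norm_zero, zero_add, hDF] at hFx
    calc _ ≤ _ := norm_add_sum_smul_le hw hFx fun i => hGnorm i x hx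
      _ ≤ _ := by linarith
  · exact (hDF ▸ hF.norm_dynamics_sub_le hG hDG hw hx hy).trans
      (mul_le_mul_of_nonneg_right (by linarith) (norm_nonneg _))
  · exact (hF.norm_dynamics_taylor_le hG hw x y).trans
      (mul_le_mul_of_nonneg_right (by linarith) (by positivity))

end FirstOrderData

/-! ### Trajectories -/

section Trajectories

variable {M : ℕ}

/-- A controlled field, bounded and Lipschitz with constant `C` on the unit ball. -/
structure IsControlField (f : Plane → (Fin M → ℝ) → Plane) (C : ℝ) : Prop where
  one_le : 1 ≤ C
  cont : Continuous fun p : Plane × (Fin M → ℝ) => f p.1 p.2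
  norm_le : ∀ x : Plane, ‖x‖ ≤ 1 → ∀ w ∈ Icc (-1 : Fin M → ℝ) 1, ‖f x w‖ ≤ C
  lip : ∀ x y : Plane, ‖x‖ ≤ 1 → ‖y‖ ≤ 1 → ∀ w ∈ Icc (-1 : Fin M → ℝ) 1,
    ‖f x w - f y w‖ ≤ C * ‖x - y‖
  lip_control : ∀ x : Plane, ‖x‖ ≤ 1 → ∀ w w' : Fin M → ℝ,
    ‖f x w - f x w'‖ ≤ C * ∑ i, |w i - w' i|

theorem SystemBounds.isControlField {F : Plane → Plane} {G : Fin M → Plane → Plane}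
    {A : Plane →L[ℝ] Plane} {B : Fin M → Plane} {C : ℝ} (h : SystemBounds F G A B C) :
    IsControlField (dynamics F G) C := by
  refine ⟨h.one_le, ?_, h.norm_le, h.lip, fun x hx w w' => ?_⟩
  · have := h.F_contDiff.continuous
    have := fun i => (h.G_contDiff i).continuous
    unfold dynamics
    fun_prop
  · have hsub : dynamics F G x w - dynamics F G x w' = ∑ i, (w i - w' i) • G i x := by
      simp [dynamics, sub_smul]
    rw [hsub, Finset.mul_sum]
    refine norm_sum_le_of_le _ fun i _ => ?_
    rw [norm_smul, mul_comm, Real.norm_eq_abs]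
    gcongr
    exact h.norm_G i x hx

theorem IsControlField.neg {f : Plane → (Fin M → ℝ) → Plane} {C : ℝ} (h : IsControlField f C) :
    IsControlField (fun z w => -f z w) C := by
  refine ⟨h.one_le, h.cont.neg, fun x hx w hw => by simpa using h.norm_le x hx w hw,
    fun x y hx hy w hw => ?_, fun x hx w w' => ?_⟩
  · rw [neg_sub_neg, norm_sub_rev]; exact h.lip x y hx hy w hw
  · rw [neg_sub_neg, norm_sub_rev]; exact h.lip_control x hx w w'

theorem IsControl.comp_sub_left {u : ℝ → Fin M → ℝ} (hu : IsControl u) (t : ℝ) :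
    IsControl fun s => u (t - s) :=
  ⟨hu.1.comp (measurable_const.sub measurable_id),
    (Measure.measurePreserving_sub_left volume t).quasiMeasurePreserving.ae hu.2⟩

theorem IsControl.comp_sub_right {u : ℝ → Fin M → ℝ} (hu : IsControl u) (t : ℝ) :
    IsControl fun s => u (s - t) :=
  ⟨hu.1.comp (measurable_id.sub measurable_const),
    (measurePreserving_sub_right volume t).quasiMeasurePreserving.ae hu.2⟩

theorem isControl_const {w : Fin M → ℝ} (hw : w ∈ Icc (-1 : Fin M → ℝ) 1) :
    IsControl fun _ : ℝ => w :=
  ⟨measurable_const, Eventually.of_forall fun _ => hw⟩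

theorem IsControl.ite {u v : ℝ → Fin M → ℝ} (hu : IsControl u) (hv : IsControl v) (s : ℝ) :
    IsControl fun r => if r < s then u r else v r := by
  refine ⟨Measurable.ite measurableSet_Iio hu.1 hv.1, ?_⟩
  filter_upwards [hu.2, hv.2] with r hur hvr
  split_ifs <;> assumption

theorem IsControlField.intervalIntegrable {f : Plane → (Fin M → ℝ) → Plane} {C : ℝ}
    (hf : IsControlField f C) {u : ℝ → Fin M → ℝ} (hu : IsControl u) {y : ℝ → Plane} {t : ℝ}
    (hy : ContinuousOn y (Icc 0 t)) {r r' : ℝ} (hr : r ∈ Icc 0 t) (hr' : r' ∈ Icc 0 t) :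
    IntervalIntegrable (fun s => f (y s) (u s)) volume r r' := by
  have hcompact : IsCompact ((y '' Icc 0 t) ×ˢ Icc (-1 : Fin M → ℝ) 1) :=
    (isCompact_Icc.image_of_continuousOn hy).prod isCompact_Icc
  obtain ⟨K, hK⟩ := (hcompact.image hf.cont).isBounded.exists_norm_le
  have hmeas : AEStronglyMeasurable (fun s => f (y s) (u s)) (volume.restrict (Icc 0 t)) :=
    (hf.cont.measurable.comp_aemeasurable
      ((hy.aemeasurable measurableSet_Icc).prodMk hu.1.aemeasurable)).aestronglyMeasurable
  have hint : IntegrableOn (fun s => f (y s) (u s)) (Icc 0 t) := by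
    refine Integrable.of_bound hmeas K ?_
    rw [ae_restrict_iff' measurableSet_Icc]
    filter_upwards [hu.2] with s hs hst
    exact hK _ ⟨(y s, u s), ⟨⟨s, hst, rfl⟩, hs⟩, rfl⟩
  rw [intervalIntegrable_iff']
  exact hint.mono_set ((convex_Icc 0 t).ordConnected.uIcc_subset hr hr')

variable {f : Plane → (Fin M → ℝ) → Plane} {C : ℝ} {u v : ℝ → Fin M → ℝ} {p : Plane} {t : ℝ}
  {y : ℝ → Plane}

theorem IsTrajectory.sub_eq (hf : IsControlField f C) (hu : IsControl u)
    (hy : IsTrajectory f u p t y) {r r' : ℝ} (hr : r ∈ Icc 0 t) (hr' : r' ∈ Icc 0 t) :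
    y r' - y r = ∫ s in r..r', f (y s) (u s) := by
  have h0 : (0 : ℝ) ∈ Icc 0 t := ⟨le_rfl, hr.1.trans hr.2⟩
  rw [hy.2 r hr, hy.2 r' hr', add_sub_add_left_eq_sub,
    intervalIntegral.integral_interval_sub_left (hf.intervalIntegrable hu hy.1 h0 hr')
    (hf.intervalIntegrable hu hy.1 h0 hr)]

theorem IsTrajectory.apply_zero (hy : IsTrajectory f u p t y) (ht : 0 ≤ t) : y 0 = p := by
  simpa using hy.2 0 ⟨le_rfl, ht⟩

theorem IsTrajectory.mono (hy : IsTrajectory f u p t y) {t' : ℝ} (ht : t' ≤ t) :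
    IsTrajectory f u p t' y :=
  ⟨hy.1.mono (Icc_subset_Icc_right ht), fun r hr => hy.2 r ⟨hr.1, hr.2.trans ht⟩⟩

theorem IsTrajectory.congr (hy : IsTrajectory f u p t y) {Y : ℝ → Plane}
    (hY : EqOn Y y (Icc 0 t)) (huv : EqOn v u (Ico 0 t)) : IsTrajectory f v p t Y := by
  refine ⟨hy.1.congr hY, fun r hr => ?_⟩
  rw [hY hr, hy.2 r hr]
  refine congrArg (p + ·) (intervalIntegral.integral_congr_ae ?_)
  filter_upwards [Measure.ae_ne volume t] with q hqt hqr
  rw [uIoc_of_le hr.1] at hqr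
  have hq : q < t := lt_of_le_of_ne (hqr.2.trans hr.2) hqt
  rw [hY ⟨hqr.1.le, hq.le⟩, huv ⟨hqr.1.le, hq⟩]

theorem IsTrajectory.norm_sub_le_of_forall (hf : IsControlField f C) (hu : IsControl u)
    (hy : IsTrajectory f u p t y) {r r' : ℝ} (hr : r ∈ Icc 0 t) (hr' : r' ∈ Icc 0 t)
    (hb : ∀ s ∈ uIoo r r', ‖y s‖ ≤ 1) : ‖y r' - y r‖ ≤ C * |r' - r| := by
  rw [hy.sub_eq hf hu hr hr']
  refine intervalIntegral.norm_integral_le_of_norm_le_const_ae ?_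
  filter_upwards [hu.2, Measure.ae_ne volume (max r r')] with s hs hne hsr
  exact hf.norm_le _ (hb s ⟨hsr.1, lt_of_le_of_ne hsr.2 hne⟩) _ hs

theorem IsTrajectory.norm_lt_one (hf : IsControlField f C) (hu : IsControl u)
    (hy : IsTrajectory f u p t y) (hp : ‖p‖ + C * t < 1) {r : ℝ} (hr : r ∈ Icc 0 t) :
    ‖y r‖ < 1 := by
  by_contra! hcon
  have h0 : (0 : ℝ) ∈ Icc 0 t := ⟨le_rfl, hr.1.trans hr.2⟩
  have hcompact : IsCompact (Icc 0 t ∩ (fun s => ‖y s‖) ⁻¹' Ici 1) :=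
    isCompact_Icc.of_isClosed_subset
      (hy.1.norm.preimage_isClosed_of_isClosed isClosed_Icc isClosed_Ici) inter_subset_left
  obtain ⟨r₀, ⟨hr₀, hexit : 1 ≤ ‖y r₀‖⟩, hmin⟩ := hcompact.exists_isLeast ⟨r, hr, hcon⟩
  have hbefore : ∀ s ∈ uIoo 0 r₀, ‖y s‖ ≤ 1 := by
    intro s hs
    rw [uIoo_of_le hr₀.1] at hs
    by_contra! h
    exact absurd (hmin ⟨⟨hs.1.le, hs.2.le.trans hr₀.2⟩, h.le⟩) (not_le.2 hs.2)
  have hmove := hy.norm_sub_le_of_forall hf hu h0 hr₀ hbefore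
  rw [hy.apply_zero h0.2, sub_zero, abs_of_nonneg hr₀.1] at hmove
  have hC : 0 ≤ C := zero_le_one.trans hf.one_le
  linarith [norm_sub_norm_le (y r₀) p, mul_le_mul_of_nonneg_left hr₀.2 hC]

theorem IsTrajectory.norm_sub_le (hf : IsControlField f C) (hu : IsControl u)
    (hy : IsTrajectory f u p t y) (hp : ‖p‖ + C * t < 1) {r r' : ℝ} (hr : r ∈ Icc 0 t)
    (hr' : r' ∈ Icc 0 t) : ‖y r' - y r‖ ≤ C * |r' - r| := by
  refine hy.norm_sub_le_of_forall hf hu hr hr' fun s hs => (hy.norm_lt_one hf hu hp ?_).le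
  exact (convex_Icc 0 t).ordConnected.uIcc_subset hr hr' (uIoo_subset_uIcc_self hs)

theorem IsTrajectory.norm_le (hf : IsControlField f C) (hu : IsControl u)
    (hy : IsTrajectory f u p t y) (hp : ‖p‖ + C * t < 1) {r : ℝ} (hr : r ∈ Icc 0 t) :
    ‖y r‖ ≤ ‖p‖ + C * r := by
  have h0 : (0 : ℝ) ∈ Icc 0 t := ⟨le_rfl, hr.1.trans hr.2⟩
  have hmove := hy.norm_sub_le hf hu hp h0 hr
  rw [hy.apply_zero h0.2, sub_zero, abs_of_nonneg hr.1] at hmove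
  linarith [norm_sub_norm_le (y r) p]

theorem IsTrajectory.reverse (hf : IsControlField f C) (hu : IsControl u)
    (hy : IsTrajectory f u p t y) (ht : 0 ≤ t) :
    IsTrajectory (fun z w => -f z w) (fun s => u (t - s)) (y t) t (fun s => y (t - s)) := by
  have hmem : ∀ r ∈ Icc 0 t, t - r ∈ Icc 0 t := fun r hr => ⟨by linarith [hr.2], by linarith [hr.1]⟩
  refine ⟨hy.1.comp (by fun_prop) hmem, fun r hr => ?_⟩
  rw [intervalIntegral.integral_neg,
    intervalIntegral.integral_comp_sub_left (fun s => f (y s) (u s)) t, sub_zero,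
    ← hy.sub_eq hf hu (hmem r hr) ⟨ht, le_rfl⟩]
  abel

theorem IsTrajectory.append (hf : IsControlField f C) (hu : IsControl u) {s : ℝ} (hs : 0 ≤ s)
    (ht : 0 ≤ t) (hfirst : IsTrajectory f u p s y)
    (hsecond : IsTrajectory f (fun r => u (r + s)) (y s) t fun r => y (r + s)) :
    IsTrajectory f u p (s + t) y := by
  have hcont : ContinuousOn y (Icc 0 (s + t)) := by
    have hright : ContinuousOn y (Icc s (s + t)) := by
      simpa [Function.comp_def] using hsecond.1.comp (t := Icc 0 t) (s := Icc s (s + t))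
        (g := fun r => y (r + s)) (f := fun r => r - s) (by fun_prop)
        fun r hr => ⟨by linarith [hr.1], by linarith [hr.2]⟩
    rw [← Icc_union_Icc_eq_Icc hs (by linarith : s ≤ s + t)]
    exact hfirst.1.union_of_isClosed hright isClosed_Icc isClosed_Icc
  refine ⟨hcont, fun r hr => (le_total r s).elim (fun hrs => hfirst.2 r ⟨hr.1, hrs⟩) fun hrs => ?_⟩
  have h0 : (0 : ℝ) ∈ Icc 0 (s + t) := ⟨le_rfl, by linarith⟩
  have hsm : s ∈ Icc 0 (s + t) := ⟨hs, by linarith⟩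
  have hlast := hsecond.2 (r - s) ⟨by linarith, by linarith [hr.2]⟩
  rw [intervalIntegral.integral_comp_add_right (fun q => f (y q) (u q)) s, zero_add,
    sub_add_cancel, hfirst.2 s ⟨hs, le_rfl⟩, add_assoc,
    intervalIntegral.integral_add_adjacent_intervals (hf.intervalIntegrable hu hcont h0 hsm)
      (hf.intervalIntegrable hu hcont hsm hr)] at hlast
  simpa only [sub_add_cancel] using hlast

theorem IsTrajectory.concat (hf : IsControlField f C) (hu : IsControl u)
    {s : ℝ} (hs : 0 ≤ s) (ht : 0 ≤ t) (hy : IsTrajectory f u p s y)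
    (hv : IsControl v) {y' : ℝ → Plane} (hy' : IsTrajectory f v (y s) t y') :
    IsTrajectory f (fun r => if r < s then u r else v (r - s)) p (s + t)
      (fun r => if r ≤ s then y r else y' (r - s)) := by
  refine IsTrajectory.append hf (hu.ite (hv.comp_sub_right s) s) hs ht
    (hy.congr (fun r hr => if_pos hr.2) fun r hr => if_pos hr.2) ?_
  simp only [le_refl, if_true]
  refine hy'.congr (fun r hr => ?_) fun r hr => ?_
  · rcases hr.1.eq_or_lt with rfl | hr
    · simp [hy'.apply_zero ht]
    · simp [not_le.2 hr]
  · simp [not_lt.2 hr.1]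

theorem IsTrajectory.ae_hasDerivAt (hf : IsControlField f C) (hu : IsControl u)
    (hy : IsTrajectory f u p t y) (ht : 0 ≤ t) :
    ∀ᵐ s : ℝ, s ∈ Ioo 0 t → HasDerivAt y (f (y s) (u s)) s := by
  have h0 : (0 : ℝ) ∈ Icc 0 t := ⟨le_rfl, ht⟩
  have hint := hf.intervalIntegrable hu hy.1 h0 ⟨ht, le_rfl⟩
  filter_upwards [hint.ae_hasDerivAt_integral] with s hs hst
  rw [uIcc_of_le ht] at hs
  refine ((hs (Ioo_subset_Icc_self hst) 0 h0).const_add p).congr_of_eventuallyEq ?_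
  filter_upwards [Ioo_mem_nhds hst.1 hst.2] with r hr
  exact hy.2 r (Ioo_subset_Icc_self hr)

theorem IsTrajectory.lipschitzOnWith (hf : IsControlField f C) (hu : IsControl u)
    (hy : IsTrajectory f u p t y) (hp : ‖p‖ + C * t < 1) :
    LipschitzOnWith C.toNNReal y (Icc 0 t) :=
  LipschitzOnWith.of_dist_le_mul fun r hr r' hr' => by
    rw [Real.coe_toNNReal C (zero_le_one.trans hf.one_le), dist_eq_norm, Real.dist_eq]
    exact hy.norm_sub_le hf hu hp hr' hr

theorem absolutelyContinuousOnInterval_wedge {a b : ℝ → Plane} {K K' : ℝ≥0} {r s : ℝ}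
    (ha : LipschitzOnWith K a (uIcc r s)) (hb : LipschitzOnWith K' b (uIcc r s)) :
    AbsolutelyContinuousOnInterval (fun q => wedge (a q) (b q)) r s := by
  have hcoord {f : ℝ → Plane} {K : ℝ≥0} (hf : LipschitzOnWith K f (uIcc r s)) (j : Fin 2) :
      AbsolutelyContinuousOnInterval (fun q => f q j) r s :=
    ((EuclideanSpace.proj j : Plane →L[ℝ] ℝ).lipschitz.comp_lipschitzOnWith
      hf).absolutelyContinuousOnInterval
  simp only [wedge_apply]
  exact ((hcoord ha 0).fun_mul (hcoord hb 1)).fun_sub ((hcoord ha 1).fun_mul (hcoord hb 0))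

theorem sub_le_integral_of_ae_hasDerivAt_le {ψ g : ℝ → ℝ} {t : ℝ} (ht : 0 ≤ t)
    (hψ : AbsolutelyContinuousOnInterval ψ 0 t) (hg : IntervalIntegrable g volume 0 t)
    (h : ∀ᵐ s : ℝ, s ∈ Ioo 0 t → ∃ d, HasDerivAt ψ d s ∧ d ≤ g s) :
    ψ t - ψ 0 ≤ ∫ s in (0 : ℝ)..t, g s := by
  rw [← hψ.integral_deriv_eq_sub]
  refine intervalIntegral.integral_mono_ae_restrict ht hψ.intervalIntegrable_deriv hg ?_
  rw [EventuallyLE, ae_restrict_iff' measurableSet_Icc]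
  filter_upwards [h, Measure.ae_ne volume 0, Measure.ae_ne volume t] with s hs hs0 hst hmem
  obtain ⟨d, hd, hdg⟩ := hs ⟨lt_of_le_of_ne hmem.1 hs0.symm, lt_of_le_of_ne hmem.2 hst⟩
  rwa [hd.deriv]

end Trajectories

section ControlGap

variable {M : ℕ} {u v : ℝ → Fin M → ℝ}

/-- The `ℓ¹` distance of two controls at the time `s`. -/
def gap (u v : ℝ → Fin M → ℝ) (s : ℝ) : ℝ := ∑ i, |u s i - v s i|

/-- The first moment, on `[0,t]`, of the `ℓ¹` distance of two controls. -/
def moment (u v : ℝ → Fin M → ℝ) (t : ℝ) : ℝ := ∫ s in (0 : ℝ)..t, s * gap u v s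

theorem gap_nonneg (u v : ℝ → Fin M → ℝ) (s : ℝ) : 0 ≤ gap u v s :=
  Finset.sum_nonneg fun _ _ => abs_nonneg _

theorem gap_le (hu : IsControl u) (hv : IsControl v) : ∀ᵐ s : ℝ, gap u v s ≤ 2 * M := by
  filter_upwards [hu.2, hv.2] with s hus hvs
  calc gap u v s ≤ ∑ _i : Fin M, (2 : ℝ) := Finset.sum_le_sum fun i _ => by
        linarith [abs_sub (u s i) (v s i), abs_le_one_of_mem_cube hus i,
          abs_le_one_of_mem_cube hvs i]
    _ = 2 * M := by simp [mul_comm]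

theorem gap_intervalIntegrable (hu : IsControl u) (hv : IsControl v) (a b : ℝ) :
    IntervalIntegrable (gap u v) volume a b := by
  have hmeas : Measurable (gap u v) := by
    have := hu.1
    have := hv.1
    unfold gap
    fun_prop
  refine (intervalIntegrable_const (c := (2 * M : ℝ))).mono_fun hmeas.aestronglyMeasurable
    (ae_restrict_of_ae ?_)
  filter_upwards [gap_le hu hv] with s hs
  rw [Real.norm_eq_abs, abs_of_nonneg (gap_nonneg u v s)]
  exact hs.trans (le_abs_self _)

theorem integral_gap_le (hu : IsControl u) (hv : IsControl v) {r t : ℝ} (hrt : r ≤ t) :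
    ∫ s in r..t, gap u v s ≤ 2 * M * (t - r) :=
  calc ∫ s in r..t, gap u v s ≤ ∫ _ in r..t, (2 * M : ℝ) :=
        intervalIntegral.integral_mono_ae hrt (gap_intervalIntegrable hu hv _ _)
          intervalIntegrable_const (gap_le hu hv)
    _ = 2 * M * (t - r) := by rw [intervalIntegral.integral_const, smul_eq_mul, mul_comm]

theorem abs_integral_gap_le {k : ℝ} (hk : ∀ᵐ s : ℝ, gap u v s ≤ k) (a b : ℝ) :
    |∫ s in a..b, gap u v s| ≤ k * |b - a| := by
  rw [← Real.norm_eq_abs]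
  refine intervalIntegral.norm_integral_le_of_norm_le_const_ae ?_
  filter_upwards [hk] with s hs _
  rwa [Real.norm_eq_abs, abs_of_nonneg (gap_nonneg u v s)]

theorem moment_intervalIntegrable (hu : IsControl u) (hv : IsControl v) (a b : ℝ) :
    IntervalIntegrable (fun s => s * gap u v s) volume a b :=
  (gap_intervalIntegrable hu hv a b).continuousOn_mul continuousOn_id

theorem moment_nonneg (u v : ℝ → Fin M → ℝ) {t : ℝ} (ht : 0 ≤ t) : 0 ≤ moment u v t :=
  intervalIntegral.integral_nonneg ht fun s hs => mul_nonneg hs.1 (gap_nonneg u v s)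

theorem moment_mono (hu : IsControl u) (hv : IsControl v) {s t : ℝ} (hs : 0 ≤ s) (hst : s ≤ t) :
    moment u v s ≤ moment u v t := by
  have hint := moment_intervalIntegrable hu hv
  have htail : 0 ≤ ∫ r in s..t, r * gap u v r := intervalIntegral.integral_nonneg hst fun r hr =>
    mul_nonneg (hs.trans hr.1) (gap_nonneg u v r)
  rw [moment, moment, ← intervalIntegral.integral_add_adjacent_intervals (hint 0 s) (hint s t)]
  linarith

theorem moment_pos_of_le_gap (hu : IsControl u) (hv : IsControl v) {d t : ℝ} (hd : 0 < d)
    (hdt : d ≤ t) (h : ∀ r < d, 1 ≤ gap u v r) : 0 < moment u v t :=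
  calc 0 < ∫ s in (0 : ℝ)..d, s := by
        rw [integral_id, zero_pow two_ne_zero, sub_zero]
        positivity
    _ ≤ moment u v d := intervalIntegral.integral_mono_on_of_le_Ioo hd.le
        (continuous_id.intervalIntegrable _ _) (moment_intervalIntegrable hu hv 0 d)
        fun s hs => le_mul_of_one_le_right hs.1.le (h s hs.2)
    _ ≤ moment u v t := moment_mono hu hv hd.le hdt

theorem mul_integral_gap_le_moment (hu : IsControl u) (hv : IsControl v) {s t : ℝ}
    (hs : s ∈ Icc 0 t) : s * ∫ r in s..t, gap u v r ≤ moment u v t := by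
  have hint := moment_intervalIntegrable hu hv
  calc s * ∫ r in s..t, gap u v r = ∫ r in s..t, s * gap u v r :=
        (intervalIntegral.integral_const_mul _ _).symm
    _ ≤ ∫ r in s..t, r * gap u v r :=
        intervalIntegral.integral_mono_on hs.2 ((gap_intervalIntegrable hu hv _ _).const_mul s)
          (hint s t) fun r hr => mul_le_mul_of_nonneg_right hr.1 (gap_nonneg u v r)
    _ ≤ moment u v s + ∫ r in s..t, r * gap u v r :=
        le_add_of_nonneg_left (moment_nonneg u v hs.1)
    _ = moment u v t := intervalIntegral.integral_add_adjacent_intervals (hint 0 s) (hint s t)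

theorem mul_integral_gap_sub_le_moment (hu : IsControl u) (hv : IsControl v) {η t : ℝ}
    (hη : η ∈ Icc 0 t) :
    η * ((∫ s in (0 : ℝ)..t, gap u v s) - 2 * M * η) ≤ moment u v t := by
  have hint := gap_intervalIntegrable hu hv
  refine le_trans (mul_le_mul_of_nonneg_left ?_ hη.1) (mul_integral_gap_le_moment hu hv hη)
  have hhead := integral_gap_le hu hv hη.1
  rw [sub_zero] at hhead
  linarith [intervalIntegral.integral_add_adjacent_intervals (hint 0 η) (hint η t)]

/-- Since the gap is at most `2 * M`, a large integral cannot be concentrated near `0`. -/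
theorem sq_integral_gap_le (hu : IsControl u) (hv : IsControl v) {t : ℝ} (ht : 0 ≤ t) :
    (∫ s in (0 : ℝ)..t, gap u v s) ^ 2 ≤ 8 * M * moment u v t := by
  set q := ∫ s in (0 : ℝ)..t, gap u v s
  have hq0 : 0 ≤ q := intervalIntegral.integral_nonneg ht fun s _ => gap_nonneg u v s
  have hqt : q ≤ 2 * M * t := by simpa only [sub_zero] using integral_gap_le hu hv ht
  rcases (Nat.cast_nonneg M : (0 : ℝ) ≤ M).eq_or_lt with hM | hM
  · have hq : q = 0 := le_antisymm (by simpa [← hM] using hqt) hq0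
    simp [hq, ← hM]
  · have hη : q / (4 * M) ∈ Icc 0 t :=
      ⟨by positivity, by rw [div_le_iff₀ (by positivity)]; linarith⟩
    calc q ^ 2 = 8 * M * (q / (4 * M) * (q - 2 * M * (q / (4 * M)))) := by
          field_simp
          ring
      _ ≤ 8 * M * moment u v t := by
          gcongr
          exact mul_integral_gap_sub_le_moment hu hv hη

theorem continuous_integral_gap_left (hu : IsControl u) (hv : IsControl v) (t : ℝ) :
    Continuous fun s => ∫ r in s..t, gap u v r := by
  simp_rw [fun s => intervalIntegral.integral_symm (μ := volume) (f := gap u v) t s]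
  exact (intervalIntegral.continuous_primitive (gap_intervalIntegrable hu hv) t).neg

theorem integral_tail_gap (hu : IsControl u) (hv : IsControl v) (t : ℝ) :
    ∫ s in (0 : ℝ)..t, (∫ r in s..t, gap u v r) = moment u v t := by
  have hint := gap_intervalIntegrable hu hv
  set P : ℝ → ℝ := fun s => ∫ r in (0 : ℝ)..s, gap u v r
  have hP : AbsolutelyContinuousOnInterval P 0 t :=
    (hint 0 t).absolutelyContinuousOnInterval_intervalIntegral left_mem_uIcc
  have hid : AbsolutelyContinuousOnInterval (fun s : ℝ => s) 0 t :=
    contDiffOn_id.absolutelyContinuousOnInterval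
  have hderiv : ∫ s in (0 : ℝ)..t, s * deriv P s = moment u v t := by
    refine intervalIntegral.integral_congr_ae ?_
    filter_upwards [(hint 0 t).ae_hasDerivAt_integral] with s hs hst
    rw [(hs (uIoc_subset_uIcc hst) 0 left_mem_uIcc).deriv]
  have htail : ∀ s, ∫ r in s..t, gap u v r = P t - P s := fun s =>
    (intervalIntegral.integral_interval_sub_left (hint 0 t) (hint 0 s)).symm
  have hcont : Continuous P := intervalIntegral.continuous_primitive hint 0
  simp only [htail]
  rw [intervalIntegral.integral_sub intervalIntegrable_const (hcont.intervalIntegrable _ _),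
    ← hderiv, hid.integral_mul_deriv_eq_deriv_mul hP]
  simp

end ControlGap

section Picard

variable {M : ℕ} {f : Plane → (Fin M → ℝ) → Plane} {C : ℝ} {u v : ℝ → Fin M → ℝ} {p : Plane}
  {t : ℝ} {y : ℝ → Plane}

theorem IsControlField.norm_integral_sub_le (hf : IsControlField f C) (hu : IsControl u)
    (hv : IsControl v) {y y' : ℝ → Plane} {a b d : ℝ} (hy : ∀ s ∈ uIoc a b, ‖y s‖ ≤ 1)
    (hy' : ∀ s ∈ uIoc a b, ‖y' s‖ ≤ 1) (hd : ∀ s ∈ uIoc a b, ‖y s - y' s‖ ≤ d) :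
    ‖∫ s in a..b, (f (y s) (u s) - f (y' s) (v s))‖ ≤
      |(b - a) * (C * d) + C * ∫ s in a..b, gap u v s| := by
  have hC : 0 ≤ C := zero_le_one.trans hf.one_le
  have hgap := (gap_intervalIntegrable hu hv a b).const_mul C
  rw [← smul_eq_mul (b - a), ← intervalIntegral.integral_const,
    ← intervalIntegral.integral_const_mul, ← intervalIntegral.integral_add
      intervalIntegrable_const hgap]
  refine intervalIntegral.norm_integral_le_abs_of_norm_le ?_ (intervalIntegrable_const.add hgap)
  rw [ae_restrict_iff' measurableSet_uIoc]
  filter_upwards [hu.2] with s hus hs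
  calc _ ≤ ‖f (y s) (u s) - f (y' s) (u s)‖ + ‖f (y' s) (u s) - f (y' s) (v s)‖ :=
        norm_sub_le_norm_sub_add_norm_sub _ _ _
    _ ≤ C * ‖y s - y' s‖ + C * gap u v s :=
        add_le_add (hf.lip _ _ (hy s hs) (hy' s hs) _ hus) (hf.lip_control _ (hy' s hs) _ _)
    _ ≤ C * d + C * gap u v s := by gcongr; exact hd s hs

/-- A Gronwall estimate for times so short that it can be absorbed instead of iterated. -/
theorem norm_sub_trajectory_le (hf : IsControlField f C) (ht : C * t ≤ 1 / 2) (hu : IsControl u)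
    (hy : IsTrajectory f u p t y) (hy1 : ∀ r ∈ Icc 0 t, ‖y r‖ ≤ 1)
    (hv : IsControl v) {q : Plane} {y' : ℝ → Plane}
    (hy' : IsTrajectory f v q t y') (hy1' : ∀ r ∈ Icc 0 t, ‖y' r‖ ≤ 1)
    {r r₀ : ℝ} (hr : r ∈ Icc 0 t) (hr₀ : r₀ ∈ Icc 0 t) :
    ‖y r - y' r‖ ≤ 2 * (‖y r₀ - y' r₀‖ + C * |∫ s in r₀..r, gap u v s|) := by
  have hC : 0 ≤ C := zero_le_one.trans hf.one_le
  have hsub : uIcc r₀ r ⊆ Icc 0 t := (convex_Icc 0 t).ordConnected.uIcc_subset hr₀ hr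
  obtain ⟨m, hm, hmax⟩ := isCompact_uIcc.exists_isMaxOn nonempty_uIcc
    (((hy.1.sub hy'.1).norm).mono hsub)
  have hmt := hsub hm
  have hsub' : ∀ s ∈ uIoc r₀ m, s ∈ uIcc r₀ r := fun s hs =>
    uIcc_subset_uIcc_left hm (uIoc_subset_uIcc hs)
  set d := ‖y m - y' m‖
  have hgap : |∫ s in r₀..m, gap u v s| ≤ |∫ s in r₀..r, gap u v s| :=
    intervalIntegral.abs_integral_mono_interval
      (uIoc_subset_uIoc_of_uIcc_subset_uIcc (uIcc_subset_uIcc_left hm))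
      (Eventually.of_forall fun s => gap_nonneg u v s) (gap_intervalIntegrable hu hv _ _)
  have hint : y m - y' m = (y r₀ - y' r₀) + ∫ s in r₀..m, (f (y s) (u s) - f (y' s) (v s)) := by
    rw [intervalIntegral.integral_sub (hf.intervalIntegrable hu hy.1 hr₀ hmt)
      (hf.intervalIntegrable hv hy'.1 hr₀ hmt), ← hy.sub_eq hf hu hr₀ hmt,
      ← hy'.sub_eq hf hv hr₀ hmt]
    abel
  have hlength : |m - r₀| ≤ t := by
    rw [abs_le]; constructor <;> linarith [hmt.1, hmt.2, hr₀.1, hr₀.2]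
  have hbound : ‖∫ s in r₀..m, (f (y s) (u s) - f (y' s) (v s))‖ ≤
      1 / 2 * d + C * |∫ s in r₀..r, gap u v s| :=
    calc _ ≤ |(m - r₀) * (C * d) + C * ∫ s in r₀..m, gap u v s| :=
          hf.norm_integral_sub_le hu hv (fun s hs => hy1 s (hsub (hsub' s hs)))
            (fun s hs => hy1' s (hsub (hsub' s hs))) fun s hs => hmax (hsub' s hs)
      _ ≤ |m - r₀| * (C * d) + C * |∫ s in r₀..m, gap u v s| := by
          refine (abs_add_le _ _).trans_eq ?_
          rw [abs_mul, abs_of_nonneg (by positivity : 0 ≤ C * d), abs_mul, abs_of_nonneg hC]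
      _ ≤ t * (C * d) + C * |∫ s in r₀..r, gap u v s| := by gcongr
      _ = C * t * d + C * |∫ s in r₀..r, gap u v s| := by ring
      _ ≤ _ := by gcongr
  have hd : d ≤ ‖y r₀ - y' r₀‖ + ‖∫ s in r₀..m, (f (y s) (u s) - f (y' s) (v s))‖ :=
    (congrArg norm hint).trans_le (norm_add_le _ _)
  have hrm : ‖y r - y' r‖ ≤ d := hmax right_mem_uIcc
  linarith

/-- The curves on `[0,t]` in the unit ball, the space of the Picard iteration. -/
abbrev BallCurve (t : ℝ) : Type := C(Icc (0 : ℝ) t, Metric.closedBall (0 : Plane) 1)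

/-- The extension of a curve on `[0,t]` to the real line, constant on either side. -/
def BallCurve.extend (ht : 0 ≤ t) (x : BallCurve t) (s : ℝ) : Plane := x (projIcc 0 t ht s)

theorem BallCurve.norm_extend_le (ht : 0 ≤ t) (x : BallCurve t) (s : ℝ) : ‖x.extend ht s‖ ≤ 1 :=
  mem_closedBall_zero_iff.1 (x (projIcc 0 t ht s)).2

theorem BallCurve.continuous_extend (ht : 0 ≤ t) (x : BallCurve t) : Continuous (x.extend ht) :=
  continuous_subtype_val.comp (x.continuous.comp continuous_projIcc)

theorem BallCurve.norm_extend_sub_le (ht : 0 ≤ t) (x x' : BallCurve t) (s : ℝ) :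
    ‖x.extend ht s - x'.extend ht s‖ ≤ dist x x' := by
  rw [← dist_eq_norm]
  exact ContinuousMap.dist_apply_le_dist (f := x) (g := x') (projIcc 0 t ht s)

theorem IsControlField.intervalIntegrable_extend (hf : IsControlField f C) (hu : IsControl u)
    (ht : 0 ≤ t) (x : BallCurve t) (r : Icc (0 : ℝ) t) :
    IntervalIntegrable (fun s => f (x.extend ht s) (u s)) volume 0 r :=
  hf.intervalIntegrable hu (x.continuous_extend ht).continuousOn ⟨le_rfl, ht⟩ r.2

theorem IsControlField.exists_picardMap (hf : IsControlField f C) (hu : IsControl u) (ht : 0 ≤ t)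
    (hp : ‖p‖ + C * t ≤ 1) :
    ∃ Φ : BallCurve t → BallCurve t,
      ∀ x r, (Φ x r : Plane) = p + ∫ s in (0 : ℝ)..r, f (x.extend ht s) (u s) := by
  have hC : 0 ≤ C := zero_le_one.trans hf.one_le
  have hle : ∀ (x : BallCurve t) (r r' : ℝ),
      ‖∫ s in r..r', f (x.extend ht s) (u s)‖ ≤ C * |r' - r| := fun x r r' => by
    refine intervalIntegral.norm_integral_le_of_norm_le_const_ae ?_
    filter_upwards [hu.2] with s hs _
    exact hf.norm_le _ (x.norm_extend_le ht s) _ hs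
  have hball : ∀ (x : BallCurve t) (r : Icc (0 : ℝ) t),
      p + ∫ s in (0 : ℝ)..r, f (x.extend ht s) (u s) ∈ Metric.closedBall (0 : Plane) 1 :=
    fun x r => by
    rw [mem_closedBall_zero_iff]
    calc _ ≤ ‖p‖ + C * |(r : ℝ) - 0| := norm_add_le_of_le le_rfl (hle x 0 r)
      _ ≤ ‖p‖ + C * t := by rw [sub_zero, abs_of_nonneg r.2.1]; gcongr; exact r.2.2
      _ ≤ 1 := hp
  have hcont : ∀ x : BallCurve t, Continuous
      fun r : Icc (0 : ℝ) t => p + ∫ s in (0 : ℝ)..r, f (x.extend ht s) (u s) := fun x => by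
    refine (LipschitzWith.of_dist_le_mul (K := C.toNNReal) fun r r' => ?_).continuous
    rw [dist_eq_norm, Real.coe_toNNReal C hC, Subtype.dist_eq, Real.dist_eq,
      add_sub_add_left_eq_sub, intervalIntegral.integral_interval_sub_left
        (hf.intervalIntegrable_extend hu ht x r) (hf.intervalIntegrable_extend hu ht x r')]
    exact hle x r' r
  exact ⟨fun x => ⟨fun r => ⟨_, hball x r⟩, (hcont x).subtype_mk _⟩, fun x r => rfl⟩

theorem IsControlField.dist_picardMap_le (hf : IsControlField f C) (hu : IsControl u)
    (ht : 0 ≤ t) (hCt : C * t ≤ 1 / 2) {Φ : BallCurve t → BallCurve t}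
    (hΦ : ∀ x r, (Φ x r : Plane) = p + ∫ s in (0 : ℝ)..r, f (x.extend ht s) (u s))
    (x x' : BallCurve t) : dist (Φ x) (Φ x') ≤ 1 / 2 * dist x x' := by
  have hC : 0 ≤ C := zero_le_one.trans hf.one_le
  refine (ContinuousMap.dist_le (by positivity)).2 fun r => ?_
  have hr : 0 ≤ (r : ℝ) := r.2.1
  rw [Subtype.dist_eq, dist_eq_norm, hΦ, hΦ, add_sub_add_left_eq_sub,
    ← intervalIntegral.integral_sub (hf.intervalIntegrable_extend hu ht x r)
      (hf.intervalIntegrable_extend hu ht x' r)]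
  calc _ ≤ |((r : ℝ) - 0) * (C * dist x x') + C * ∫ s in (0 : ℝ)..r, gap u u s| :=
        hf.norm_integral_sub_le hu hu (fun s _ => x.norm_extend_le ht s)
          (fun s _ => x'.norm_extend_le ht s) fun s _ => x.norm_extend_sub_le ht x' s
    _ = C * r * dist x x' := by
        simp only [gap, sub_self, abs_zero, Finset.sum_const_zero, sub_zero,
          intervalIntegral.integral_zero, mul_zero, add_zero]
        rw [abs_of_nonneg (by positivity)]
        ring
    _ ≤ C * t * dist x x' := by gcongr; exact r.2.2
    _ ≤ _ := by gcongr

theorem exists_trajectory (hf : IsControlField f C) (hu : IsControl u) (ht : 0 ≤ t)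
    (hCt : C * t ≤ 1 / 2) (hp : ‖p‖ + C * t ≤ 1) :
    ∃ y : ℝ → Plane, Continuous y ∧ IsTrajectory f u p t y := by
  have hC : 0 ≤ C := zero_le_one.trans hf.one_le
  obtain ⟨Φ, hΦ⟩ := hf.exists_picardMap hu ht hp
  have hcontract : ContractingWith (1 / 2) Φ :=
    ⟨by rw [← NNReal.coe_lt_coe]; norm_num, LipschitzWith.of_dist_le_mul fun x x' => by
      simpa using hf.dist_picardMap_le hu ht hCt hΦ x x'⟩
  have hp1 : p ∈ Metric.closedBall (0 : Plane) 1 :=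
    mem_closedBall_zero_iff.2 (by linarith [mul_nonneg hC ht])
  have : Nonempty (BallCurve t) := ⟨ContinuousMap.const _ ⟨p, hp1⟩⟩
  have : CompleteSpace (Metric.closedBall (0 : Plane) 1) :=
    Metric.isClosed_closedBall.completeSpace_coe
  set x : BallCurve t := ContractingWith.fixedPoint Φ hcontract
  refine ⟨x.extend ht, x.continuous_extend ht, (x.continuous_extend ht).continuousOn,
    fun r hr => ?_⟩
  rw [← hΦ x ⟨r, hr⟩, hcontract.fixedPoint_isFixedPt.eq, BallCurve.extend, projIcc_of_mem ht hr]

end Picard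

/-! ### Steering and Lipschitz points -/

section Steering

variable {M : ℕ} {F : Plane → Plane} {G : Fin M → Plane → Plane} {A : Plane →L[ℝ] Plane}
  {B : Fin M → Plane} {C : ℝ}

/-- The dynamics with time reversed. -/
def revDynamics (F : Plane → Plane) (G : Fin M → Plane → Plane) (z : Plane) (w : Fin M → ℝ) :
    Plane := -dynamics F G z w

theorem SystemBounds.isControlField_rev (h : SystemBounds F G A B C) :
    IsControlField (revDynamics F G) C := h.isControlField.neg

theorem isControl_zero : IsControl fun _ : ℝ => (0 : Fin M → ℝ) :=
  isControl_const (mem_cube_of_abs_le_one (by simp))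

theorem isTrajectory_zero {f : Plane → (Fin M → ℝ) → Plane} (hf : f 0 0 = 0) (t : ℝ) :
    IsTrajectory f (fun _ => 0) 0 t fun _ => 0 :=
  ⟨continuousOn_const, fun r _ => by simp [hf]⟩

theorem Steers.exists_rev (h : SystemBounds F G A B C) {x : Plane} {t : ℝ} (hx : Steers F G x t) :
    ∃ u : ℝ → Fin M → ℝ, IsControl u ∧
      ∃ y : ℝ → Plane, IsTrajectory (revDynamics F G) u 0 t y ∧ y t = x := by
  obtain ⟨ht, u, hu, y, hy, hyt⟩ := hx
  exact ⟨_, hu.comp_sub_left t, _, hyt ▸ hy.reverse h.isControlField hu ht,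
    by simp [hy.apply_zero ht]⟩

theorem steers_of_rev (h : SystemBounds F G A B C) {u : ℝ → Fin M → ℝ} (hu : IsControl u)
    {p : Plane} {t : ℝ} (ht : 0 ≤ t) {y : ℝ → Plane}
    (hy : IsTrajectory (revDynamics F G) u p t y) {s : ℝ} (hp : Steers F G p s) :
    Steers F G (y t) (t + s) := by
  obtain ⟨hs, v, hv, z, hz, hzs⟩ := hp
  have hback : IsTrajectory (dynamics F G) (fun s => u (t - s)) (y t) t (fun s => y (t - s)) := by
    simpa [revDynamics] using hy.reverse h.isControlField_rev hu ht
  have hz' : IsTrajectory (dynamics F G) v (y (t - t)) s z := by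
    rwa [sub_self, hy.apply_zero ht]
  refine ⟨by linarith, _, (hu.comp_sub_left t).ite (hv.comp_sub_right t) t, _,
    hback.concat h.isControlField (hu.comp_sub_left t) ht hs hv hz', ?_⟩
  split_ifs with hle
  · obtain rfl : s = 0 := by linarith
    simp only [add_zero, sub_self]
    rw [hy.apply_zero ht, ← hzs, hz.apply_zero le_rfl]
  · simpa using hzs

theorem steers_of_rev_zero (h : SystemBounds F G A B C) {u : ℝ → Fin M → ℝ} (hu : IsControl u)
    {t : ℝ} (ht : 0 ≤ t) {y : ℝ → Plane} (hy : IsTrajectory (revDynamics F G) u 0 t y) :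
    Steers F G (y t) t := by
  have hzero : Steers F G 0 0 := ⟨le_rfl, _, isControl_zero, _,
    isTrajectory_zero (by simp [dynamics, h.F_zero]) 0, rfl⟩
  simpa using steers_of_rev h hu ht hy hzero

/-- One may wait at the origin before following a trajectory of the reversed dynamics. -/
theorem Steers.exists_rev_wait (h : SystemBounds F G A B C) {x : Plane} {s t : ℝ}
    (hx : Steers F G x s) (hst : s ≤ t) :
    ∃ u : ℝ → Fin M → ℝ, IsControl u ∧ (∀ r < t - s, u r = 0) ∧
      ∃ y : ℝ → Plane, IsTrajectory (revDynamics F G) u 0 t y ∧ y t = x := by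
  obtain ⟨v, hv, z, hz, hzs⟩ := hx.exists_rev h
  have hconcat := IsTrajectory.concat h.isControlField_rev isControl_zero (by linarith) hx.1
    (isTrajectory_zero (by simp [revDynamics, dynamics, h.F_zero]) (t - s)) hv hz
  rw [sub_add_cancel] at hconcat
  refine ⟨_, isControl_zero.ite (hv.comp_sub_right (t - s)) (t - s), fun r hr => by simp [hr],
    _, hconcat, ?_⟩
  split_ifs with hle
  · obtain rfl : s = 0 := by linarith [hx.1]
    rw [← hzs, hz.apply_zero le_rfl]
  · simpa using hzs

theorem Steers.mono (h : SystemBounds F G A B C) {x : Plane} {s t : ℝ} (hx : Steers F G x s)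
    (hst : s ≤ t) : Steers F G x t := by
  obtain ⟨u, hu, -, y, hy, rfl⟩ := hx.exists_rev_wait h hst
  exact steers_of_rev_zero h hu (hx.1.trans hst) hy

theorem Steers.norm_le (h : SystemBounds F G A B C) {x : Plane} {t : ℝ} (hx : Steers F G x t)
    (ht : C * t < 1) : ‖x‖ ≤ C * t := by
  obtain ⟨u, hu, y, hy, rfl⟩ := hx.exists_rev h
  simpa using hy.norm_le h.isControlField_rev hu (by simpa using ht) (r := t) ⟨hx.1, le_rfl⟩

theorem mem_reachable_iff (h : SystemBounds F G A B C) {x : Plane} {t : ℝ} :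
    x ∈ reachable F G t ↔ Steers F G x t :=
  ⟨fun ⟨_, hs, hx⟩ => hx.mono h hs, fun hx => ⟨t, le_rfl, hx⟩⟩

theorem Steers.minTime_le {x : Plane} {t : ℝ} (hx : Steers F G x t) :
    minTime F G x ≤ ENNReal.ofReal t := iInf₂_le t hx

theorem Steers.minTime_ne_top {x : Plane} {t : ℝ} (hx : Steers F G x t) :
    minTime F G x ≠ ⊤ := (hx.minTime_le.trans_lt ENNReal.ofReal_lt_top).ne

theorem Steers.toReal_minTime_le {x : Plane} {t : ℝ} (hx : Steers F G x t) :
    (minTime F G x).toReal ≤ t :=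
  ENNReal.toReal_le_of_le_ofReal hx.1 hx.minTime_le

theorem exists_steers_lt {x : Plane} (hx : minTime F G x ≠ ⊤) {t : ℝ}
    (ht : (minTime F G x).toReal < t) : ∃ s < t, Steers F G x s := by
  have hlt : minTime F G x < ENNReal.ofReal t := (ENNReal.lt_ofReal_iff_toReal_lt hx).2 ht
  simp only [minTime, iInf_lt_iff] at hlt
  obtain ⟨s, hs, hst⟩ := hlt
  exact ⟨s, (ENNReal.ofReal_lt_ofReal_iff_of_nonneg hs.1).1 hst, hs⟩

end Steering

section LipschitzNear

/-- `f` is Lipschitz on the part of its domain `{f < ⊤}` near `x`. -/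
def LipschitzNear (f : Plane → ℝ≥0∞) (x : Plane) : Prop :=
  ∃ ε > 0, ∃ K : ℝ, 0 ≤ K ∧ ∀ a b : Plane, ‖a - x‖ < ε → ‖b - x‖ < ε → f a ≠ ⊤ → f b ≠ ⊤ →
    |(f b).toReal - (f a).toReal| ≤ K * ‖b - a‖

variable {f : Plane → ℝ≥0∞} {x : Plane}

theorem NonLipschitzAt.not_lipschitzNear (hf : NonLipschitzAt f x) : ¬LipschitzNear f x := by
  obtain ⟨a, b, hne, ha, hb, hax, hbx, hlim⟩ := hf
  rintro ⟨ε, hε, K, -, hlip⟩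
  have hle : limsup (fun i => ((|(f (b i)).toReal - (f (a i)).toReal| / ‖b i - a i‖ : ℝ) : EReal))
      atTop ≤ (K : EReal) := by
    refine limsup_le_of_le (h := ?_)
    filter_upwards [hax (Metric.ball_mem_nhds x hε), hbx (Metric.ball_mem_nhds x hε)]
      with i hai hbi
    have hpos : 0 < ‖b i - a i‖ := norm_pos_iff.2 (sub_ne_zero.2 (hne i).symm)
    exact_mod_cast (div_le_iff₀ hpos).2
      (hlip (a i) (b i) (mem_ball_iff_norm.1 hai) (mem_ball_iff_norm.1 hbi) (ha i) (hb i))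
  exact not_le.2 (EReal.coe_lt_top K) (hlim ▸ hle)

theorem nonLipschitzAt_of_not_lipschitzNear (hf : ¬LipschitzNear f x) : NonLipschitzAt f x := by
  unfold LipschitzNear at hf
  push Not at hf
  choose a b ha hb hfa hfb hlt using
    fun n : ℕ => hf (1 / ((n : ℝ) + 1)) (by positivity) n n.cast_nonneg
  have hne : ∀ n, a n ≠ b n := fun n he => by simpa [he] using hlt n
  have htendsto : ∀ c : ℕ → Plane, (∀ n : ℕ, ‖c n - x‖ < 1 / ((n : ℝ) + 1)) →
      Tendsto c atTop (𝓝 x) := fun c hc => tendsto_iff_norm_sub_tendsto_zero.2 <|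
    squeeze_zero (fun _ => norm_nonneg _) (fun n => (hc n).le)
      tendsto_one_div_add_atTop_nhds_zero_nat
  refine ⟨a, b, hne, hfa, hfb, htendsto a ha, htendsto b hb, Tendsto.limsup_eq ?_⟩
  rw [EReal.tendsto_nhds_top_iff_real]
  intro K
  obtain ⟨N, hN⟩ := exists_nat_gt K
  filter_upwards [eventually_ge_atTop N] with n hn
  have hpos : 0 < ‖b n - a n‖ := norm_pos_iff.2 (sub_ne_zero.2 (hne n).symm)
  exact_mod_cast (hN.trans_le (Nat.cast_le.2 hn)).trans ((lt_div_iff₀ hpos).2 (hlt n))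

theorem nonLipschitzAt_iff : NonLipschitzAt f x ↔ ¬LipschitzNear f x :=
  ⟨NonLipschitzAt.not_lipschitzNear, nonLipschitzAt_of_not_lipschitzNear⟩

end LipschitzNear

section SingularPoints

variable {M : ℕ} {F : Plane → Plane} {G : Fin M → Plane → Plane} {A : Plane →L[ℝ] Plane}
  {B : Fin M → Plane} {C : ℝ}

theorem minHamiltonian_le (h : SystemBounds F G A B C) (x p : Plane) {w : Fin M → ℝ}
    (hw : w ∈ Icc (-1 : Fin M → ℝ) 1) :
    minHamiltonian F G x p ≤ inner ℝ p (dynamics F G x w) :=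
  csInf_le (isCompact_Icc.image (continuous_const.inner
    (h.isControlField.cont.comp (Continuous.prodMk_right x)))).bddBelow ⟨w, hw, rfl⟩

theorem inner_revDynamics_le (h : SystemBounds F G A B C) {x y ζ : Plane} (hζ : ‖ζ‖ = 1)
    (hH : 0 ≤ minHamiltonian F G x ζ) (hx : ‖x‖ ≤ 1) (hy : ‖y‖ ≤ 1) {w : Fin M → ℝ}
    (hw : w ∈ Icc (-1 : Fin M → ℝ) 1) : inner ℝ ζ (revDynamics F G y w) ≤ C * ‖y - x‖ := by
  have hlip := h.lip x y hx hy w hw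
  have hinner := real_inner_le_norm ζ (dynamics F G x w - dynamics F G y w)
  rw [hζ, one_mul, inner_sub_right] at hinner
  rw [norm_sub_rev] at hlip
  rw [norm_sub_rev y x, revDynamics, inner_neg_right]
  rw [norm_sub_rev] at hlip
  linarith [minHamiltonian_le h x ζ hw]

theorem inner_sub_le_of_minHamiltonian_nonneg (h : SystemBounds F G A B C) {x ζ : Plane}
    (hζ : ‖ζ‖ = 1) (hH : 0 ≤ minHamiltonian F G x ζ) (hx : ‖x‖ ≤ 1) {u : ℝ → Fin M → ℝ}
    (hu : IsControl u) {p : Plane} {T : ℝ} {y : ℝ → Plane}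
    (hy : IsTrajectory (revDynamics F G) u p T y) {t : ℝ} (ht : 0 ≤ t) (htT : t ≤ T) {d : ℝ}
    (hd : ∀ r ∈ Icc t T, ‖y r‖ ≤ 1 ∧ ‖y r - x‖ ≤ d) :
    (inner ℝ ζ (y T - y t) : ℝ) ≤ (T - t) * (C * d) := by
  have hC : 0 ≤ C := zero_le_one.trans h.one_le
  have htm : t ∈ Icc 0 T := ⟨ht, htT⟩
  have hTm : T ∈ Icc 0 T := ⟨ht.trans htT, le_rfl⟩
  have hint := h.isControlField_rev.intervalIntegrable hu hy.1 htm hTm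
  rw [hy.sub_eq h.isControlField_rev hu htm hTm, ← innerSL_apply_apply ℝ,
    ← ContinuousLinearMap.intervalIntegral_comp_comm _ hint, ← smul_eq_mul (T - t),
    ← intervalIntegral.integral_const]
  refine intervalIntegral.integral_mono_ae_restrict htT
    ⟨(innerSL ℝ ζ).integrable_comp hint.1, (innerSL ℝ ζ).integrable_comp hint.2⟩
    intervalIntegrable_const ?_
  rw [EventuallyLE, ae_restrict_iff' measurableSet_Icc]
  filter_upwards [hu.2] with r hur hr
  calc _ ≤ C * ‖y r - x‖ := inner_revDynamics_le h hζ hH hx (hd r hr).1 hur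
    _ ≤ C * d := by gcongr; exact (hd r hr).2

/-- A point `z` steered in the time `t + s` lies on a reversed trajectory through a point of
`reachable F G t`, which the proximal inequality at `x` controls; along the remaining time `s`, the
vanishing Hamiltonian makes the trajectory move by `O(s²)` only in the direction `ζ`. -/
theorem inner_sub_le_of_mem_proximalNormals (h : SystemBounds F G A B C) {x z ζ : Plane}
    (hζ : ‖ζ‖ = 1) (hH : 0 ≤ minHamiltonian F G x ζ) (hx : ‖x‖ ≤ 1) {t s σ : ℝ} (ht : 0 ≤ t)
    (hs : 0 ≤ s) (hCt : C * (t + s) < 1) (hσ : 0 ≤ σ)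
    (hprox : ∀ y ∈ reachable F G t, inner ℝ ζ (y - x) ≤ σ * ‖y - x‖ ^ 2)
    (hz : Steers F G z (t + s)) :
    inner ℝ ζ (z - x) ≤ s * (C * (‖z - x‖ + C * s)) + σ * (‖z - x‖ + C * s) ^ 2 := by
  have hC : 0 ≤ C := zero_le_one.trans h.one_le
  obtain ⟨u, hu, y, hy, rfl⟩ := hz.exists_rev h
  have hball : ‖(0 : Plane)‖ + C * (t + s) < 1 := by simpa using hCt
  have hnear : ∀ r ∈ Icc t (t + s),
      ‖y r‖ ≤ 1 ∧ ‖y r - x‖ ≤ ‖y (t + s) - x‖ + C * s := fun r hr => by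
    have hr' : r ∈ Icc 0 (t + s) := ⟨ht.trans hr.1, hr.2⟩
    refine ⟨(hy.norm_lt_one h.isControlField_rev hu hball hr').le, ?_⟩
    have hmove := hy.norm_sub_le h.isControlField_rev hu hball hr' ⟨by linarith, le_rfl⟩
    rw [abs_of_nonneg (by linarith [hr.2]), norm_sub_rev] at hmove
    calc ‖y r - x‖ ≤ ‖y r - y (t + s)‖ + ‖y (t + s) - x‖ := norm_sub_le_norm_sub_add_norm_sub _ _ _
      _ ≤ C * (t + s - r) + ‖y (t + s) - x‖ := by gcongr
      _ ≤ C * s + ‖y (t + s) - x‖ := by gcongr; linarith [hr.1]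
      _ = _ := add_comm _ _
  have hlast := inner_sub_le_of_minHamiltonian_nonneg h hζ hH hx hu hy ht (by linarith) hnear
  rw [add_sub_cancel_left] at hlast
  have hfirst : inner ℝ ζ (y t - x) ≤ σ * (‖y (t + s) - x‖ + C * s) ^ 2 :=
    (hprox _ ⟨t, le_rfl, steers_of_rev_zero h hu ht (hy.mono (by linarith))⟩).trans
      (by gcongr; exact (hnear t ⟨le_rfl, by linarith⟩).2)
  rw [← sub_add_sub_cancel (y (t + s)) (y t) x, inner_add_right, sub_add_sub_cancel]
  exact add_le_add hlast hfirst

theorem not_lipschitzNear_of_mem_singularSet (h : SystemBounds F G A B C) {τ : ℝ}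
    (hτ : C * τ ≤ 1 / 2) {x : Plane} (hx : x ∈ singularSet F G τ) {ρ : ℝ} (hρ : 0 < ρ)
    (hfin : ∀ b, ‖b - x‖ < ρ → minTime F G b ≠ ⊤) : ¬LipschitzNear (minTime F G) x := by
  rintro ⟨ε₀, hε₀, K, hK, hlip⟩
  obtain ⟨hxτ, ζ, hζ, ⟨-, σ, hσ, hprox⟩, hH⟩ := hx
  have hC : 0 ≤ C := zero_le_one.trans h.one_le
  rw [mem_reachable_iff h] at hxτ
  set t := (minTime F G x).toReal
  have hCt : C * t ≤ 1 / 2 := (mul_le_mul_of_nonneg_left hxτ.toReal_minTime_le hC).trans hτ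
  have hxn : ‖x‖ ≤ 1 := by linarith [hxτ.norm_le h (by linarith)]
  set k := K + 1
  set Q := k * (C * (1 + C * k)) + σ * (1 + C * k) ^ 2
  obtain ⟨ε, hε, hεε₀, hερ, hεk, hεQ⟩ :
      ∃ ε > 0, ε < ε₀ ∧ ε < ρ ∧ C * (k * ε) < 1 / 2 ∧ ε * Q < 1 := by
    have hsmall : ∀ᶠ ε : ℝ in 𝓝 0, ε < ε₀ ∧ ε < ρ ∧ C * (k * ε) < 1 / 2 ∧ ε * Q < 1 :=
      (eventually_lt_nhds hε₀).and <| (eventually_lt_nhds hρ).and <|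
        (ContinuousAt.eventually_lt (by fun_prop) continuousAt_const (by norm_num)).and <|
          ContinuousAt.eventually_lt (by fun_prop) continuousAt_const (by norm_num)
    exact ((eventually_mem_nhdsWithin (s := Ioi 0)).and
      (hsmall.filter_mono nhdsWithin_le_nhds)).exists
  set z := x + ε • ζ with hz
  have hzx : ‖z - x‖ = ε := by simp [hz, norm_smul, hζ, abs_of_pos hε]
  have hinner : (inner ℝ ζ (z - x) : ℝ) = ε := by simp [hz, inner_smul_right, hζ]
  have hzfin := hfin z (hzx.trans_lt hερ)
  have hTz : (minTime F G z).toReal ≤ t + K * ε := by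
    have hxz := hlip x z (by simpa using hε₀) (hzx.trans_lt hεε₀) hxτ.minTime_ne_top hzfin
    rw [hzx] at hxz
    linarith [(abs_le.1 hxz).2]
  obtain ⟨s, hst, hs⟩ := exists_steers_lt hzfin (t := t + k * ε) (by linarith)
  have hbound := inner_sub_le_of_mem_proximalNormals h hζ hH.ge hxn ENNReal.toReal_nonneg
    (by positivity : 0 ≤ k * ε) (by rw [mul_add]; linarith) hσ hprox (hs.mono h hst.le)
  rw [hinner, hzx] at hbound
  have : ε ≤ ε * (ε * Q) := hbound.trans_eq (by ring)
  nlinarith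

end SingularPoints

section SteerStable

variable {M : ℕ} {F : Plane → Plane} {G : Fin M → Plane → Plane}

/-- A uniform steering estimate at `x`: every point near `x` can be steered to the origin from the
time in which a neighbour can be steered, with a delay at most linear in the distance. -/
def SteerStable (F : Plane → Plane) (G : Fin M → Plane → Plane) (T : ℝ) (x : Plane) : Prop :=
  ∃ ρ > 0, ∃ K : ℝ, 0 ≤ K ∧ ∀ a b : Plane, ‖a - x‖ < ρ → ‖b - x‖ < ρ → ∀ t ≤ T, Steers F G a t →
    ∃ s ≤ t + K * ‖b - a‖, Steers F G b s

theorem SteerStable.lipschitzNear {T τ : ℝ} (hτ : τ < T) {x : Plane} (hx : Steers F G x τ)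
    (hs : SteerStable F G T x) : LipschitzNear (minTime F G) x := by
  obtain ⟨ρ, hρ, K, hK, hsteer⟩ := hs
  set δ := min ρ ((T - τ) / (K + 1))
  have hδ : 0 < δ := lt_min hρ (div_pos (sub_pos.2 hτ) (by linarith))
  have hle : ∀ a b : Plane, ‖a - x‖ < δ → ‖b - x‖ < δ → minTime F G a ≠ ⊤ →
      (minTime F G b).toReal ≤ (minTime F G a).toReal + K * ‖b - a‖ := by
    intro a b ha hb hfa
    obtain ⟨haρ, haT⟩ := lt_min_iff.1 ha
    have hT : (minTime F G a).toReal < T := by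
      obtain ⟨s, hs, hsa⟩ := hsteer x a (by simpa using hρ) haρ τ hτ.le hx
      rw [lt_div_iff₀ (by linarith)] at haT
      linarith [hsa.toReal_minTime_le, norm_nonneg (a - x)]
    refine le_of_forall_pos_lt_add fun ε hε => ?_
    obtain ⟨t, ht, hta⟩ := exists_steers_lt hfa (t := min T ((minTime F G a).toReal + ε))
      (lt_min hT (by linarith))
    obtain ⟨htT, htε⟩ := lt_min_iff.1 ht
    obtain ⟨s, hs, hsb⟩ := hsteer a b haρ (lt_min_iff.1 hb).1 t htT.le hta
    linarith [hsb.toReal_minTime_le]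
  refine ⟨δ, hδ, K, hK, fun a b ha hb hfa hfb => abs_le.2 ⟨?_, ?_⟩⟩
  · linarith [norm_sub_rev a b ▸ hle b a hb ha hfb]
  · linarith [hle a b ha hb hfa]

theorem SteerStable.exists_forall_minTime_ne_top {T τ : ℝ} (hτ : τ ≤ T) {x : Plane}
    (hx : Steers F G x τ) (hs : SteerStable F G T x) :
    ∃ ρ > 0, ∀ b, ‖b - x‖ < ρ → minTime F G b ≠ ⊤ := by
  obtain ⟨ρ, hρ, K, -, hsteer⟩ := hs
  refine ⟨ρ, hρ, fun b hb => ?_⟩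
  obtain ⟨s, -, hsb⟩ := hsteer x b (by simpa using hρ) hb τ hτ hx
  exact hsb.minTime_ne_top

end SteerStable

/-! ### Extremals of parallel control fields -/

section LiouvilleFormula

variable {V : Plane → Plane} {X : ℝ → Plane}

/-- The factor `exp (-∫ div V)` along the integral curve `X` of `V`, which by Liouville's formula
compensates the change of area under the flow of `V`. -/
def integratingFactor (V : Plane → Plane) (X : ℝ → Plane) (s : ℝ) : ℝ :=
  Real.exp (-∫ r in (0 : ℝ)..s, planeTrace (fderiv ℝ V (X r)))

theorem continuous_planeTrace_fderiv_comp (hV : ContDiff ℝ 1 V) (hX : Continuous X) :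
    Continuous fun s => planeTrace (fderiv ℝ V (X s)) :=
  continuous_planeTrace.comp ((hV.continuous_fderiv one_ne_zero).comp hX)

theorem hasDerivAt_integratingFactor (hV : ContDiff ℝ 1 V) (hX : Continuous X) (s : ℝ) :
    HasDerivAt (integratingFactor V X)
      (integratingFactor V X s * -planeTrace (fderiv ℝ V (X s))) s :=
  ((continuous_planeTrace_fderiv_comp hV hX).integral_hasStrictDerivAt 0
    s).hasDerivAt.fun_neg.exp

theorem contDiff_integratingFactor (hV : ContDiff ℝ 1 V) (hX : Continuous X) :
    ContDiff ℝ 1 (integratingFactor V X) := by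
  have hderiv := hasDerivAt_integratingFactor hV hX
  have hcont : Continuous (integratingFactor V X) :=
    continuous_iff_continuousAt.2 fun s => (hderiv s).continuousAt
  rw [contDiff_one_iff_deriv, funext fun s => (hderiv s).deriv]
  exact ⟨fun s => (hderiv s).differentiableAt,
    hcont.mul (continuous_planeTrace_fderiv_comp hV hX).neg⟩

theorem integratingFactor_mem_Icc {C s : ℝ} (hs : 0 ≤ s) (hCs : C * s ≤ 1 / 4)
    (hC : ∀ r ∈ Icc 0 s, ‖fderiv ℝ V (X r)‖ ≤ C) :
    integratingFactor V X s ∈ Icc (1 / 2) 2 := by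
  rw [integratingFactor]
  set I := ∫ r in (0 : ℝ)..s, planeTrace (fderiv ℝ V (X r))
  have hI : |I| ≤ 1 / 2 := by
    have hle : ‖I‖ ≤ 2 * C * |s - 0| := by
      refine intervalIntegral.norm_integral_le_of_norm_le_const fun r hr => ?_
      rw [uIoc_of_le hs] at hr
      exact (abs_planeTrace_le _).trans (by gcongr; exact hC r (Ioc_subset_Icc_self hr))
    rw [sub_zero, abs_of_nonneg hs, Real.norm_eq_abs] at hle
    linarith
  obtain ⟨hlow, hup⟩ := abs_le.1 hI
  constructor
  · linarith [Real.add_one_le_exp (-I)]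
  · rw [Real.exp_neg]
    exact inv_le_of_inv_le₀ two_pos (by linarith [Real.add_one_le_exp I])

theorem hasDerivAt_integratingFactor_mul_wedge (hV : ContDiff ℝ 1 V) (hXc : Continuous X)
    {z : ℝ → Plane} {z' : Plane} {s : ℝ} (hX : HasDerivAt X (V (X s)) s)
    (hz : HasDerivAt z z' s) :
    HasDerivAt (fun r => integratingFactor V X r * wedge (V (X r)) (z r))
      (integratingFactor V X s * wedge (V (X s)) (z' - fderiv ℝ V (X s) (z s))) s := by
  have hVX : HasDerivAt (fun r => V (X r)) (fderiv ℝ V (X s) (V (X s))) s :=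
    (hV.differentiable one_ne_zero (X s)).hasFDerivAt.comp_hasDerivAt s hX
  refine ((hasDerivAt_integratingFactor hV hXc s).fun_mul
    (hasDerivAt_wedge hVX hz)).congr_deriv ?_
  rw [map_sub]
  linear_combination integratingFactor V X s *
    wedge_map_left_add_wedge_map_right (fderiv ℝ V (X s)) (V (X s)) (z s)

end LiouvilleFormula

section RevDynamics

variable {M : ℕ} {F : Plane → Plane} {G : Fin M → Plane → Plane} {A : Plane →L[ℝ] Plane}
  {B : Fin M → Plane} {C : ℝ} {w : Fin M → ℝ}

theorem SystemBounds.contDiff_revDynamics (h : SystemBounds F G A B C) :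
    ContDiff ℝ 1 fun x => revDynamics F G x w := by
  have := h.F_contDiff
  have := h.G_contDiff
  simp only [revDynamics, dynamics]
  fun_prop

theorem SystemBounds.norm_fderiv_revDynamics_le (h : SystemBounds F G A B C)
    (hw : w ∈ Icc (-1 : Fin M → ℝ) 1) {x : Plane} (hx : ‖x‖ < 1) :
    ‖fderiv ℝ (fun x => revDynamics F G x w) x‖ ≤ C := by
  refine (h.contDiff_revDynamics.differentiable one_ne_zero x).hasFDerivAt.le_of_lip'
    (zero_le_one.trans h.one_le) ?_
  filter_upwards [continuous_norm.continuousAt.eventually_lt_const hx] with y hy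
  exact h.isControlField_rev.lip y x hy.le hx.le _ hw

theorem SystemBounds.norm_revDynamics_taylor_le (h : SystemBounds F G A B C)
    (hw : w ∈ Icc (-1 : Fin M → ℝ) 1) (x y : Plane) :
    ‖revDynamics F G y w - revDynamics F G x w -
      fderiv ℝ (fun x => revDynamics F G x w) x (y - x)‖ ≤ C * ‖y - x‖ ^ 2 := by
  refine le_of_eq_of_le ?_ (h.taylor w hw x y)
  simp only [revDynamics, fderiv_fun_neg, neg_apply]
  rw [← norm_neg]
  congr 1
  abel

theorem revDynamics_sub_revDynamics (x : Plane) (w w' : Fin M → ℝ) :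
    revDynamics F G x w - revDynamics F G x w' = -∑ i, (w i - w' i) • G i x := by
  simp only [revDynamics, dynamics, sub_smul, Finset.sum_sub_distrib]
  abel

end RevDynamics

section SmallTime

variable {C c T t : ℝ}

/-- The time `T` is small with respect to the bounds `C` and `c` of a parallel system. -/
structure IsSmallTime (C c T : ℝ) : Prop where
  nonneg : 0 ≤ T
  mul_le : C * T ≤ 1 / 4
  pow_mul_le : 256 * C ^ 5 * T ≤ c ^ 3

theorem IsSmallTime.mono (hT : IsSmallTime C c T) (hC : 1 ≤ C) (ht : 0 ≤ t) (htT : t ≤ T) :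
    IsSmallTime C c t :=
  ⟨ht, le_trans (by gcongr) hT.mul_le, le_trans (by gcongr) hT.pow_mul_le⟩

theorem IsSmallTime.le_one (hT : IsSmallTime C c T) (hC : 1 ≤ C) : T ≤ 1 := by
  linarith [hT.mul_le, le_mul_of_one_le_left hT.nonneg hC]

theorem IsSmallTime.norm_zero_add_lt (hT : IsSmallTime C c T) : ‖(0 : Plane)‖ + C * T < 1 := by
  rw [norm_zero]
  linarith [hT.mul_le]

end SmallTime

section Parallel

variable {M : ℕ} {F : Plane → Plane} {G : Fin M → Plane → Plane} {A : Plane →L[ℝ] Plane}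
  {B : Fin M → Plane} {C : ℝ}

/-- All control vector fields are parallel at the origin, to the unit vector `e`, and `e`, `A e`
are independent; `c` is a lower bound for the sizes and `ν` is the orientation of `(e, A e)`. -/
structure IsParallel (A : Plane →L[ℝ] Plane) (B : Fin M → Plane) (e : Plane) (β : Fin M → ℝ)
    (ν c : ℝ) : Prop where
  card_pos : 0 < M
  norm_e : ‖e‖ = 1
  B_eq : ∀ i, B i = β i • e
  c_pos : 0 < c
  c_le_one : c ≤ 1
  c_le : ∀ i, c ≤ |β i|
  abs_ν : |ν| = 1
  c_le_wedge : c ≤ ν * wedge e (A e)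

/-- The constant control which gives all the vectors `β i • e` the direction of `e`. -/
def signs (β : Fin M → ℝ) (i : Fin M) : ℝ := SignType.sign (β i)

/-- The speed at the origin produced by the control `signs β`. -/
def totalSize (β : Fin M → ℝ) : ℝ := ∑ i, |β i|

theorem signs_neg (β : Fin M → ℝ) : signs (-β) = -signs β := by
  funext i
  simp [signs, Left.sign_neg]

theorem signs_mul_self (β : Fin M → ℝ) (i : Fin M) : signs β i * β i = |β i| := sign_mul_self _

/-- `X` is the reversed trajectory from the origin with the constant control `signs β`. The
continuity outside of `[0, t]` only serves to integrate along `X` without restricting it. -/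
structure IsExtremal (F : Plane → Plane) (G : Fin M → Plane → Plane) (β : Fin M → ℝ) (t : ℝ)
    (X : ℝ → Plane) : Prop where
  continuous : Continuous X
  isTrajectory : IsTrajectory (revDynamics F G) (fun _ => signs β) 0 t X

variable {e : Plane} {β : Fin M → ℝ} {ν c : ℝ}

namespace IsParallel

theorem neg (hp : IsParallel A B e β ν c) : IsParallel A B (-e) (-β) ν c where
  card_pos := hp.card_pos
  norm_e := by rw [norm_neg, hp.norm_e]
  B_eq i := by simp [hp.B_eq i]
  c_pos := hp.c_pos
  c_le_one := hp.c_le_one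
  c_le i := by simpa using hp.c_le i
  abs_ν := hp.abs_ν
  c_le_wedge := by simpa using hp.c_le_wedge

theorem abs_signs (hp : IsParallel A B e β ν c) (i : Fin M) : |signs β i| = 1 := by
  have hβ : 0 < |β i| := hp.c_pos.trans_le (hp.c_le i)
  refine mul_right_cancel₀ hβ.ne' ?_
  rw [← abs_mul, signs_mul_self, abs_abs, one_mul]

theorem signs_mem (hp : IsParallel A B e β ν c) : signs β ∈ Icc (-1 : Fin M → ℝ) 1 :=
  mem_cube_of_abs_le_one fun i => (hp.abs_signs i).le

theorem isControl (hp : IsParallel A B e β ν c) : IsControl fun _ : ℝ => signs β :=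
  isControl_const hp.signs_mem

theorem sub_signs_eq (hp : IsParallel A B e β ν c) {w : Fin M → ℝ}
    (hw : w ∈ Icc (-1 : Fin M → ℝ) 1) (i : Fin M) :
    w i - signs β i = -(signs β i * |w i - signs β i|) := by
  obtain ⟨hlow, hup⟩ := abs_le.1 (abs_le_one_of_mem_cube hw i)
  rcases eq_or_eq_neg_of_abs_eq (hp.abs_signs i) with hi | hi
  · rw [hi, abs_of_nonpos (by linarith)]
    ring
  · rw [hi, abs_of_nonneg (by linarith)]
    ring

theorem abs_size_le (hp : IsParallel A B e β ν c) (h : SystemBounds F G A B C) (i : Fin M) :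
    |β i| ≤ C := by
  simpa [h.G_zero, hp.B_eq, norm_smul, hp.norm_e] using h.norm_G i 0 (by simp)

theorem c_le_totalSize (hp : IsParallel A B e β ν c) : c ≤ totalSize β :=
  (hp.c_le ⟨0, hp.card_pos⟩).trans
    (Finset.single_le_sum (f := fun i => |β i|) (fun _ _ => abs_nonneg _) (Finset.mem_univ _))

theorem abs_mul_wedge_le (hp : IsParallel A B e β ν c) (x y : Plane) :
    |ν * wedge x y| ≤ ‖x‖ * ‖y‖ := by
  rw [abs_mul, hp.abs_ν, one_mul]
  exact abs_wedge_le x y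

theorem norm_field_sub_le (hp : IsParallel A B e β ν c) (h : SystemBounds F G A B C) (i : Fin M)
    {x : Plane} (hx : ‖x‖ ≤ 1) : ‖G i x - β i • e‖ ≤ C * ‖x‖ ^ 2 := by
  have := h.G_sub i ‖x‖ hx x 0 le_rfl (by simp)
  rwa [h.G_zero, hp.B_eq, sub_zero, mul_assoc, ← sq] at this

theorem revDynamics_zero (hp : IsParallel A B e β ν c) (h : SystemBounds F G A B C) :
    revDynamics F G 0 (signs β) = -(totalSize β • e) := by
  simp only [revDynamics, dynamics, h.F_zero, h.G_zero, hp.B_eq, smul_smul, signs_mul_self,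
    ← Finset.sum_smul, totalSize, zero_add]

theorem norm_revDynamics_add_le (hp : IsParallel A B e β ν c) (h : SystemBounds F G A B C)
    {x : Plane} (hx : ‖x‖ ≤ 1) :
    ‖revDynamics F G x (signs β) + totalSize β • e + A x‖ ≤ 2 * C ^ 2 * ‖x‖ ^ 2 := by
  have hC := h.one_le
  have hF : ‖F x - A x‖ ≤ C * ‖x‖ ^ 2 := by
    have := h.F_sub ‖x‖ hx x 0 le_rfl (by simp)
    rwa [h.F_zero, sub_zero, sub_zero, mul_assoc, ← sq] at this
  have hG := norm_sum_smul_le hp.signs_mem fun i => hp.norm_field_sub_le h i hx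
  have hsplit : revDynamics F G x (signs β) + totalSize β • e + A x =
      -(F x - A x) - ∑ i, signs β i • (G i x - β i • e) := by
    simp only [revDynamics, dynamics, totalSize, smul_sub, smul_smul, signs_mul_self,
      Finset.sum_sub_distrib, Finset.sum_smul]
    abel
  calc _ ≤ C * ‖x‖ ^ 2 + M * (C * ‖x‖ ^ 2) := by
        rw [hsplit]
        exact (norm_sub_le _ _).trans (by rw [norm_neg]; exact add_le_add hF hG)
    _ ≤ C * (C * ‖x‖ ^ 2) + C * (C * ‖x‖ ^ 2) := by
        gcongr
        exacts [le_mul_of_one_le_left (by positivity) hC, h.card_le]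
    _ = _ := by ring

end IsParallel

namespace IsExtremal

variable {t s : ℝ} {X : ℝ → Plane}

theorem mono (hX : IsExtremal F G β t X) (hst : s ≤ t) : IsExtremal F G β s X :=
  ⟨hX.continuous, hX.isTrajectory.mono hst⟩

theorem norm_lt_one (hX : IsExtremal F G β t X) (hp : IsParallel A B e β ν c)
    (h : SystemBounds F G A B C) (ht : IsSmallTime C c t) (hs : s ∈ Icc 0 t) : ‖X s‖ < 1 :=
  hX.isTrajectory.norm_lt_one h.isControlField_rev hp.isControl ht.norm_zero_add_lt hs

theorem norm_le (hX : IsExtremal F G β t X) (hp : IsParallel A B e β ν c)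
    (h : SystemBounds F G A B C) (ht : IsSmallTime C c t) (hs : s ∈ Icc 0 t) :
    ‖X s‖ ≤ C * s := by
  simpa using hX.isTrajectory.norm_le h.isControlField_rev hp.isControl ht.norm_zero_add_lt hs

theorem norm_sub_add_smul_le (hX : IsExtremal F G β t X) (hp : IsParallel A B e β ν c)
    (h : SystemBounds F G A B C) (ht : IsSmallTime C c t) {r : ℝ} (hs : s ∈ Icc 0 t)
    (hr : r ∈ Icc 0 s) : ‖X s - X r + (s - r) • totalSize β • e‖ ≤ C ^ 2 * s * (s - r) := by
  have hC := h.one_le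
  have hf := h.isControlField_rev
  have hrt : r ∈ Icc 0 t := ⟨hr.1, hr.2.trans hs.2⟩
  have hsplit : X s - X r + (s - r) • totalSize β • e =
      ∫ q in r..s, (revDynamics F G (X q) (signs β) - revDynamics F G 0 (signs β)) := by
    rw [intervalIntegral.integral_sub
        (hf.intervalIntegrable hp.isControl hX.isTrajectory.1 hrt hs) intervalIntegrable_const,
      intervalIntegral.integral_const, hX.isTrajectory.sub_eq hf hp.isControl hrt hs,
      hp.revDynamics_zero h, smul_neg, sub_neg_eq_add]
  rw [hsplit, ← abs_of_nonneg (sub_nonneg.2 hr.2)]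
  refine intervalIntegral.norm_integral_le_of_norm_le_const fun q hq => ?_
  rw [uIoc_of_le hr.2] at hq
  have hqt : q ∈ Icc 0 t := ⟨hr.1.trans hq.1.le, hq.2.trans hs.2⟩
  calc _ ≤ C * ‖X q - 0‖ :=
        hf.lip (X q) 0 (hX.norm_lt_one hp h ht hqt).le (by simp) _ hp.signs_mem
    _ ≤ C * (C * s) := by
        rw [sub_zero]
        gcongr
        exact (hX.norm_le hp h ht hqt).trans (by gcongr; exact hq.2)
    _ = _ := by ring

theorem norm_add_smul_le (hX : IsExtremal F G β t X) (hp : IsParallel A B e β ν c)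
    (h : SystemBounds F G A B C) (ht : IsSmallTime C c t) (hs : s ∈ Icc 0 t) :
    ‖X s + s • totalSize β • e‖ ≤ C ^ 2 * s ^ 2 := by
  have := hX.norm_sub_add_smul_le hp h ht hs ⟨le_rfl, hs.1⟩
  rwa [hX.isTrajectory.apply_zero ht.nonneg, sub_zero, sub_zero, mul_assoc, ← sq] at this

theorem norm_velocity_add_smul_sub_smul_le (hX : IsExtremal F G β t X)
    (hp : IsParallel A B e β ν c) (h : SystemBounds F G A B C) (ht : IsSmallTime C c t)
    (hs : s ∈ Icc 0 t) :
    ‖revDynamics F G (X s) (signs β) + totalSize β • e - (s * totalSize β) • A e‖ ≤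
      3 * C ^ 4 * s ^ 2 := by
  have hC := h.one_le
  set k := totalSize β
  have hXn := hX.norm_le hp h ht hs
  have hsplit : revDynamics F G (X s) (signs β) + k • e - (s * k) • A e =
      (revDynamics F G (X s) (signs β) + k • e + A (X s)) - A (X s + s • k • e) := by
    rw [map_add, map_smul, map_smul, smul_smul]
    abel
  calc _ ≤ 2 * C ^ 2 * ‖X s‖ ^ 2 + ‖A‖ * ‖X s + s • k • e‖ := by
        rw [hsplit]
        exact (norm_sub_le _ _).trans (add_le_add
          (hp.norm_revDynamics_add_le h (hX.norm_lt_one hp h ht hs).le) (A.le_opNorm _))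
    _ ≤ 2 * C ^ 2 * (C * s) ^ 2 + C * (C ^ 2 * s ^ 2) := by
        gcongr
        exacts [h.norm_A, hX.norm_add_smul_le hp h ht hs]
    _ = 2 * C ^ 4 * s ^ 2 + C ^ 3 * s ^ 2 := by ring
    _ ≤ 2 * C ^ 4 * s ^ 2 + C ^ 4 * s ^ 2 := by
        gcongr
        norm_num
    _ = _ := by ring

theorem mul_wedge_velocity_le (hX : IsExtremal F G β t X) (hp : IsParallel A B e β ν c)
    (h : SystemBounds F G A B C) (ht : IsSmallTime C c t) (hs : s ∈ Icc 0 t) :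
    ν * wedge (revDynamics F G (X s) (signs β)) e ≤ 3 * C ^ 4 * s ^ 2 - c ^ 2 * s := by
  set V := revDynamics F G (X s) (signs β)
  set k := totalSize β
  set R := V + k • e - (s * k) • A e with hR
  have hsplit : ν * wedge V e = ν * wedge R e - k * (ν * wedge e (A e)) * s := by
    simp only [hR, map_add, map_sub, map_smul, add_apply, sub_apply, smul_apply, smul_eq_mul,
      wedge_self]
    rw [wedge_swap (A e) e]
    ring
  have hRe : ν * wedge R e ≤ 3 * C ^ 4 * s ^ 2 := by
    have := (le_abs_self _).trans (hp.abs_mul_wedge_le R e)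
    rw [hp.norm_e, mul_one] at this
    exact this.trans (hX.norm_velocity_add_smul_sub_smul_le hp h ht hs)
  have hmain : c ^ 2 ≤ k * (ν * wedge e (A e)) := by
    rw [sq]
    exact mul_le_mul hp.c_le_totalSize hp.c_le_wedge hp.c_pos.le
      (hp.c_pos.le.trans hp.c_le_totalSize)
  rw [hsplit]
  exact sub_le_sub hRe (mul_le_mul_of_nonneg_right hmain hs.1)

/-- The switching functions `⟨G i, V^⊥⟩` along the extremal with velocity `V` vanish at the origin
and have a derivative of definite sign there. -/
theorem switching_le (hX : IsExtremal F G β t X) (hp : IsParallel A B e β ν c)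
    (h : SystemBounds F G A B C) (ht : IsSmallTime C c t) (hs : s ∈ Icc 0 t) {y : Plane}
    (hy : ‖y‖ ≤ C * s) (i : Fin M) :
    signs β i * (ν * wedge (revDynamics F G (X s) (signs β)) (G i y)) ≤ -(c ^ 3 / 2) * s := by
  have hC := h.one_le
  have hc := hp.c_pos
  have hs0 := hs.1
  have hCs : C * s ≤ C * t := by gcongr; exact hs.2
  set V := revDynamics F G (X s) (signs β)
  set R := G i y - β i • e with hR
  have hVn : ‖V‖ ≤ C :=
    h.isControlField_rev.norm_le _ (hX.norm_lt_one hp h ht hs).le _ hp.signs_mem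
  have hsplit : signs β i * (ν * wedge V (G i y)) =
      |β i| * (ν * wedge V e) + signs β i * (ν * wedge V R) := by
    rw [show G i y = β i • e + R by rw [hR]; abel, map_add, map_smul, smul_eq_mul,
      ← signs_mul_self]
    ring
  have hmain : |β i| * (ν * wedge V e) ≤ 3 * C ^ 5 * s ^ 2 - c ^ 3 * s :=
    calc _ ≤ |β i| * (3 * C ^ 4 * s ^ 2 - c ^ 2 * s) :=
          mul_le_mul_of_nonneg_left (hX.mul_wedge_velocity_le hp h ht hs) (abs_nonneg _)
      _ = |β i| * (3 * C ^ 4 * s ^ 2) - |β i| * (c ^ 2 * s) := mul_sub _ _ _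
      _ ≤ C * (3 * C ^ 4 * s ^ 2) - c * (c ^ 2 * s) := by
        gcongr
        exacts [hp.abs_size_le h i, hp.c_le i]
      _ = _ := by ring
  have hremainder : signs β i * (ν * wedge V R) ≤ C ^ 5 * s ^ 2 :=
    calc _ ≤ |ν * wedge V R| := by
          refine (le_abs_self _).trans_eq ?_
          rw [abs_mul, hp.abs_signs, one_mul]
      _ ≤ ‖V‖ * ‖R‖ := hp.abs_mul_wedge_le V R
      _ ≤ C * (C * (C * s) ^ 2) := by
        gcongr
        exact (hp.norm_field_sub_le h i (by linarith [ht.mul_le])).trans (by gcongr)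
      _ = C ^ 4 * s ^ 2 := by ring
      _ ≤ C ^ 5 * s ^ 2 := by
        gcongr
        norm_num
  have hsmall : 8 * C ^ 5 * s * s ≤ c ^ 3 * s := by
    gcongr
    calc 8 * C ^ 5 * s ≤ 256 * C ^ 5 * t := by gcongr; exacts [by norm_num, hs.2]
      _ ≤ c ^ 3 := ht.pow_mul_le
  rw [hsplit]
  linarith

theorem mul_wedge_defect_le (hX : IsExtremal F G β t X) (hp : IsParallel A B e β ν c)
    (h : SystemBounds F G A B C) (ht : IsSmallTime C c t) (hs : s ∈ Icc 0 t) {y : Plane}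
    (hy : ‖y‖ ≤ C * s) {w : Fin M → ℝ} (hw : w ∈ Icc (-1 : Fin M → ℝ) 1) :
    ν * wedge (revDynamics F G (X s) (signs β))
        (revDynamics F G y w - revDynamics F G (X s) (signs β) -
          fderiv ℝ (fun x => revDynamics F G x (signs β)) (X s) (y - X s)) ≤
      C ^ 2 * ‖y - X s‖ ^ 2 - c ^ 3 / 2 * (s * ∑ i, |w i - signs β i|) := by
  have hC := zero_le_one.trans h.one_le
  set V := revDynamics F G (X s) (signs β)
  set D := fderiv ℝ (fun x => revDynamics F G x (signs β)) (X s)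
  set R := revDynamics F G y (signs β) - V - D (y - X s) with hR
  have hremainder : ν * wedge V R ≤ C ^ 2 * ‖y - X s‖ ^ 2 :=
    calc _ ≤ ‖V‖ * ‖R‖ := (le_abs_self _).trans (hp.abs_mul_wedge_le V R)
      _ ≤ C * (C * ‖y - X s‖ ^ 2) := by
        gcongr
        exacts [h.isControlField_rev.norm_le _ (hX.norm_lt_one hp h ht hs).le _ hp.signs_mem,
          h.norm_revDynamics_taylor_le hp.signs_mem _ _]
      _ = _ := by ring
  have hcontrol : -∑ i, (w i - signs β i) * (ν * wedge V (G i y)) ≤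
      -(c ^ 3 / 2 * (s * ∑ i, |w i - signs β i|)) := by
    rw [← Finset.sum_neg_distrib, Finset.mul_sum, Finset.mul_sum, ← Finset.sum_neg_distrib]
    refine Finset.sum_le_sum fun i _ => ?_
    calc -((w i - signs β i) * (ν * wedge V (G i y))) =
          |w i - signs β i| * (signs β i * (ν * wedge V (G i y))) := by
          conv_lhs => rw [hp.sub_signs_eq hw i]
          ring
      _ ≤ |w i - signs β i| * (-(c ^ 3 / 2) * s) :=
          mul_le_mul_of_nonneg_left (hX.switching_le hp h ht hs hy i) (abs_nonneg _)
      _ = _ := by ring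
  have hsplit : revDynamics F G y w - V - D (y - X s) = R - ∑ i, (w i - signs β i) • G i y := by
    rw [sub_eq_add_neg R, ← revDynamics_sub_revDynamics, hR]
    abel
  calc _ = ν * wedge V R + -∑ i, (w i - signs β i) * (ν * wedge V (G i y)) := by
        rw [hsplit, map_sub, mul_sub, map_sum, Finset.mul_sum, sub_eq_add_neg]
        simp only [map_smul, smul_eq_mul, mul_left_comm ν]
    _ ≤ _ := add_le_add hremainder hcontrol

variable {v : ℝ → Fin M → ℝ} {x : ℝ → Plane}

theorem norm_sub_sq_le (hX : IsExtremal F G β t X) (hp : IsParallel A B e β ν c)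
    (h : SystemBounds F G A B C) (ht : IsSmallTime C c t) (hv : IsControl v)
    (hx : IsTrajectory (revDynamics F G) v 0 t x) (hs : s ∈ Icc 0 t) :
    ‖x s - X s‖ ^ 2 ≤
      8 * ‖x t - X t‖ ^ 2 + 16 * C ^ 3 * t * ∫ r in s..t, gap v (fun _ => signs β) r := by
  have hC := h.one_le
  have hf := h.isControlField_rev
  set d := ‖x t - X t‖
  set g := ∫ r in s..t, gap v (fun _ => signs β) r
  have hg0 : 0 ≤ g := intervalIntegral.integral_nonneg hs.2 fun r _ => gap_nonneg _ _ r
  have hg : g ≤ 2 * C * t :=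
    calc g ≤ 2 * M * (t - s) := integral_gap_le hv hp.isControl hs.2
      _ ≤ 2 * C * t := by
        gcongr
        exacts [sub_nonneg.2 hs.2, h.card_le, sub_le_self _ hs.1]
  have hdist : ‖x s - X s‖ ≤ 2 * (d + C * g) := by
    have := norm_sub_trajectory_le hf (by linarith [ht.mul_le]) hv hx
      (fun r hr => (hx.norm_lt_one hf hv ht.norm_zero_add_lt hr).le) hp.isControl hX.isTrajectory
      (fun r hr => (hX.norm_lt_one hp h ht hr).le) hs ⟨ht.nonneg, le_rfl⟩
    rwa [intervalIntegral.integral_symm, abs_neg, abs_of_nonneg hg0] at this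
  calc ‖x s - X s‖ ^ 2 ≤ (2 * (d + C * g)) ^ 2 := by gcongr
    _ = 4 * (d + C * g) ^ 2 := by ring
    _ ≤ 4 * (2 * (d ^ 2 + (C * g) ^ 2)) := by gcongr; exact add_sq_le
    _ = 8 * d ^ 2 + 8 * C ^ 2 * (g * g) := by ring
    _ ≤ 8 * d ^ 2 + 8 * C ^ 2 * (2 * C * t * g) := by gcongr
    _ = _ := by ring

theorem absolutelyContinuousOnInterval_integratingFactor_mul_wedge (hX : IsExtremal F G β t X)
    (hp : IsParallel A B e β ν c) (h : SystemBounds F G A B C) (ht : IsSmallTime C c t)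
    (hv : IsControl v) (hx : IsTrajectory (revDynamics F G) v 0 t x) :
    AbsolutelyContinuousOnInterval
      (fun s => integratingFactor (fun x => revDynamics F G x (signs β)) X s *
        wedge (revDynamics F G (X s) (signs β)) (x s - X s)) 0 t := by
  have hf := h.isControlField_rev
  have hlipX := hX.isTrajectory.lipschitzOnWith hf hp.isControl ht.norm_zero_add_lt
  have hlipx := hx.lipschitzOnWith hf hv ht.norm_zero_add_lt
  have hlipV : LipschitzOnWith C.toNNReal (fun x => revDynamics F G x (signs β)) {x | ‖x‖ ≤ 1} :=
    LipschitzOnWith.of_dist_le_mul fun x hx y hy => by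
      rw [dist_eq_norm, dist_eq_norm, Real.coe_toNNReal C (zero_le_one.trans h.one_le)]
      exact hf.lip x y hx hy _ hp.signs_mem
  rw [← uIcc_of_le ht.nonneg] at hlipX hlipx
  refine (contDiff_integratingFactor h.contDiff_revDynamics
    hX.continuous).contDiffOn.absolutelyContinuousOnInterval.fun_mul
      (absolutelyContinuousOnInterval_wedge (hlipV.comp hlipX fun r hr => ?_) (hlipx.sub hlipX))
  rw [uIcc_of_le ht.nonneg] at hr
  exact (hX.norm_lt_one hp h ht hr).le

theorem integratingFactor_mul_wedge_defect_le (hX : IsExtremal F G β t X)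
    (hp : IsParallel A B e β ν c) (h : SystemBounds F G A B C) (ht : IsSmallTime C c t)
    (hv : IsControl v) (hx : IsTrajectory (revDynamics F G) v 0 t x) (hs : s ∈ Icc 0 t)
    (hvs : v s ∈ Icc (-1 : Fin M → ℝ) 1) :
    integratingFactor (fun x => revDynamics F G x (signs β)) X s *
        (ν * wedge (revDynamics F G (X s) (signs β))
          (revDynamics F G (x s) (v s) - revDynamics F G (X s) (signs β) -
            fderiv ℝ (fun x => revDynamics F G x (signs β)) (X s) (x s - X s))) ≤
      2 * C ^ 2 * (8 * ‖x t - X t‖ ^ 2 +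
        16 * C ^ 3 * t * ∫ r in s..t, gap v (fun _ => signs β) r) -
          c ^ 3 / 4 * (s * gap v (fun _ => signs β) s) := by
  set E := integratingFactor (fun x => revDynamics F G x (signs β)) X
  have hE : E s ∈ Icc (1 / 2) 2 := integratingFactor_mem_Icc hs.1
    (ht.mono h.one_le hs.1 hs.2).mul_le fun r hr =>
      h.norm_fderiv_revDynamics_le hp.signs_mem (hX.norm_lt_one hp h ht ⟨hr.1, hr.2.trans hs.2⟩)
  have hdefect := hX.mul_wedge_defect_le hp h ht hs
    (by simpa using hx.norm_le h.isControlField_rev hv ht.norm_zero_add_lt hs) hvs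
  have hgap : 0 ≤ c ^ 3 / 2 * (s * gap v (fun _ => signs β) s) := by
    have := hp.c_pos
    have := gap_nonneg v (fun _ => signs β) s
    have := hs.1
    positivity
  calc _ ≤ E s * (C ^ 2 * ‖x s - X s‖ ^ 2 - c ^ 3 / 2 * (s * gap v (fun _ => signs β) s)) :=
        mul_le_mul_of_nonneg_left hdefect (by linarith [hE.1])
    _ = E s * (C ^ 2 * ‖x s - X s‖ ^ 2) - E s * (c ^ 3 / 2 * (s * gap v (fun _ => signs β) s)) :=
        mul_sub _ _ _
    _ ≤ 2 * (C ^ 2 * (8 * ‖x t - X t‖ ^ 2 +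
          16 * C ^ 3 * t * ∫ r in s..t, gap v (fun _ => signs β) r)) -
        1 / 2 * (c ^ 3 / 2 * (s * gap v (fun _ => signs β) s)) := by
        gcongr
        exacts [hE.2, hX.norm_sub_sq_le hp h ht hv hx hs, hE.1]
    _ = _ := by ring

/-- The area spanned by the velocity of the extremal `X` and the difference `x - X`, once
compensated by the integrating factor, decreases up to the quadratic error. -/
theorem integratingFactor_mul_wedge_le (hX : IsExtremal F G β t X) (hp : IsParallel A B e β ν c)
    (h : SystemBounds F G A B C) (ht : IsSmallTime C c t) (hv : IsControl v)
    (hx : IsTrajectory (revDynamics F G) v 0 t x) :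
    integratingFactor (fun x => revDynamics F G x (signs β)) X t *
        (ν * wedge (revDynamics F G (X t) (signs β)) (x t - X t)) ≤
      ∫ s in (0 : ℝ)..t, (2 * C ^ 2 * (8 * ‖x t - X t‖ ^ 2 +
        16 * C ^ 3 * t * ∫ r in s..t, gap v (fun _ => signs β) r) -
          c ^ 3 / 4 * (s * gap v (fun _ => signs β) s)) := by
  have hf := h.isControlField_rev
  set E := integratingFactor (fun x => revDynamics F G x (signs β)) X
  set ψ : ℝ → ℝ := fun s =>
    ν * (E s * wedge (revDynamics F G (X s) (signs β)) (x s - X s)) with hψ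
  have hψac : AbsolutelyContinuousOnInterval ψ 0 t :=
    (hX.absolutelyContinuousOnInterval_integratingFactor_mul_wedge hp h ht hv hx).const_mul ν
  have hψ0 : ψ 0 = 0 := by
    simp [hψ, hx.apply_zero ht.nonneg, hX.isTrajectory.apply_zero ht.nonneg]
  have htail := continuous_integral_gap_left hv hp.isControl t
  have hintegrable : IntervalIntegrable (fun s => 2 * C ^ 2 * (8 * ‖x t - X t‖ ^ 2 +
      16 * C ^ 3 * t * ∫ r in s..t, gap v (fun _ => signs β) r) -
        c ^ 3 / 4 * (s * gap v (fun _ => signs β) s)) volume 0 t :=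
    (by fun_prop : Continuous fun s => 2 * C ^ 2 * (8 * ‖x t - X t‖ ^ 2 + 16 * C ^ 3 * t *
      ∫ r in s..t, gap v (fun _ => signs β) r)).intervalIntegrable 0 t |>.sub
        ((moment_intervalIntegrable hv hp.isControl 0 t).const_mul _)
  have hψt := sub_le_integral_of_ae_hasDerivAt_le ht.nonneg hψac hintegrable ?_
  · rw [hψ0, sub_zero] at hψt
    exact (mul_left_comm _ _ _).trans_le hψt
  filter_upwards [hx.ae_hasDerivAt hf hv ht.nonneg,
    hX.isTrajectory.ae_hasDerivAt hf hp.isControl ht.nonneg, hv.2] with s hxs hXs hvs hs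
  refine ⟨_, (hasDerivAt_integratingFactor_mul_wedge h.contDiff_revDynamics hX.continuous (hXs hs)
    ((hxs hs).fun_sub (hXs hs))).const_mul ν, ?_⟩
  rw [mul_left_comm]
  exact hX.integratingFactor_mul_wedge_defect_le hp h ht hv hx (Ioo_subset_Icc_self hs) hvs

/-- Every reachable point lies, up to a quadratic error, on one side of the tangent to the
extremal, strictly so if its control differs. -/
theorem wedge_velocity_le (hX : IsExtremal F G β t X) (hp : IsParallel A B e β ν c)
    (h : SystemBounds F G A B C) (ht : IsSmallTime C c t) (hv : IsControl v)
    (hx : IsTrajectory (revDynamics F G) v 0 t x) :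
    ν * wedge (revDynamics F G (X t) (signs β)) (x t - X t) ≤
      -(c ^ 3 / 16) * moment v (fun _ => signs β) t + 32 * C ^ 2 * ‖x t - X t‖ ^ 2 := by
  have hC := h.one_le
  have ht0 := ht.nonneg
  have hbound := hX.integratingFactor_mul_wedge_le hp h ht hv hx
  set E := integratingFactor (fun x => revDynamics F G x (signs β)) X t
  set m := moment v (fun _ => signs β) t with hm
  set d := ‖x t - X t‖
  have hE : E ∈ Icc (1 / 2) 2 := integratingFactor_mem_Icc ht0 ht.mul_le fun r hr =>
    h.norm_fderiv_revDynamics_le hp.signs_mem (hX.norm_lt_one hp h ht hr)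
  have htail : IntervalIntegrable (fun s => ∫ r in s..t, gap v (fun _ => signs β) r)
      volume 0 t := (continuous_integral_gap_left hv hp.isControl t).intervalIntegrable 0 t
  have hintegral : E * (ν * wedge (revDynamics F G (X t) (signs β)) (x t - X t)) ≤
      t * (16 * C ^ 2 * d ^ 2) + 32 * C ^ 5 * t * m - c ^ 3 / 4 * m := by
    refine hbound.trans_eq ?_
    rw [intervalIntegral.integral_sub
        ((intervalIntegrable_const.add (htail.const_mul _)).const_mul _)
        ((moment_intervalIntegrable hv hp.isControl 0 t).const_mul _),
      intervalIntegral.integral_const_mul,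
      intervalIntegral.integral_add intervalIntegrable_const (htail.const_mul _),
      intervalIntegral.integral_const, intervalIntegral.integral_const_mul,
      intervalIntegral.integral_const_mul, integral_tail_gap hv hp.isControl, ← moment, ← hm,
      sub_zero, smul_eq_mul]
    ring
  have hm0 : 0 ≤ m := moment_nonneg v _ ht0
  have hc : 0 < c ^ 3 := pow_pos hp.c_pos 3
  have hsmall : 32 * C ^ 5 * t * m ≤ c ^ 3 / 8 * m := by
    gcongr
    linarith [ht.pow_mul_le]
  have htime : t * (16 * C ^ 2 * d ^ 2) ≤ 16 * C ^ 2 * d ^ 2 :=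
    mul_le_of_le_one_left (by positivity) (ht.le_one hC)
  have hEm : E * (c ^ 3 / 16 * m) ≤ 2 * (c ^ 3 / 16 * m) := by gcongr; exact hE.2
  have hEd : 1 / 2 * (32 * C ^ 2 * d ^ 2) ≤ E * (32 * C ^ 2 * d ^ 2) := by gcongr; exact hE.1
  refine le_of_mul_le_mul_left (a := E) ?_ (by linarith [hE.1])
  linarith

end IsExtremal

end Parallel

section Extremal

variable {M : ℕ} {F : Plane → Plane} {G : Fin M → Plane → Plane} {A : Plane →L[ℝ] Plane}
  {B : Fin M → Plane} {C : ℝ} {e : Plane} {β : Fin M → ℝ} {ν c t : ℝ}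

namespace IsParallel

theorem c_le_bound (hp : IsParallel A B e β ν c) (h : SystemBounds F G A B C) : c ≤ C :=
  (hp.c_le ⟨0, hp.card_pos⟩).trans (hp.abs_size_le h _)

theorem sq_mul_le (hp : IsParallel A B e β ν c) (h : SystemBounds F G A B C)
    (ht : IsSmallTime C c t) : C ^ 2 * t ≤ c / 4 := by
  have hC := h.one_le
  have hc := hp.c_pos
  have hcC := hp.c_le_bound h
  refine le_of_mul_le_mul_left ?_ (show 0 < 256 * C ^ 3 by positivity)
  calc 256 * C ^ 3 * (C ^ 2 * t) = 256 * C ^ 5 * t := by ring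
    _ ≤ c ^ 3 := ht.pow_mul_le
    _ = c ^ 2 * c := by ring
    _ ≤ C ^ 2 * c := by gcongr
    _ ≤ C ^ 3 * c := by gcongr; norm_num
    _ ≤ 64 * (C ^ 3 * c) := le_mul_of_one_le_left (by positivity) (by norm_num)
    _ = _ := by ring

end IsParallel

namespace IsExtremal

variable {X Y : ℝ → Plane}

theorem norm_velocity_pos (hX : IsExtremal F G β t X) (hp : IsParallel A B e β ν c)
    (h : SystemBounds F G A B C) (ht : IsSmallTime C c t) :
    0 < ‖revDynamics F G (X t) (signs β)‖ := by
  have hC := zero_le_one.trans h.one_le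
  have hmem : t ∈ Icc 0 t := ⟨ht.nonneg, le_rfl⟩
  have hdiff : ‖revDynamics F G (X t) (signs β) - revDynamics F G 0 (signs β)‖ ≤ C ^ 2 * t :=
    calc _ ≤ C * ‖X t - 0‖ := h.isControlField_rev.lip (X t) 0
          (hX.norm_lt_one hp h ht hmem).le (by simp) _ hp.signs_mem
      _ ≤ C * (C * t) := by
        rw [sub_zero]
        gcongr
        exact hX.norm_le hp h ht hmem
      _ = _ := by ring
  have hzero : c ≤ ‖revDynamics F G 0 (signs β)‖ := by
    rw [hp.revDynamics_zero h, norm_neg, norm_smul, hp.norm_e, mul_one]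
    exact hp.c_le_totalSize.trans (le_abs_self _)
  have := norm_sub_norm_le (revDynamics F G 0 (signs β)) (revDynamics F G (X t) (signs β))
  rw [norm_sub_rev] at this
  linarith [hp.sq_mul_le h ht, hp.c_pos]

theorem moment_nonpos (hX : IsExtremal F G β t X) (hp : IsParallel A B e β ν c)
    (h : SystemBounds F G A B C) (ht : IsSmallTime C c t) {v : ℝ → Fin M → ℝ} (hv : IsControl v)
    {x : ℝ → Plane} (hx : IsTrajectory (revDynamics F G) v 0 t x) (hxX : x t = X t) :
    moment v (fun _ => signs β) t ≤ 0 := by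
  have := hX.wedge_velocity_le hp h ht hv hx
  simp only [hxX, sub_self, map_zero, mul_zero, norm_zero, ne_eq, OfNat.ofNat_ne_zero,
    not_false_eq_true, zero_pow, add_zero, neg_mul, Left.nonneg_neg_iff] at this
  exact nonpos_of_mul_nonpos_right this (by have := hp.c_pos; positivity)

/-- A faster trajectory could wait at the origin first; its control would then differ from that of
the extremal for a positive time. -/
theorem minTime_eq (hX : IsExtremal F G β t X) (hp : IsParallel A B e β ν c)
    (h : SystemBounds F G A B C) (ht : IsSmallTime C c t) :
    minTime F G (X t) = ENNReal.ofReal t := by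
  refine le_antisymm
    (steers_of_rev_zero h hp.isControl ht.nonneg hX.isTrajectory).minTime_le
    (le_iInf₂ fun s hs => ?_)
  by_contra! hlt
  have hst : s < t := (ENNReal.ofReal_lt_ofReal_iff_of_nonneg hs.1).1 hlt
  obtain ⟨u, hu, hu0, x, hx, hxt⟩ := hs.exists_rev_wait h hst.le
  have hgap : ∀ r < t - s, 1 ≤ gap u (fun _ => signs β) r := fun r hr => by
    simp only [gap, hu0 r hr, Pi.zero_apply, zero_sub, abs_neg, hp.abs_signs, Finset.sum_const,
      Finset.card_univ, Fintype.card_fin, nsmul_eq_mul, mul_one]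
    exact Nat.one_le_cast.2 hp.card_pos
  exact (hX.moment_nonpos hp h ht hu hx hxt).not_gt
    (moment_pos_of_le_gap hu hp.isControl (sub_pos.2 hst) (sub_le_self _ hs.1) hgap)

theorem apply_ne (hX : IsExtremal F G β t X) (hY : IsExtremal F G (-β) t Y)
    (hp : IsParallel A B e β ν c) (h : SystemBounds F G A B C) (ht : IsSmallTime C c t)
    (ht0 : 0 < t) : X t ≠ Y t := by
  intro hXY
  have hgap : ∀ r < t, 1 ≤ gap (fun _ => signs (-β)) (fun _ => signs β) r := fun r _ => by
    have htwo : ∀ i, |signs (-β) i - signs β i| = 2 := fun i => by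
      rw [signs_neg, Pi.neg_apply, ← neg_add', abs_neg, ← two_mul, abs_mul, hp.abs_signs]
      norm_num
    have : (1 : ℝ) ≤ M := Nat.one_le_cast.2 hp.card_pos
    simp only [gap, htwo, Finset.sum_const, Finset.card_univ, Fintype.card_fin, nsmul_eq_mul]
    linarith
  exact (hX.moment_nonpos hp h ht hp.neg.isControl hY.isTrajectory hXY.symm).not_gt
    (moment_pos_of_le_gap hp.neg.isControl hp.isControl ht0 le_rfl hgap)

theorem smul_rotation_velocity_mem_proximalNormals (hX : IsExtremal F G β t X)
    (hp : IsParallel A B e β ν c) (h : SystemBounds F G A B C) (ht : IsSmallTime C c t) {a : ℝ}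
    (ha : 0 ≤ a) :
    (a * ν) • orientation.rightAngleRotation (revDynamics F G (X t) (signs β)) ∈
      proximalNormals (reachable F G t) (X t) := by
  refine ⟨⟨t, le_rfl, steers_of_rev_zero h hp.isControl ht.nonneg hX.isTrajectory⟩,
    a * (32 * C ^ 2), by positivity, fun y hy => ?_⟩
  obtain ⟨u, hu, x, hx, rfl⟩ := ((mem_reachable_iff h).1 hy).exists_rev h
  have hle := hX.wedge_velocity_le hp h ht hu hx
  have hmoment : 0 ≤ c ^ 3 / 16 * moment u (fun _ => signs β) t := by
    have := hp.c_pos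
    have := moment_nonneg u (fun _ => signs β) ht.nonneg
    positivity
  rw [real_inner_smul_left, Orientation.inner_rightAngleRotation_left, ← wedge_eq_areaForm,
    mul_assoc, mul_assoc a]
  exact mul_le_mul_of_nonneg_left (by linarith) ha

theorem minHamiltonian_smul_rotation_velocity (hX : IsExtremal F G β t X)
    (hp : IsParallel A B e β ν c) (h : SystemBounds F G A B C) (ht : IsSmallTime C c t) {a : ℝ}
    (ha : 0 ≤ a) :
    minHamiltonian F G (X t)
      ((a * ν) • orientation.rightAngleRotation (revDynamics F G (X t) (signs β))) = 0 := by
  have hmem : t ∈ Icc 0 t := ⟨ht.nonneg, le_rfl⟩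
  set V := revDynamics F G (X t) (signs β) with hV
  have hinner : ∀ z, inner ℝ ((a * ν) • orientation.rightAngleRotation V) z =
      a * (ν * wedge V z) := fun z => by
    rw [real_inner_smul_left, Orientation.inner_rightAngleRotation_left, ← wedge_eq_areaForm,
      mul_assoc]
  have hdyn : ∀ w, dynamics F G (X t) w = -V + ∑ i, (w i - signs β i) • G i (X t) := fun w => by
    rw [← neg_eq_iff_eq_neg.2 (revDynamics_sub_revDynamics (F := F) (G := G) (X t) w (signs β)),
      hV, revDynamics, revDynamics]
    abel
  refine IsLeast.csInf_eq ⟨⟨signs β, hp.signs_mem, ?_⟩, ?_⟩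
  · simp only [hinner, hdyn, sub_self, zero_smul, Finset.sum_const_zero, add_zero, map_neg,
      wedge_self, neg_zero, mul_zero]
  rintro _ ⟨w, hw, rfl⟩
  simp only [hinner, hdyn, map_add, map_neg, wedge_self, neg_zero, zero_add, map_sum, map_smul,
    smul_eq_mul]
  refine mul_nonneg ha ?_
  rw [Finset.mul_sum]
  refine Finset.sum_nonneg fun i _ => ?_
  have hswitch : 0 ≤ -(signs β i * (ν * wedge V (G i (X t)))) := by
    have hct : 0 ≤ c ^ 3 / 2 * t := by
      have := hp.c_pos
      have := ht.nonneg
      positivity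
    linarith [hX.switching_le hp h ht hmem (hX.norm_le hp h ht hmem) i]
  rw [hp.sub_signs_eq hw i]
  linarith [mul_nonneg (abs_nonneg (w i - signs β i)) hswitch]

theorem mem_singularSet (hX : IsExtremal F G β t X) (hp : IsParallel A B e β ν c)
    (h : SystemBounds F G A B C) (ht : IsSmallTime C c t) {τ : ℝ} (htτ : t ≤ τ) :
    X t ∈ singularSet F G τ := by
  have hV := hX.norm_velocity_pos hp h ht
  set V := revDynamics F G (X t) (signs β)
  refine ⟨⟨t, htτ, steers_of_rev_zero h hp.isControl ht.nonneg hX.isTrajectory⟩,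
    (‖V‖⁻¹ * ν) • orientation.rightAngleRotation V, ?_, ?_,
    hX.minHamiltonian_smul_rotation_velocity hp h ht (by positivity)⟩
  · rw [norm_smul, norm_mul, norm_inv, norm_norm, Real.norm_eq_abs ν, hp.abs_ν, mul_one,
      LinearIsometryEquiv.norm_map, inv_mul_cancel₀ hV.ne']
  · rw [hX.minTime_eq hp h ht, ENNReal.toReal_ofReal ht.nonneg]
    exact hX.smul_rotation_velocity_mem_proximalNormals hp h ht (by positivity)

end IsExtremal

end Extremal

/-! ### Crossing of Lipschitz curves -/

section Crossing

theorem exists_continuousOn_lift {X Y Z : Type*} [Nonempty X] [TopologicalSpace X]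
    [TopologicalSpace Y] [TopologicalSpace Z] [T2Space Z] {K : Set X} {s : Set Y} {l : X → Z}
    {q : Y → Z} (hK : IsCompact K) (hl : ContinuousOn l K) (hinj : InjOn l K)
    (hq : ContinuousOn q s) (hmaps : MapsTo q s (l '' K)) :
    ∃ f : Y → X, ContinuousOn f s ∧ MapsTo f s K ∧ ∀ y ∈ s, l (f y) = q y := by
  have := isCompact_iff_compactSpace.1 hK
  have hind : Topology.IsInducing (K.domRestrict l) :=
    (hl.domRestrict.isClosedEmbedding hinj.injective).isInducing
  have hex : ∀ y ∈ s, ∃ x ∈ K, l x = q y := fun _ hy => hmaps hy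
  choose! f hfK hf using hex
  refine ⟨f, ?_, fun y hy => hfK y hy, hf⟩
  rw [continuousOn_iff_continuous_domRestrict] at hq ⊢
  have hlift : Continuous fun y : s => (⟨f y, hfK y y.2⟩ : K) :=
    hind.continuous_iff.2 (hq.congr fun y => (hf y y.2).symm)
  exact continuous_subtype_val.comp hlift

variable {e : Plane} {ν k : ℝ} {δ : ℝ≥0} {γ p : ℝ → Plane} {s : Set ℝ}

/-- A curve with the endpoints of `p` on its two sides is met by `p`, if the component along `e`
parametrizes it. -/
theorem exists_crossing {a₁ a₂ : ℝ} {K : Set ℝ} (he : ‖e‖ = 1) (hν : ν ≠ 0) (ha : a₁ ≤ a₂)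
    (hK : IsCompact K) (hγ : ContinuousOn γ K) (hinj : InjOn (fun b => inner ℝ e (γ b)) K)
    (hp : ContinuousOn p (Icc a₁ a₂))
    (hmaps : MapsTo (fun α => inner ℝ e (p α)) (Icc a₁ a₂) ((fun b => inner ℝ e (γ b)) '' K))
    (h₁ : ∀ b ∈ K, ν * wedge e (p a₁) ≤ ν * wedge e (γ b))
    (h₂ : ∀ b ∈ K, ν * wedge e (γ b) ≤ ν * wedge e (p a₂)) :
    ∃ α ∈ Icc a₁ a₂, ∃ b ∈ K, p α = γ b := by
  obtain ⟨f, hfc, hfK, hf⟩ := exists_continuousOn_lift hK (continuousOn_const.inner hγ) hinj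
    (continuousOn_const.inner hp) hmaps
  have hcont : ContinuousOn (fun α => ν * wedge e (p α - γ (f α))) (Icc a₁ a₂) :=
    ((wedge e).continuous.comp_continuousOn (hp.sub (hγ.comp hfc hfK))).const_mul ν
  have hzero : (0 : ℝ) ∈
      Icc (ν * wedge e (p a₁ - γ (f a₁))) (ν * wedge e (p a₂ - γ (f a₂))) := by
    simp only [map_sub, mul_sub]
    exact ⟨sub_nonpos.2 (h₁ _ (hfK (left_mem_Icc.2 ha))),
      sub_nonneg.2 (h₂ _ (hfK (right_mem_Icc.2 ha)))⟩
  obtain ⟨α, hα, hα0⟩ := intermediate_value_Icc ha hcont hzero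
  refine ⟨α, hα, f α, hfK hα, sub_eq_zero.1 ?_⟩
  have hwedge : wedge e (p α - γ (f α)) = 0 := (mul_eq_zero.1 hα0).resolve_left hν
  have hinner : inner ℝ e (p α - γ (f α)) = 0 := by rw [inner_sub_right, ← hf α hα, sub_self]
  rw [eq_inner_smul_of_wedge_eq_zero he hwedge, hinner, zero_smul]

theorem abs_inner_sub_add_mul_le (he : ‖e‖ = 1)
    (hγ : LipschitzOnWith δ (fun b => γ b + (b * k) • e) s) {b b' : ℝ} (hb : b ∈ s) (hb' : b' ∈ s) :
    |inner ℝ e (γ b) - inner ℝ e (γ b') + (b - b') * k| ≤ δ * |b - b'| := by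
  have hinner : inner ℝ e (γ b) - inner ℝ e (γ b') + (b - b') * k =
      inner ℝ e (γ b + (b * k) • e - (γ b' + (b' * k) • e)) := by
    simp only [inner_sub_right, inner_add_right, real_inner_smul_right,
      real_inner_self_eq_norm_sq, he]
    ring
  have hle := abs_real_inner_le_norm e (γ b + (b * k) • e - (γ b' + (b' * k) • e))
  rw [he, one_mul, ← dist_eq_norm] at hle
  exact hinner ▸ hle.trans (hγ.dist_le_mul b hb b' hb')

theorem injOn_inner_of_lipschitzOnWith (he : ‖e‖ = 1) (hδ : δ < k)
    (hγ : LipschitzOnWith δ (fun b => γ b + (b * k) • e) s) :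
    InjOn (fun b => inner ℝ e (γ b)) s := by
  intro b hb b' hb' hbb
  have hle := abs_inner_sub_add_mul_le he hγ hb hb'
  rw [show inner ℝ e (γ b) = inner ℝ e (γ b') from hbb, sub_self, zero_add, abs_mul, mul_comm,
    abs_of_pos (δ.2.trans_lt hδ)] at hle
  refine sub_eq_zero.1 (abs_nonpos_iff.1 (not_lt.1 fun hpos => ?_))
  exact (mul_lt_mul_of_pos_right hδ hpos).not_ge hle

theorem mem_image_inner_of_abs_le {b₀ x : ℝ} (he : ‖e‖ = 1) (hb₀ : 0 ≤ b₀)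
    (hγ : LipschitzOnWith δ (fun b => γ b + (b * k) • e) (Icc (-b₀) b₀)) (hγ0 : γ 0 = 0)
    (hcont : ContinuousOn γ (Icc (-b₀) b₀)) (hx : |x| ≤ (k - δ) * b₀) :
    x ∈ (fun b => inner ℝ e (γ b)) '' Icc (-b₀) b₀ := by
  have h0 : (0 : ℝ) ∈ Icc (-b₀) b₀ := ⟨neg_nonpos.2 hb₀, hb₀⟩
  have hle : -b₀ ≤ b₀ := neg_le_self hb₀
  have hright := abs_inner_sub_add_mul_le he hγ (right_mem_Icc.2 hle) h0
  have hleft := abs_inner_sub_add_mul_le he hγ (left_mem_Icc.2 hle) h0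
  simp only [hγ0, inner_zero_right, sub_zero, abs_neg, abs_of_nonneg hb₀] at hright hleft
  rw [abs_le] at hright hleft hx
  exact intermediate_value_Icc' hle (continuousOn_const.inner hcont)
    ⟨by linarith, by linarith⟩

theorem exists_crossing_of_lipschitzOnWith {b₀ a D : ℝ} (he : ‖e‖ = 1) (hν : |ν| = 1) (hδ : δ < k)
    (hb₀ : 0 ≤ b₀) (ha : 0 ≤ a)
    (hγ : LipschitzOnWith δ (fun b => γ b + (b * k) • e) (Icc (-b₀) b₀)) (hγ0 : γ 0 = 0)
    (hγD : ∀ b ∈ Icc (-b₀) b₀, |wedge e (γ b)| ≤ D)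
    (hp : ContinuousOn p (Icc (-a) a))
    (hpb₀ : ∀ α ∈ Icc (-a) a, |inner ℝ e (p α)| ≤ (k - δ) * b₀)
    (hpa : D ≤ ν * wedge e (p a)) (hpa' : ν * wedge e (p (-a)) ≤ -D) :
    ∃ α ∈ Icc (-a) a, ∃ b ∈ Icc (-b₀) b₀, p α = γ b := by
  have hcont : ContinuousOn γ (Icc (-b₀) b₀) := by
    have hline : Continuous fun b : ℝ => (b * k) • e := by fun_prop
    exact (hγ.continuousOn.sub hline.continuousOn).congr fun b _ => (add_sub_cancel_right _ _).symm
  have hside : ∀ b ∈ Icc (-b₀) b₀, |ν * wedge e (γ b)| ≤ D := fun b hb => by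
    simpa only [abs_mul, hν, one_mul] using hγD b hb
  exact exists_crossing he (by rintro rfl; simp at hν) (neg_le_self ha) isCompact_Icc hcont
    (injOn_inner_of_lipschitzOnWith he hδ hγ) hp
    (fun α hα => mem_image_inner_of_abs_le he hb₀ hγ hγ0 hcont (hpb₀ α hα))
    (fun b hb => hpa'.trans (abs_le.1 (hside b hb)).1)
    (fun b hb => (abs_le.1 (hside b hb)).2.trans hpa)

end Crossing

/-! ### Tilted controls -/

section Tilting

variable {M : ℕ} {F : Plane → Plane} {G : Fin M → Plane → Plane} {A : Plane →L[ℝ] Plane}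
  {B : Fin M → Plane} {C : ℝ} {e : Plane} {β : Fin M → ℝ} {ν c : ℝ}

/-- The control `u` moved towards the extremal control `signs β` if `α` is positive, and towards
`-signs β` if it is negative, by the fraction `|α|` of the way. -/
def tilt (β : Fin M → ℝ) (u : ℝ → Fin M → ℝ) (α : ℝ) (s : ℝ) (i : Fin M) : ℝ :=
  (1 - |α|) * u s i + α * signs β i

variable {u : ℝ → Fin M → ℝ} {α : ℝ}

theorem tilt_zero (β : Fin M → ℝ) (u : ℝ → Fin M → ℝ) : tilt β u 0 = u := by
  funext s i
  simp [tilt]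

theorem tilt_neg (β : Fin M → ℝ) (u : ℝ → Fin M → ℝ) (α : ℝ) : tilt β u (-α) = tilt (-β) u α := by
  funext s i
  simp [tilt, signs_neg]

theorem tilt_of_nonneg (β : Fin M → ℝ) (u : ℝ → Fin M → ℝ) (hα : 0 ≤ α) (s : ℝ) (i : Fin M) :
    tilt β u α s i = u s i + α * (signs β i - u s i) := by
  rw [tilt, abs_of_nonneg hα]
  ring

theorem IsParallel.isControl_tilt (hp : IsParallel A B e β ν c) (hu : IsControl u)
    (hα : |α| ≤ 1) : IsControl (tilt β u α) := by
  refine ⟨?_, ?_⟩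
  · have := hu.1
    unfold tilt
    fun_prop
  · filter_upwards [hu.2] with s hs
    refine mem_cube_of_abs_le_one fun i => ?_
    calc |tilt β u α s i| ≤ |(1 - |α|) * u s i| + |α * signs β i| := abs_add_le _ _
      _ = (1 - |α|) * |u s i| + |α| := by
        rw [abs_mul, abs_mul, hp.abs_signs, mul_one, abs_of_nonneg (sub_nonneg.2 hα)]
      _ ≤ (1 - |α|) * 1 + |α| := by
        gcongr
        exact abs_le_one_of_mem_cube hs i
      _ = 1 := by ring

theorem gap_tilt_left (β : Fin M → ℝ) (u : ℝ → Fin M → ℝ) (hα : 0 ≤ α) (s : ℝ) :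
    gap (tilt β u α) u s = α * gap u (fun _ => signs β) s := by
  simp only [gap, Finset.mul_sum]
  refine Finset.sum_congr rfl fun i _ => ?_
  rw [tilt_of_nonneg β u hα, add_sub_cancel_left, abs_mul, abs_of_nonneg hα, abs_sub_comm]

theorem IsParallel.gap_tilt_tilt_le (hp : IsParallel A B e β ν c) (hu : IsControl u)
    (α α' : ℝ) : ∀ᵐ s : ℝ, gap (tilt β u α) (tilt β u α') s ≤ 2 * M * |α - α'| := by
  filter_upwards [hu.2] with s hs
  have hcoord : ∀ i, |tilt β u α s i - tilt β u α' s i| ≤ 2 * |α - α'| := fun i =>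
    calc |tilt β u α s i - tilt β u α' s i| =
          |(|α'| - |α|) * u s i + (α - α') * signs β i| := by
          congr 1
          simp only [tilt]
          ring
      _ ≤ |(|α'| - |α|) * u s i| + |(α - α') * signs β i| := abs_add_le _ _
      _ ≤ |α - α'| * 1 + |α - α'| * 1 := by
        rw [abs_mul, abs_mul, hp.abs_signs, abs_sub_comm α]
        exact add_le_add_left (mul_le_mul (abs_abs_sub_abs_le α' α) (abs_le_one_of_mem_cube hs i)
          (abs_nonneg _) (abs_nonneg _)) _
      _ = 2 * |α - α'| := by ring
  calc gap (tilt β u α) (tilt β u α') s ≤ ∑ _i : Fin M, 2 * |α - α'| :=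
        Finset.sum_le_sum fun i _ => hcoord i
    _ = 2 * M * |α - α'| := by
      rw [Finset.sum_const, Finset.card_univ, Fintype.card_fin, nsmul_eq_mul]
      ring

namespace IsParallel

theorem revDynamics_tilt_sub_add_eq (hp : IsParallel A B e β ν c) {s : ℝ}
    (hus : u s ∈ Icc (-1 : Fin M → ℝ) 1) (hα : 0 ≤ α) (y y' : Plane) :
    revDynamics F G y' (tilt β u α s) - revDynamics F G y (u s) + A (y' - y) +
        (α * ∑ i, |β i| * |u s i - signs β i|) • e =
      -(F y' - F y - A (y' - y)) - ∑ i, u s i • (G i y' - G i y) -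
        ∑ i, (α * (signs β i - u s i)) • (G i y' - β i • e) := by
  have hsum : (α * ∑ i, |β i| * |u s i - signs β i|) • e =
      ∑ i, (α * (signs β i - u s i)) • β i • e := by
    rw [Finset.mul_sum, Finset.sum_smul]
    refine Finset.sum_congr rfl fun i _ => ?_
    rw [smul_smul, ← neg_sub (u s i), hp.sub_signs_eq hus i, ← signs_mul_self β i]
    congr 1
    simp only [abs_neg, abs_mul, hp.abs_signs, abs_abs, one_mul]
    ring
  rw [hsum]
  simp only [revDynamics, dynamics, tilt_of_nonneg β u hα, add_smul, smul_sub,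
    Finset.sum_sub_distrib, Finset.sum_add_distrib]
  abel

theorem norm_revDynamics_tilt_sub_add_le (hp : IsParallel A B e β ν c)
    (h : SystemBounds F G A B C) {r : ℝ} (hr : r ≤ 1) {y y' : Plane} (hy : ‖y‖ ≤ r)
    (hy' : ‖y'‖ ≤ r) {s : ℝ} (hus : u s ∈ Icc (-1 : Fin M → ℝ) 1) (hα : 0 ≤ α) :
    ‖revDynamics F G y' (tilt β u α s) - revDynamics F G y (u s) + A (y' - y) +
        (α * ∑ i, |β i| * |u s i - signs β i|) • e‖ ≤
      2 * C ^ 2 * (r * ‖y' - y‖) + C * (α * gap u (fun _ => signs β) s * r ^ 2) := by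
  have hC := h.one_le
  have hr0 : 0 ≤ r := (norm_nonneg y).trans hy
  have hlin : ‖F y' - F y - A (y' - y)‖ ≤ C ^ 2 * (r * ‖y' - y‖) :=
    calc _ ≤ C * r * ‖y' - y‖ := h.F_sub r hr _ _ hy' hy
      _ ≤ C ^ 2 * r * ‖y' - y‖ := by
        gcongr
        exact le_self_pow₀ hC two_ne_zero
      _ = _ := by ring
  have hfield : ‖∑ i, u s i • (G i y' - G i y)‖ ≤ C ^ 2 * (r * ‖y' - y‖) :=
    calc _ ≤ M * (C * r * ‖y' - y‖) := norm_sum_smul_le hus fun i => h.G_sub i r hr _ _ hy' hy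
      _ ≤ C * (C * r * ‖y' - y‖) := by
        gcongr
        exact h.card_le
      _ = _ := by ring
  have htilt : ‖∑ i, (α * (signs β i - u s i)) • (G i y' - β i • e)‖ ≤
      C * (α * gap u (fun _ => signs β) s * r ^ 2) := by
    rw [gap, Finset.mul_sum, Finset.sum_mul, Finset.mul_sum]
    refine norm_sum_le_of_le _ fun i _ => ?_
    rw [norm_smul, norm_mul, Real.norm_eq_abs, Real.norm_eq_abs, abs_of_nonneg hα, abs_sub_comm]
    calc _ ≤ α * |u s i - signs β i| * (C * r ^ 2) := by
          gcongr
          exact (hp.norm_field_sub_le h i (hy'.trans hr)).trans (by gcongr)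
      _ = _ := by ring
  rw [hp.revDynamics_tilt_sub_add_eq hus hα]
  calc _ ≤ C ^ 2 * (r * ‖y' - y‖) + C ^ 2 * (r * ‖y' - y‖) +
        C * (α * gap u (fun _ => signs β) s * r ^ 2) :=
        norm_sub_le_of_le (norm_sub_le_of_le (by rwa [norm_neg]) hfield) htilt
    _ = _ := by ring

/-- The derivative of the drift-corrected side `ν ⟨e, z⟩ + s ν ⟨e, A z⟩`, with `⟨·,·⟩` the area
form, of a curve `z` with velocity `V`. The correction cancels the first-order effect of `A`, so
that the `e`-component `-q` of the velocity only acts through `s A e`. -/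
theorem mul_wedge_add_mul_wedge_le (hp : IsParallel A B e β ν c) (h : SystemBounds F G A B C)
    {s q g : ℝ} (hs : s ∈ Icc 0 1) (hg : 0 ≤ g) (hgq : c * g ≤ q) (V z : Plane) :
    ν * (wedge e V + (wedge e (A z) + s * wedge e (A V))) ≤
      (1 + C) * ‖V + A z + q • e‖ + C ^ 2 * (s * ‖z‖) - c ^ 2 * (s * g) := by
  have hC := zero_le_one.trans h.one_le
  have hs0 := hs.1
  set R := V + A z + q • e with hR
  have hA : ∀ y, ‖A y‖ ≤ C * ‖y‖ := A.le_of_opNorm_le h.norm_A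
  have hwedge : ∀ y, ν * wedge e y ≤ ‖y‖ := fun y => by
    simpa only [hp.norm_e, one_mul] using (le_abs_self _).trans (hp.abs_mul_wedge_le e y)
  have hexpand : ν * (wedge e V + (wedge e (A z) + s * wedge e (A V))) =
      ν * wedge e R + s * (ν * wedge e (A R)) + s * (ν * wedge e (-A (A z))) -
        s * q * (ν * wedge e (A e)) := by
    simp only [hR, map_add, map_smul, map_neg, smul_eq_mul, wedge_self]
    ring
  have hAR : s * (ν * wedge e (A R)) ≤ C * ‖R‖ :=
    calc _ ≤ s * (C * ‖R‖) := mul_le_mul_of_nonneg_left ((hwedge _).trans (hA R)) hs0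
      _ ≤ C * ‖R‖ := mul_le_of_le_one_left (by positivity) hs.2
  have hAA : s * (ν * wedge e (-A (A z))) ≤ C ^ 2 * (s * ‖z‖) :=
    calc _ ≤ s * (C * (C * ‖z‖)) := by
          refine mul_le_mul_of_nonneg_left ((hwedge _).trans ?_) hs0
          rw [norm_neg]
          exact (hA _).trans (mul_le_mul_of_nonneg_left (hA z) hC)
      _ = _ := by ring
  have htransversal : c ^ 2 * (s * g) ≤ s * q * (ν * wedge e (A e)) :=
    calc c ^ 2 * (s * g) = s * (c * g) * c := by ring
      _ ≤ s * q * (ν * wedge e (A e)) := by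
        have hc := hp.c_pos
        have hq : 0 ≤ q := (mul_nonneg hc.le hg).trans hgq
        gcongr
        exact hp.c_le_wedge
  rw [hexpand]
  linarith [hwedge R]

end IsParallel

/-- A trajectory `x` of the reversed dynamics from the origin, with control `u`, and a nearby one
`x'` with the tilted control, not necessarily from the origin. -/
structure IsTilted (F : Plane → Plane) (G : Fin M → Plane → Plane) (β : Fin M → ℝ) (C t α : ℝ)
    (u : ℝ → Fin M → ℝ) (x x' : ℝ → Plane) : Prop where
  nonneg : 0 ≤ α
  le_one : α ≤ 1
  isControl : IsControl u
  isTrajectory : IsTrajectory (revDynamics F G) u 0 t x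
  isTrajectory_tilt : IsTrajectory (revDynamics F G) (tilt β u α) (x' 0) t x'
  norm_le_one : ∀ r ∈ Icc 0 t, ‖x' r‖ ≤ 1
  small : 4 * C ^ 2 * (‖x' t - x t‖ + α) ≤ 1 / 2

namespace IsTilted

variable {t s : ℝ} {x x' : ℝ → Plane}

theorem isControl_tilt (hx : IsTilted F G β C t α u x x') (hp : IsParallel A B e β ν c) :
    IsControl (tilt β u α) :=
  hp.isControl_tilt hx.isControl ((abs_of_nonneg hx.nonneg).trans_le hx.le_one)

theorem norm_sub_le_integral (hx : IsTilted F G β C t α u x x') (hp : IsParallel A B e β ν c)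
    (h : SystemBounds F G A B C) (ht : IsSmallTime C c t) (hs : s ∈ Icc 0 t) :
    ‖x' s - x s‖ ≤
      2 * (‖x' t - x t‖ + C * (α * ∫ r in s..t, gap u (fun _ => signs β) r)) := by
  have hdist := norm_sub_trajectory_le h.isControlField_rev (by linarith [ht.mul_le])
    (hx.isControl_tilt hp) hx.isTrajectory_tilt hx.norm_le_one hx.isControl hx.isTrajectory
    (fun r hr => (hx.isTrajectory.norm_lt_one h.isControlField_rev hx.isControl
      ht.norm_zero_add_lt hr).le) hs ⟨ht.nonneg, le_rfl⟩
  have hnonneg : 0 ≤ α * ∫ r in s..t, gap u (fun _ => signs β) r :=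
    mul_nonneg hx.nonneg (intervalIntegral.integral_nonneg hs.2 fun r _ => gap_nonneg _ _ r)
  rwa [intervalIntegral.integral_symm, abs_neg,
    intervalIntegral.integral_congr fun r _ => gap_tilt_left β u hx.nonneg r,
    intervalIntegral.integral_const_mul, abs_of_nonneg hnonneg] at hdist

theorem norm_sub_le (hx : IsTilted F G β C t α u x x') (hp : IsParallel A B e β ν c)
    (h : SystemBounds F G A B C) (ht : IsSmallTime C c t) (hs : s ∈ Icc 0 t) :
    ‖x' s - x s‖ ≤ 4 * C ^ 2 * (‖x' t - x t‖ + α) := by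
  have hC := h.one_le
  have hα := hx.nonneg
  set d := ‖x' t - x t‖
  have htail : ∫ r in s..t, gap u (fun _ => signs β) r ≤ 2 * C :=
    calc _ ≤ 2 * M * (t - s) := integral_gap_le hx.isControl hp.isControl hs.2
      _ ≤ 2 * C * 1 := by
        gcongr
        exacts [sub_nonneg.2 hs.2, h.card_le, by linarith [hs.1, ht.le_one hC]]
      _ = 2 * C := mul_one _
  calc ‖x' s - x s‖ ≤ 2 * (d + C * (α * (2 * C))) :=
        (hx.norm_sub_le_integral hp h ht hs).trans (by gcongr)
    _ = 2 * d + 4 * C ^ 2 * α := by ring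
    _ ≤ 4 * C ^ 2 * d + 4 * C ^ 2 * α := by
      gcongr
      nlinarith
    _ = 4 * C ^ 2 * (d + α) := by ring

theorem mul_norm_sub_le (hx : IsTilted F G β C t α u x x') (hp : IsParallel A B e β ν c)
    (h : SystemBounds F G A B C) (ht : IsSmallTime C c t) (hs : s ∈ Icc 0 t) :
    s * ‖x' s - x s‖ ≤
      2 * (‖x' t - x t‖ + C * (α * moment u (fun _ => signs β) t)) := by
  have hC := h.one_le
  have hα := hx.nonneg
  have hs0 := hs.1
  set d := ‖x' t - x t‖
  set g := ∫ r in s..t, gap u (fun _ => signs β) r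
  calc s * ‖x' s - x s‖ ≤ s * (2 * (d + C * (α * g))) := by
        gcongr
        exact hx.norm_sub_le_integral hp h ht hs
    _ = 2 * (s * d + C * (α * (s * g))) := by ring
    _ ≤ 2 * (1 * d + C * (α * moment u (fun _ => signs β) t)) := by
      gcongr
      exacts [hs.2.trans (ht.le_one hC), mul_integral_gap_le_moment hx.isControl hp.isControl hs]
    _ = _ := by rw [one_mul]

theorem norm_le (hx : IsTilted F G β C t α u x x') (h : SystemBounds F G A B C)
    (ht : IsSmallTime C c t) (hs : s ∈ Icc 0 t) :
    ‖x s‖ ≤ 4 * C ^ 2 * (‖x' t - x t‖ + α) + C * s := by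
  have hα := hx.nonneg
  have hnorm := hx.isTrajectory.norm_le h.isControlField_rev hx.isControl ht.norm_zero_add_lt hs
  rw [norm_zero, zero_add] at hnorm
  exact hnorm.trans (le_add_of_nonneg_left (by positivity))

theorem norm_zero_add_lt (hx : IsTilted F G β C t α u x x') (hp : IsParallel A B e β ν c)
    (h : SystemBounds F G A B C) (ht : IsSmallTime C c t) : ‖x' 0‖ + C * t < 1 := by
  have hzero := hx.norm_sub_le hp h ht ⟨le_rfl, ht.nonneg⟩
  rw [hx.isTrajectory.apply_zero ht.nonneg, sub_zero] at hzero
  linarith [hx.small, ht.mul_le]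

theorem norm_tilt_le (hx : IsTilted F G β C t α u x x') (hp : IsParallel A B e β ν c)
    (h : SystemBounds F G A B C) (ht : IsSmallTime C c t) (hs : s ∈ Icc 0 t) :
    ‖x' s‖ ≤ 4 * C ^ 2 * (‖x' t - x t‖ + α) + C * s := by
  have hzero := hx.norm_sub_le hp h ht ⟨le_rfl, ht.nonneg⟩
  rw [hx.isTrajectory.apply_zero ht.nonneg, sub_zero] at hzero
  have hnorm := hx.isTrajectory_tilt.norm_le h.isControlField_rev (hx.isControl_tilt hp)
    (hx.norm_zero_add_lt hp h ht) hs
  linarith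

end IsTilted

end Tilting

section TiltedWedge

variable {M : ℕ} {F : Plane → Plane} {G : Fin M → Plane → Plane} {A : Plane →L[ℝ] Plane}
  {B : Fin M → Plane} {C : ℝ} {e : Plane} {β : Fin M → ℝ} {ν c : ℝ}

theorem tilt_remainder_le {s t N y g ρ : ℝ} (hC : 1 ≤ C) (hN : 0 ≤ N) (hyN : y ≤ N) (hs : 0 ≤ s)
    (hst : s ≤ t) (hg : 0 ≤ g) (hgC : g ≤ 2 * C)
    (hρ : ρ ≤ 2 * C ^ 2 * ((N + C * s) * y) + C * (g * (N + C * s) ^ 2)) (hρ0 : 0 ≤ ρ)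
    (hy : 0 ≤ y) :
    (1 + C) * ρ + C ^ 2 * (s * y) ≤
      12 * C ^ 3 * N ^ 2 + 5 * C ^ 4 * (s * y) + 4 * C ^ 4 * t * (s * g) := by
  have hdist : (N + C * s) * y ≤ N ^ 2 + C * (s * y) := by
    linarith [mul_le_mul_of_nonneg_left hyN hN]
  have hgap : g * (N + C * s) ^ 2 ≤ 4 * C * N ^ 2 + 2 * C ^ 2 * t * (s * g) :=
    calc g * (N + C * s) ^ 2 ≤ g * (2 * N ^ 2 + 2 * (C * s) ^ 2) := by
          gcongr
          linarith [sq_nonneg (N - C * s)]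
      _ = g * (2 * N ^ 2) + 2 * C ^ 2 * s * (s * g) := by ring
      _ ≤ 2 * C * (2 * N ^ 2) + 2 * C ^ 2 * t * (s * g) := by gcongr
      _ = _ := by ring
  calc (1 + C) * ρ + C ^ 2 * (s * y) ≤ 2 * C * ρ + C ^ 4 * (s * y) := by
        gcongr
        exacts [by linarith, by norm_num]
    _ ≤ 2 * C * (2 * C ^ 2 * (N ^ 2 + C * (s * y)) +
          C * (4 * C * N ^ 2 + 2 * C ^ 2 * t * (s * g))) + C ^ 4 * (s * y) := by
        gcongr
        exact hρ.trans (by gcongr)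
    _ = _ := by ring

theorem IsParallel.neg_le_mul_wedge_add (hp : IsParallel A B e β ν c) (h : SystemBounds F G A B C)
    {t : ℝ} (ht : IsSmallTime C c t) (z : Plane) :
    -(2 * C ^ 4 * ‖z‖) ≤ ν * (wedge e z + t * wedge e (A z)) := by
  have hC := h.one_le
  have ht0 := ht.nonneg
  have hwedge : ∀ y, |ν * wedge e y| ≤ ‖y‖ := fun y => by
    simpa only [hp.norm_e, one_mul] using hp.abs_mul_wedge_le e y
  have hA : |t * (ν * wedge e (A z))| ≤ C ^ 4 * ‖z‖ :=
    calc _ = t * |ν * wedge e (A z)| := by rw [abs_mul, abs_of_nonneg ht0]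
      _ ≤ 1 * (C * ‖z‖) := by
        gcongr
        exacts [ht.le_one hC, (hwedge _).trans (A.le_of_opNorm_le h.norm_A z)]
      _ ≤ C ^ 4 * ‖z‖ := by
        rw [one_mul]
        gcongr
        exact le_self_pow₀ hC (by norm_num)
  have hz : ‖z‖ ≤ C ^ 4 * ‖z‖ := le_mul_of_one_le_left (norm_nonneg z) (one_le_pow₀ hC)
  linarith [(abs_le.1 hA).1, (abs_le.1 (hwedge z)).1]

namespace IsTilted

variable {t s α : ℝ} {u : ℝ → Fin M → ℝ} {x x' : ℝ → Plane}

theorem mul_wedge_velocity_sub_le (hx : IsTilted F G β C t α u x x')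
    (hp : IsParallel A B e β ν c) (h : SystemBounds F G A B C) (ht : IsSmallTime C c t)
    (hs : s ∈ Icc 0 t) (hus : u s ∈ Icc (-1 : Fin M → ℝ) 1)
    (hgap : gap u (fun _ => signs β) s ≤ 2 * M) {V : Plane}
    (hV : V = revDynamics F G (x' s) (tilt β u α s) - revDynamics F G (x s) (u s)) :
    ν * (wedge e V + (wedge e (A (x' s - x s)) + s * wedge e (A V))) ≤
      192 * C ^ 7 * (‖x' t - x t‖ + α) ^ 2 + 10 * C ^ 4 * ‖x' t - x t‖ +
        10 * C ^ 5 * (α * moment u (fun _ => signs β) t) -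
        (c ^ 2 - 4 * C ^ 4 * t) * α * (s * gap u (fun _ => signs β) s) := by
  have hC := h.one_le
  have hα := hx.nonneg
  have hs0 := hs.1
  set d := ‖x' t - x t‖
  set g := gap u (fun _ => signs β) s with hg
  set N := 4 * C ^ 2 * (d + α)
  set q := ∑ i, |β i| * |u s i - signs β i|
  set ρ := ‖V + A (x' s - x s) + (α * q) • e‖ with hρ
  have hg0 : 0 ≤ g := gap_nonneg _ _ s
  have hgq : c * (α * g) ≤ α * q := by
    rw [mul_left_comm, hg, gap, Finset.mul_sum]
    exact mul_le_mul_of_nonneg_left (Finset.sum_le_sum fun i _ =>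
      mul_le_mul_of_nonneg_right (hp.c_le i) (abs_nonneg _)) hα
  have hagC : α * g ≤ 2 * C :=
    (mul_le_of_le_one_left hg0 hx.le_one).trans (hgap.trans (by gcongr; exact h.card_le))
  have hr : N + C * s ≤ 1 := by
    have : C * s ≤ C * t := by gcongr; exact hs.2
    linarith [ht.mul_le, hx.small]
  have hρle : ρ ≤ 2 * C ^ 2 * ((N + C * s) * ‖x' s - x s‖) +
      C * (α * g * (N + C * s) ^ 2) := by
    rw [hρ, hV]
    exact hp.norm_revDynamics_tilt_sub_add_le h hr (hx.norm_le h ht hs)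
      (hx.norm_tilt_le hp h ht hs) hus hα
  have hderiv := hp.mul_wedge_add_mul_wedge_le h ⟨hs0, hs.2.trans (ht.le_one hC)⟩
    (mul_nonneg hα hg0) hgq V (x' s - x s)
  have hremainder := tilt_remainder_le hC (by positivity) (hx.norm_sub_le hp h ht hs) hs0 hs.2
    (mul_nonneg hα hg0) hagC hρle (norm_nonneg _) (norm_nonneg _)
  have hweighted : 5 * C ^ 4 * (s * ‖x' s - x s‖) ≤
      5 * C ^ 4 * (2 * (d + C * (α * moment u (fun _ => signs β) t))) :=
    mul_le_mul_of_nonneg_left (hx.mul_norm_sub_le hp h ht hs) (by positivity)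
  linarith

theorem absolutelyContinuousOnInterval (hx : IsTilted F G β C t α u x x')
    (hp : IsParallel A B e β ν c) (h : SystemBounds F G A B C) (ht : IsSmallTime C c t) :
    AbsolutelyContinuousOnInterval
      (fun s => ν * (wedge e (x' s - x s) + s * wedge e (A (x' s - x s)))) 0 t := by
  have hf := h.isControlField_rev
  have hz : LipschitzOnWith (C.toNNReal + C.toNNReal) (fun s => x' s - x s) (uIcc 0 t) := by
    rw [uIcc_of_le ht.nonneg]
    exact (hx.isTrajectory_tilt.lipschitzOnWith hf (hx.isControl_tilt hp)
      (hx.norm_zero_add_lt hp h ht)).sub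
      (hx.isTrajectory.lipschitzOnWith hf hx.isControl ht.norm_zero_add_lt)
  have he : LipschitzOnWith 0 (fun _ : ℝ => e) (uIcc 0 t) := (LipschitzWith.const e).lipschitzOnWith
  exact ((absolutelyContinuousOnInterval_wedge he hz).fun_add
    (contDiffOn_id.absolutelyContinuousOnInterval.fun_mul
      (absolutelyContinuousOnInterval_wedge he (A.lipschitz.comp_lipschitzOnWith hz)))).const_mul ν

theorem ae_hasDerivAt_le (hx : IsTilted F G β C t α u x x')
    (hp : IsParallel A B e β ν c) (h : SystemBounds F G A B C) (ht : IsSmallTime C c t) :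
    ∀ᵐ s : ℝ, s ∈ Ioo 0 t → ∃ d,
      HasDerivAt (fun s => ν * (wedge e (x' s - x s) + s * wedge e (A (x' s - x s)))) d s ∧
      d ≤ 192 * C ^ 7 * (‖x' t - x t‖ + α) ^ 2 + 10 * C ^ 4 * ‖x' t - x t‖ +
        10 * C ^ 5 * (α * moment u (fun _ => signs β) t) -
        (c ^ 2 - 4 * C ^ 4 * t) * α * (s * gap u (fun _ => signs β) s) := by
  have hf := h.isControlField_rev
  filter_upwards [hx.isTrajectory.ae_hasDerivAt hf hx.isControl ht.nonneg,
    hx.isTrajectory_tilt.ae_hasDerivAt hf (hx.isControl_tilt hp) ht.nonneg, hx.isControl.2,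
    gap_le hx.isControl hp.isControl] with s hder hder' hus hgap hs
  have hz := (hder' hs).fun_sub (hder hs)
  have hAz : HasDerivAt (fun r => A (x' r - x r)) _ s := A.hasFDerivAt.comp_hasDerivAt s hz
  have hχ := ((hasDerivAt_wedge (hasDerivAt_const s e) hz).fun_add
    ((hasDerivAt_id' s).fun_mul (hasDerivAt_wedge (hasDerivAt_const s e) hAz))).const_mul ν
  refine ⟨_, hχ, ?_⟩
  simp only [map_zero, zero_apply, add_zero, one_mul]
  exact hx.mul_wedge_velocity_sub_le hp h ht (Ioo_subset_Icc_self hs) hus hgap rfl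

theorem le_mul_wedge (hx : IsTilted F G β C t α u x x') (hp : IsParallel A B e β ν c)
    (h : SystemBounds F G A B C) (ht : IsSmallTime C c t) :
    c ^ 2 / 2 * (α * moment u (fun _ => signs β) t) - 12 * C ^ 4 * ‖x' t - x t‖ -
      192 * C ^ 7 * (‖x' t - x t‖ + α) ^ 2 ≤ ν * wedge e (x' 0) := by
  have hC := h.one_le
  have ht0 := ht.nonneg
  set d := ‖x' t - x t‖
  set m := moment u (fun _ => signs β) t with hm
  have hint := (moment_intervalIntegrable hx.isControl hp.isControl 0 t).const_mul
    ((c ^ 2 - 4 * C ^ 4 * t) * α)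
  have hmove := sub_le_integral_of_ae_hasDerivAt_le ht0
    (hx.absolutelyContinuousOnInterval hp h ht) (intervalIntegrable_const.sub hint)
    (hx.ae_hasDerivAt_le hp h ht)
  rw [intervalIntegral.integral_sub intervalIntegrable_const hint,
    intervalIntegral.integral_const, intervalIntegral.integral_const_mul, sub_zero, smul_eq_mul,
    ← moment, ← hm, hx.isTrajectory.apply_zero ht0, sub_zero, zero_mul, add_zero] at hmove
  have hfinal := hp.neg_le_mul_wedge_add h ht (x' t - x t)
  have hαm : 0 ≤ α * m := mul_nonneg hx.nonneg (moment_nonneg _ _ ht0)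
  have herror : t * (192 * C ^ 7 * (d + α) ^ 2 + 10 * C ^ 4 * d) ≤
      192 * C ^ 7 * (d + α) ^ 2 + 10 * C ^ 4 * d :=
    mul_le_of_le_one_left (by positivity) (ht.le_one hC)
  have hsmall : 14 * C ^ 5 * t ≤ c ^ 2 / 2 := by
    have hpow : c ^ 3 ≤ c ^ 2 := pow_le_pow_of_le_one hp.c_pos.le hp.c_le_one (by norm_num)
    have : 0 ≤ C ^ 5 * t := by positivity
    linarith [ht.pow_mul_le, sq_nonneg c]
  have hmoment : (4 * C ^ 4 * t + 10 * C ^ 5 * t) * (α * m) ≤ c ^ 2 / 2 * (α * m) := by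
    gcongr
    calc 4 * C ^ 4 * t + 10 * C ^ 5 * t ≤ 4 * C ^ 5 * t + 10 * C ^ 5 * t := by
          gcongr
          norm_num
      _ ≤ c ^ 2 / 2 := by linarith
  linarith

end IsTilted

end TiltedWedge

section Curves

theorem lipschitzOnWith_Icc_of_Icc_of_Icc {E : Type*} [PseudoMetricSpace E] {f : ℝ → E} {K : ℝ≥0}
    {a b c : ℝ} (hab : LipschitzOnWith K f (Icc a b)) (hbc : LipschitzOnWith K f (Icc b c)) :
    LipschitzOnWith K f (Icc a c) := by
  refine LipschitzOnWith.of_dist_le_mul fun x hx y hy => ?_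
  wlog hxy : x ≤ y generalizing x y
  · rw [dist_comm, dist_comm x]
    exact this y hy x hx (le_of_not_ge hxy)
  rcases le_total y b with hyb | hby
  · exact hab.dist_le_mul x ⟨hx.1, hxy.trans hyb⟩ y ⟨hy.1, hyb⟩
  rcases le_total b x with hbx | hxb
  · exact hbc.dist_le_mul x ⟨hbx, hx.2⟩ y ⟨hby, hy.2⟩
  calc dist (f x) (f y) ≤ dist (f x) (f b) + dist (f b) (f y) := dist_triangle _ _ _
    _ ≤ K * dist x b + K * dist b y :=
      add_le_add (hab.dist_le_mul x ⟨hx.1, hxb⟩ b ⟨hx.1.trans hxb, le_rfl⟩)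
        (hbc.dist_le_mul b ⟨le_rfl, hby.trans hy.2⟩ y ⟨hby, hy.2⟩)
    _ = K * dist x y := by
      rw [← mul_add, dist_add_dist_of_mem_segment]
      exact Icc_subset_segment ⟨hxb, hby⟩

variable {M : ℕ} {F : Plane → Plane} {G : Fin M → Plane → Plane} {A : Plane →L[ℝ] Plane}
  {B : Fin M → Plane} {C : ℝ} {e : Plane} {β : Fin M → ℝ} {ν c T b : ℝ} {X Y : ℝ → Plane}

theorem IsParallel.exists_isExtremal (hp : IsParallel A B e β ν c) (h : SystemBounds F G A B C)
    (hT : IsSmallTime C c T) : ∃ X, IsExtremal F G β T X := by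
  have hCT := hT.mul_le
  obtain ⟨X, hXc, hX⟩ := exists_trajectory (p := 0) h.isControlField_rev hp.isControl hT.nonneg
    (by linarith) hT.norm_zero_add_lt.le
  exact ⟨X, hXc, hX⟩

theorem IsExtremal.lipschitzOnWith_add_smul (hX : IsExtremal F G β T X)
    (hp : IsParallel A B e β ν c) (h : SystemBounds F G A B C) (hT : IsSmallTime C c T) :
    LipschitzOnWith (c / 4).toNNReal (fun s => X s + (s * totalSize β) • e) (Icc 0 T) := by
  refine LipschitzOnWith.of_dist_le_mul fun s hs r hr => ?_
  wlog hrs : r ≤ s generalizing s r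
  · rw [dist_comm, dist_comm s]
    exact this r hr s hs (le_of_not_ge hrs)
  rw [dist_eq_norm, Real.dist_eq, abs_of_nonneg (sub_nonneg.2 hrs),
    Real.coe_toNNReal _ (by linarith [hp.c_pos])]
  calc ‖X s + (s * totalSize β) • e - (X r + (r * totalSize β) • e)‖ =
        ‖X s - X r + (s - r) • totalSize β • e‖ := by
        congr 1
        module
    _ ≤ C ^ 2 * s * (s - r) := hX.norm_sub_add_smul_le hp h hT hs ⟨hr.1, hrs⟩
    _ ≤ C ^ 2 * T * (s - r) := by
      gcongr
      exact hs.2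
    _ ≤ c / 4 * (s - r) := mul_le_mul_of_nonneg_right (hp.sq_mul_le h hT) (sub_nonneg.2 hrs)

theorem IsExtremal.abs_wedge_le (hX : IsExtremal F G β T X) (hp : IsParallel A B e β ν c)
    (h : SystemBounds F G A B C) (hT : IsSmallTime C c T) {s : ℝ} (hs : s ∈ Icc 0 T) :
    |wedge e (X s)| ≤ C ^ 2 * s ^ 2 :=
  calc |wedge e (X s)| = |wedge e (X s + s • totalSize β • e)| := by
        simp only [map_add, map_smul, wedge_self, smul_zero, add_zero]
    _ ≤ ‖e‖ * ‖X s + s • totalSize β • e‖ := MinTime.abs_wedge_le _ _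
    _ ≤ C ^ 2 * s ^ 2 := by
      rw [hp.norm_e, one_mul]
      exact hX.norm_add_smul_le hp h hT hs

theorem totalSize_neg (β : Fin M → ℝ) : totalSize (-β) = totalSize β := by
  simp only [totalSize, Pi.neg_apply, abs_neg]

/-- The two curves `X` and `Y` issuing from the same point, joined to a single one in which `Y` is
traversed backwards on negative parameters. -/
def joinCurves (X Y : ℝ → Plane) (b : ℝ) : Plane := if 0 ≤ b then X b else Y (-b)

theorem joinCurves_of_nonneg (X Y : ℝ → Plane) (hb : 0 ≤ b) : joinCurves X Y b = X b :=
  if_pos hb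

theorem joinCurves_of_nonpos (h : X 0 = Y 0) (hb : b ≤ 0) : joinCurves X Y b = Y (-b) := by
  rcases hb.eq_or_lt with rfl | hb
  · simp [joinCurves, h]
  · exact if_neg hb.not_ge

namespace IsExtremal

theorem apply_zero_eq (hX : IsExtremal F G β T X) (hY : IsExtremal F G (-β) T Y) (hT : 0 ≤ T) :
    X 0 = Y 0 := by
  rw [hX.isTrajectory.apply_zero hT, hY.isTrajectory.apply_zero hT]

theorem lipschitzOnWith_joinCurves_add_smul (hX : IsExtremal F G β T X)
    (hY : IsExtremal F G (-β) T Y) (hp : IsParallel A B e β ν c) (h : SystemBounds F G A B C)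
    (hT : IsSmallTime C c T) :
    LipschitzOnWith (c / 4).toNNReal (fun b => joinCurves X Y b + (b * totalSize β) • e)
      (Icc (-T) T) := by
  refine lipschitzOnWith_Icc_of_Icc_of_Icc (b := 0) ?_ ?_
  · have hneg := (hY.lipschitzOnWith_add_smul hp.neg h hT).comp (f := fun b => -b) (s := Icc (-T) 0)
      (IsometryEquiv.neg ℝ).isometry.lipschitz.lipschitzOnWith
      fun b hb => ⟨neg_nonneg.2 hb.2, neg_le.1 hb.1⟩
    rw [mul_one] at hneg
    have h0 := hX.apply_zero_eq hY hT.nonneg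
    intro b hb b' hb'
    simpa [joinCurves_of_nonpos h0 hb.2, joinCurves_of_nonpos h0 hb'.2, totalSize_neg]
      using hneg hb hb'
  · intro b hb b' hb'
    simpa only [joinCurves_of_nonneg X Y hb.1, joinCurves_of_nonneg X Y hb'.1]
      using hX.lipschitzOnWith_add_smul hp h hT hb hb'

theorem abs_wedge_joinCurves_le (hX : IsExtremal F G β T X) (hY : IsExtremal F G (-β) T Y)
    (hp : IsParallel A B e β ν c) (h : SystemBounds F G A B C) (hT : IsSmallTime C c T)
    (hb : b ∈ Icc (-T) T) : |wedge e (joinCurves X Y b)| ≤ C ^ 2 * b ^ 2 := by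
  rcases le_total 0 b with hb0 | hb0
  · rw [joinCurves_of_nonneg X Y hb0]
    exact hX.abs_wedge_le hp h hT ⟨hb0, hb.2⟩
  · rw [joinCurves_of_nonpos (hX.apply_zero_eq hY hT.nonneg) hb0]
    simpa using hY.abs_wedge_le hp.neg h hT ⟨neg_nonneg.2 hb0, neg_le.1 hb.1⟩

theorem steers_joinCurves (hX : IsExtremal F G β T X) (hY : IsExtremal F G (-β) T Y)
    (hp : IsParallel A B e β ν c) (h : SystemBounds F G A B C) (hb : b ∈ Icc (-T) T) :
    Steers F G (joinCurves X Y b) |b| := by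
  rcases le_total 0 b with hb0 | hb0
  · rw [joinCurves_of_nonneg X Y hb0, abs_of_nonneg hb0]
    exact steers_of_rev_zero h hp.isControl hb0 (hX.isTrajectory.mono hb.2)
  · have hT := neg_nonpos.1 (hb.1.trans hb0)
    rw [joinCurves_of_nonpos (hX.apply_zero_eq hY hT) hb0, abs_of_nonpos hb0]
    exact steers_of_rev_zero h hp.neg.isControl (neg_nonneg.2 hb0)
      (hY.isTrajectory.mono (neg_le.1 hb.1))

end IsExtremal

end Curves

section TiltFamily

variable {M : ℕ} {F : Plane → Plane} {G : Fin M → Plane → Plane} {A : Plane →L[ℝ] Plane}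
  {B : Fin M → Plane} {C : ℝ} {e : Plane} {β : Fin M → ℝ} {ν c T t a : ℝ} {b : Plane}
  {X Y x : ℝ → Plane} {u v : ℝ → Fin M → ℝ}

theorem SystemBounds.exists_trajectory_to (h : SystemBounds F G A B C) (hu : IsControl u)
    (ht : 0 ≤ t) (hCt : C * t ≤ 1 / 2) (hb : ‖b‖ + C * t < 1) :
    ∃ x : ℝ → Plane, IsTrajectory (revDynamics F G) u (x 0) t x ∧ x t = b ∧
      ∀ r ∈ Icc 0 t, ‖x r‖ ≤ 1 := by
  have hv := hu.comp_sub_left t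
  obtain ⟨y, -, hy⟩ := exists_trajectory h.isControlField hv ht hCt hb.le
  refine ⟨fun s => y (t - s), ?_, by simp [hy.apply_zero ht], fun r hr => ?_⟩
  · have hrev := hy.reverse h.isControlField hv ht
    simp only [sub_sub_cancel] at hrev
    simp only [sub_zero]
    exact hrev
  · exact (hy.norm_lt_one h.isControlField hv hb ⟨sub_nonneg.2 hr.2, sub_le_self _ hr.1⟩).le

theorem SystemBounds.norm_sub_sq_le_moment (h : SystemBounds F G A B C) (ht : 0 ≤ t)
    (hCt : C * t ≤ 1 / 4) (hu : IsControl u) (hv : IsControl v) {y : ℝ → Plane}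
    (hx : IsTrajectory (revDynamics F G) u 0 t x) (hy : IsTrajectory (revDynamics F G) v 0 t y) :
    ‖x t - y t‖ ^ 2 ≤ 32 * C ^ 3 * moment u v t := by
  have hC := h.one_le
  have hf := h.isControlField_rev
  have hlt : ‖(0 : Plane)‖ + C * t < 1 := by
    rw [norm_zero]
    linarith
  set q := ∫ s in (0 : ℝ)..t, gap u v s
  have hq0 : 0 ≤ q := intervalIntegral.integral_nonneg ht fun s _ => gap_nonneg u v s
  have hdist := norm_sub_trajectory_le hf (by linarith) hu hx
    (fun r hr => (hx.norm_lt_one hf hu hlt hr).le) hv hy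
    (fun r hr => (hy.norm_lt_one hf hv hlt hr).le) (right_mem_Icc.2 ht) (left_mem_Icc.2 ht)
  rw [hx.apply_zero ht, hy.apply_zero ht, sub_self, norm_zero, zero_add,
    abs_of_nonneg hq0] at hdist
  calc ‖x t - y t‖ ^ 2 ≤ (2 * (C * q)) ^ 2 := by gcongr
    _ = 4 * C ^ 2 * q ^ 2 := by ring
    _ ≤ 4 * C ^ 2 * (8 * M * moment u v t) := by
      gcongr
      exact sq_integral_gap_le hu hv ht
    _ ≤ 4 * C ^ 2 * (8 * C * moment u v t) := by
      have := moment_nonneg u v ht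
      gcongr
      exact h.card_le
    _ = 32 * C ^ 3 * moment u v t := by ring

theorem SystemBounds.norm_sub_zero_le (h : SystemBounds F G A B C) (ht : 0 ≤ t)
    (hCt : C * t ≤ 1 / 4) (hu : IsControl u) (hv : IsControl v) {y : ℝ → Plane}
    (hx : IsTrajectory (revDynamics F G) u (x 0) t x)
    (hx1 : ∀ r ∈ Icc 0 t, ‖x r‖ ≤ 1)
    (hy : IsTrajectory (revDynamics F G) v (y 0) t y)
    (hy1 : ∀ r ∈ Icc 0 t, ‖y r‖ ≤ 1) {κ : ℝ} (hκ : 0 ≤ κ) (huv : ∀ᵐ s : ℝ, gap u v s ≤ 2 * M * κ) :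
    ‖x 0 - y 0‖ ≤ 2 * ‖x t - y t‖ + C * κ := by
  have hC := h.one_le
  have hgap : C * |∫ s in t..0, gap u v s| ≤ 1 / 2 * (C * κ) :=
    calc C * |∫ s in t..0, gap u v s| ≤ C * (2 * M * κ * |0 - t|) := by
          gcongr
          exact abs_integral_gap_le huv t 0
      _ = C * t * (2 * M * κ) := by
        rw [zero_sub, abs_neg, abs_of_nonneg ht]
        ring
      _ ≤ 1 / 4 * (2 * C * κ) := by
        gcongr
        exact h.card_le
      _ = 1 / 2 * (C * κ) := by ring
  linarith [norm_sub_trajectory_le h.isControlField_rev (by linarith) hu hx hx1 hv hy hy1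
    (left_mem_Icc.2 ht) (right_mem_Icc.2 ht)]

/-- A trajectory `x` with the control `u`, and trajectories `y α` which end at `b` and have the
controls `tilt β u α`, for `α` between `-a` and `a`. -/
structure IsTiltFamily (F : Plane → Plane) (G : Fin M → Plane → Plane) (β : Fin M → ℝ) (t a : ℝ)
    (u : ℝ → Fin M → ℝ) (x : ℝ → Plane) (b : Plane) (y : ℝ → ℝ → Plane) : Prop where
  nonneg : 0 ≤ a
  le_one : a ≤ 1
  isControl : IsControl u
  isTrajectory : IsTrajectory (revDynamics F G) u 0 t x
  isTrajectory_tilt : ∀ α ∈ Icc (-a) a,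
    IsTrajectory (revDynamics F G) (tilt β u α) (y α 0) t (y α)
  apply_eq : ∀ α ∈ Icc (-a) a, y α t = b
  norm_le_one : ∀ α ∈ Icc (-a) a, ∀ r ∈ Icc 0 t, ‖y α r‖ ≤ 1

theorem IsParallel.exists_isTiltFamily (hp : IsParallel A B e β ν c) (h : SystemBounds F G A B C)
    (ht : IsSmallTime C c t) (ha : 0 ≤ a) (ha1 : a ≤ 1) (hu : IsControl u)
    (hx : IsTrajectory (revDynamics F G) u 0 t x) (hb : ‖b - x t‖ ≤ 1 / 4) :
    ∃ y, IsTiltFamily F G β t a u x b y := by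
  have hCt := ht.mul_le
  have hbC : ‖b‖ + C * t < 1 := by
    have hxt := hx.norm_le h.isControlField_rev hu ht.norm_zero_add_lt (right_mem_Icc.2 ht.nonneg)
    rw [norm_zero, zero_add] at hxt
    linarith [norm_sub_norm_le b (x t)]
  have hex : ∀ α ∈ Icc (-a) a, ∃ y : ℝ → Plane,
      IsTrajectory (revDynamics F G) (tilt β u α) (y 0) t y ∧ y t = b ∧
        ∀ r ∈ Icc 0 t, ‖y r‖ ≤ 1 := fun α hα =>
    h.exists_trajectory_to (hp.isControl_tilt hu ((abs_le.2 hα).trans ha1)) ht.nonneg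
      (by linarith) hbC
  choose! y hy hyb hy1 using hex
  exact ⟨y, ha, ha1, hu, hx, hy, hyb, hy1⟩

namespace IsTiltFamily

variable {y : ℝ → ℝ → Plane} {α α' : ℝ}

theorem isControl_tilt (hy : IsTiltFamily F G β t a u x b y) (hp : IsParallel A B e β ν c)
    (hα : α ∈ Icc (-a) a) : IsControl (tilt β u α) :=
  hp.isControl_tilt hy.isControl ((abs_le.2 hα).trans hy.le_one)

theorem norm_sub_le (hy : IsTiltFamily F G β t a u x b y) (hp : IsParallel A B e β ν c)
    (h : SystemBounds F G A B C) (ht : IsSmallTime C c t) (hα : α ∈ Icc (-a) a)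
    (hα' : α' ∈ Icc (-a) a) : ‖y α 0 - y α' 0‖ ≤ C * |α - α'| := by
  have := h.norm_sub_zero_le ht.nonneg ht.mul_le (hy.isControl_tilt hp hα)
    (hy.isControl_tilt hp hα') (hy.isTrajectory_tilt α hα) (hy.norm_le_one α hα)
    (hy.isTrajectory_tilt α' hα') (hy.norm_le_one α' hα') (abs_nonneg _)
    (hp.gap_tilt_tilt_le hy.isControl α α')
  rwa [hy.apply_eq α hα, hy.apply_eq α' hα', sub_self, norm_zero, mul_zero, zero_add] at this

theorem continuousOn (hy : IsTiltFamily F G β t a u x b y) (hp : IsParallel A B e β ν c)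
    (h : SystemBounds F G A B C) (ht : IsSmallTime C c t) :
    ContinuousOn (fun α => y α 0) (Icc (-a) a) := by
  have hC : 0 ≤ C := zero_le_one.trans h.one_le
  refine (LipschitzOnWith.of_dist_le_mul (K := C.toNNReal) fun α hα α' hα' => ?_).continuousOn
  rw [Real.coe_toNNReal _ hC, dist_eq_norm, Real.dist_eq]
  exact hy.norm_sub_le hp h ht hα hα'

theorem norm_zero_le (hy : IsTiltFamily F G β t a u x b y) (hp : IsParallel A B e β ν c)
    (h : SystemBounds F G A B C) (ht : IsSmallTime C c t) (hα : α ∈ Icc (-a) a) :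
    ‖y α 0‖ ≤ 2 * C * (‖b - x t‖ + a) := by
  have hC := h.one_le
  have hf := h.isControlField_rev
  have hx0 := hy.isTrajectory.apply_zero ht.nonneg
  have hgap := hp.gap_tilt_tilt_le hy.isControl α 0
  rw [tilt_zero, sub_zero] at hgap
  have hdist := h.norm_sub_zero_le ht.nonneg ht.mul_le (hy.isControl_tilt hp hα) hy.isControl
    (hy.isTrajectory_tilt α hα) (hy.norm_le_one α hα) (hx0.symm ▸ hy.isTrajectory)
    (fun r hr => (hy.isTrajectory.norm_lt_one hf hy.isControl ht.norm_zero_add_lt hr).le)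
    (abs_nonneg α) hgap
  rw [hx0, sub_zero, hy.apply_eq α hα] at hdist
  calc ‖y α 0‖ ≤ 2 * ‖b - x t‖ + C * |α| := hdist
    _ ≤ 2 * (C * ‖b - x t‖) + 2 * (C * a) := by
      have hαa : C * |α| ≤ C * a := by
        gcongr
        exact abs_le.2 hα
      have := mul_nonneg (zero_le_one.trans hC) hy.nonneg
      linarith [le_mul_of_one_le_left (norm_nonneg (b - x t)) hC]
    _ = 2 * C * (‖b - x t‖ + a) := by ring

theorem isTilted (hy : IsTiltFamily F G β t a u x b y)
    (hsmall : 4 * C ^ 2 * (‖b - x t‖ + a) ≤ 1 / 2) : IsTilted F G β C t a u x (y a) :=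
  have hmem := right_mem_Icc.2 (neg_le_self hy.nonneg)
  ⟨hy.nonneg, hy.le_one, hy.isControl, hy.isTrajectory, hy.isTrajectory_tilt a hmem,
    hy.norm_le_one a hmem, by rwa [hy.apply_eq a hmem]⟩

theorem isTilted_neg (hy : IsTiltFamily F G β t a u x b y)
    (hsmall : 4 * C ^ 2 * (‖b - x t‖ + a) ≤ 1 / 2) : IsTilted F G (-β) C t a u x (y (-a)) :=
  have hmem := left_mem_Icc.2 (neg_le_self hy.nonneg)
  ⟨hy.nonneg, hy.le_one, hy.isControl, hy.isTrajectory,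
    tilt_neg β u a ▸ hy.isTrajectory_tilt (-a) hmem, hy.norm_le_one (-a) hmem,
    by rwa [hy.apply_eq (-a) hmem]⟩

/-- The initial points of the extreme tilted trajectories lie on different sides of the extremals,
so that the path of all the initial points meets the extremals. -/
theorem exists_eq_joinCurves (hy : IsTiltFamily F G β t a u x b y)
    (hX : IsExtremal F G β T X) (hY : IsExtremal F G (-β) T Y) (hp : IsParallel A B e β ν c)
    (h : SystemBounds F G A B C) (hT : IsSmallTime C c T) (ht : t ∈ Icc 0 T)
    (hsmall : 4 * C ^ 2 * (‖b - x t‖ + a) ≤ 1 / 2) {b₀ : ℝ}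
    (hb₀ : 4 * C * (‖b - x t‖ + a) = c * b₀) (hb₀T : b₀ ∈ Icc 0 T) {m : ℝ}
    (hm : m ≤ moment u (fun _ => signs β) t) (hm' : m ≤ moment u (fun _ => signs (-β)) t)
    (hgain : C ^ 2 * b₀ ^ 2 + 192 * C ^ 7 * (‖b - x t‖ + a) ^ 2 + 12 * C ^ 4 * ‖b - x t‖ ≤
      c ^ 2 / 2 * (a * m)) :
    ∃ α ∈ Icc (-a) a, ∃ s ∈ Icc (-b₀) b₀, y α 0 = joinCurves X Y s := by
  have hc := hp.c_pos
  have ha := hy.nonneg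
  have hsmallt := hT.mono h.one_le ht.1 ht.2
  have hsub : Icc (-b₀) b₀ ⊆ Icc (-T) T := Icc_subset_Icc (neg_le_neg hb₀T.2) hb₀T.2
  have hδ : ((c / 4).toNNReal : ℝ) = c / 4 := Real.coe_toNNReal _ (by positivity)
  have hcs := hp.c_le_totalSize
  have hside := (hy.isTilted hsmall).le_mul_wedge hp h hsmallt
  have hside' := (hy.isTilted_neg hsmall).le_mul_wedge hp.neg h hsmallt
  rw [hy.apply_eq _ (right_mem_Icc.2 (neg_le_self ha))] at hside
  rw [hy.apply_eq _ (left_mem_Icc.2 (neg_le_self ha)), map_neg, neg_apply, mul_neg] at hside'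
  have hmom : c ^ 2 / 2 * (a * m) ≤ c ^ 2 / 2 * (a * moment u (fun _ => signs β) t) := by gcongr
  have hmom' : c ^ 2 / 2 * (a * m) ≤ c ^ 2 / 2 * (a * moment u (fun _ => signs (-β)) t) := by
    gcongr
  refine exists_crossing_of_lipschitzOnWith (k := totalSize β) (D := C ^ 2 * b₀ ^ 2) hp.norm_e
    hp.abs_ν (by rw [hδ]; linarith) hb₀T.1 ha
    ((hX.lipschitzOnWith_joinCurves_add_smul hY hp h hT).mono hsub)
    (by rw [joinCurves_of_nonneg X Y le_rfl, hX.isTrajectory.apply_zero hT.nonneg])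
    (fun s hs => ?_) (hy.continuousOn hp h hsmallt) (fun α hα => ?_) (by linarith) (by linarith)
  · refine (hX.abs_wedge_joinCurves_le hY hp h hT (hsub hs)).trans ?_
    gcongr ?_ * ?_
    exact sq_le_sq.2 ((abs_le.2 hs).trans (le_abs_self b₀))
  · calc |inner ℝ e (y α 0)| ≤ ‖y α 0‖ := by
          simpa only [hp.norm_e, one_mul] using abs_real_inner_le_norm e (y α 0)
      _ ≤ 2 * C * (‖b - x t‖ + a) := hy.norm_zero_le hp h hsmallt hα
      _ = c / 2 * b₀ := by linarith
      _ ≤ (totalSize β - (c / 4).toNNReal) * b₀ := by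
        rw [hδ]
        exact mul_le_mul_of_nonneg_right (by linarith) hb₀T.1

theorem exists_steers_le (hy : IsTiltFamily F G β t a u x b y)
    (hX : IsExtremal F G β T X) (hY : IsExtremal F G (-β) T Y) (hp : IsParallel A B e β ν c)
    (h : SystemBounds F G A B C) (ht : 0 ≤ t) {b₀ : ℝ} (hb₀T : b₀ ≤ T)
    (hcross : ∃ α ∈ Icc (-a) a, ∃ s ∈ Icc (-b₀) b₀, y α 0 = joinCurves X Y s) :
    ∃ s ≤ t + b₀, Steers F G b s := by
  obtain ⟨α, hα, s, hs, heq⟩ := hcross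
  have hsteer := hX.steers_joinCurves hY hp h (Icc_subset_Icc (neg_le_neg hb₀T) hb₀T hs)
  have := steers_of_rev h (hy.isControl_tilt hp hα) ht (hy.isTrajectory_tilt α hα) (heq ▸ hsteer)
  rw [hy.apply_eq α hα] at this
  exact ⟨_, add_le_add_right (abs_le.2 hs) t, this⟩

end IsTiltFamily

theorem quadratic_error_le {k d b₀ : ℝ} (hC : 1 ≤ C) (hc : 0 < c) (hc1 : c ≤ 1) (hd : 0 ≤ d)
    (hb₀ : c * b₀ = 4 * C * (k * d)) (hkd : 256 * C ^ 7 * k ^ 2 * d ≤ c ^ 2) :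
    C ^ 2 * b₀ ^ 2 + 192 * C ^ 7 * (k * d) ^ 2 ≤ d := by
  refine le_of_mul_le_mul_left ?_ (pow_pos hc 2)
  calc c ^ 2 * (C ^ 2 * b₀ ^ 2 + 192 * C ^ 7 * (k * d) ^ 2) =
        C ^ 2 * (c * b₀) ^ 2 + c ^ 2 * (192 * C ^ 7 * (k * d) ^ 2) := by ring
    _ = 16 * (C ^ 4 * (k * d) ^ 2) + c ^ 2 * (192 * C ^ 7 * (k * d) ^ 2) := by
      rw [hb₀]
      ring
    _ ≤ 16 * (4 * (C ^ 7 * (k * d) ^ 2)) + 1 * (192 * C ^ 7 * (k * d) ^ 2) := by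
      have hpow : C ^ 4 * (k * d) ^ 2 ≤ C ^ 7 * (k * d) ^ 2 := by
        gcongr
        norm_num
      have : 0 ≤ C ^ 7 * (k * d) ^ 2 := by positivity
      refine add_le_add (by linarith) (mul_le_mul_of_nonneg_right ?_ (by positivity))
      exact pow_le_one₀ hc.le hc1
    _ = 256 * C ^ 7 * k ^ 2 * d * d := by ring
    _ ≤ c ^ 2 * d := by gcongr

theorem IsParallel.exists_forall_steers (hp : IsParallel A B e β ν c)
    (h : SystemBounds F G A B C) (hT : IsSmallTime C c T) (hT0 : 0 < T) {m : ℝ} (hm : 0 < m) :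
    ∃ ρ > 0, ∃ K : ℝ, 0 ≤ K ∧ ∀ t ∈ Icc 0 T, ∀ u : ℝ → Fin M → ℝ, IsControl u →
      ∀ x : ℝ → Plane, IsTrajectory (revDynamics F G) u 0 t x →
      m ≤ moment u (fun _ => signs β) t → m ≤ moment u (fun _ => signs (-β)) t →
      ∀ b, ‖b - x t‖ ≤ ρ → ∃ s ≤ t + K * ‖b - x t‖, Steers F G b s := by
  have hC := h.one_le
  have hc := hp.c_pos
  obtain ⟨X, hX⟩ := hp.exists_isExtremal h hT
  obtain ⟨Y, hY⟩ := hp.neg.exists_isExtremal h hT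
  -- `K₀` balances the gain `c² / 2 * (K₀ * d * m)` of the tilt `K₀ * d` with its linear error.
  set K₀ := 2 * (12 * C ^ 4 + 1) / (c ^ 2 * m)
  have hK₀ : 0 < K₀ := by positivity
  set k := 1 + K₀
  have hk : 0 < k := by positivity
  refine ⟨min (1 / (8 * C ^ 2 * k)) (min (c * T / (4 * C * k)) (c ^ 2 / (256 * C ^ 7 * k ^ 2))),
    by positivity, 4 * C * k / c, by positivity, fun t ht u hu x hx hmβ hmβ' b hb => ?_⟩
  obtain ⟨hb₁, hb₂, hb₃⟩ : ‖b - x t‖ ≤ _ ∧ ‖b - x t‖ ≤ _ ∧ ‖b - x t‖ ≤ _ := by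
    simpa only [le_min_iff] using hb
  rw [le_div_iff₀' (by positivity)] at hb₁ hb₂ hb₃
  have hsum : ‖b - x t‖ + K₀ * ‖b - x t‖ = k * ‖b - x t‖ := by ring
  have hkd : k * ‖b - x t‖ ≤ 1 / 8 := by
    have : k * ‖b - x t‖ ≤ C ^ 2 * (k * ‖b - x t‖) :=
      le_mul_of_one_le_left (by positivity) (one_le_pow₀ hC)
    linarith
  have hd := norm_nonneg (b - x t)
  have hK₀d : 0 ≤ K₀ * ‖b - x t‖ := mul_nonneg hK₀.le hd
  have hb₀T : 4 * C * k / c * ‖b - x t‖ ≤ T := by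
    rwa [div_mul_eq_mul_div, div_le_iff₀' hc]
  have hb₀ : c * (4 * C * k / c * ‖b - x t‖) = 4 * C * (k * ‖b - x t‖) := by field_simp
  obtain ⟨y, hy⟩ := hp.exists_isTiltFamily (a := K₀ * ‖b - x t‖) (b := b) h
    (hT.mono hC ht.1 ht.2) hK₀d (by linarith) hu hx (by linarith)
  refine hy.exists_steers_le hX hY hp h ht.1 hb₀T
    (hy.exists_eq_joinCurves hX hY hp h hT ht (by linarith) (by rw [hsum, hb₀])
      ⟨by positivity, hb₀T⟩ hmβ hmβ' ?_)
  have hgain : c ^ 2 / 2 * (K₀ * ‖b - x t‖ * m) = (12 * C ^ 4 + 1) * ‖b - x t‖ := by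
    simp only [K₀]
    field_simp
  rw [hgain, hsum]
  linarith [quadratic_error_le hC hc hp.c_le_one hd hb₀ hb₃]

end TiltFamily

/-! ### Lipschitz points of the minimum time -/

section Lipschitz

variable {M : ℕ} {F : Plane → Plane} {G : Fin M → Plane → Plane} {A : Plane →L[ℝ] Plane}
  {B : Fin M → Plane} {C : ℝ} {e : Plane} {β : Fin M → ℝ} {ν c T τ : ℝ} {X Y : ℝ → Plane}
  {x : Plane}

namespace IsParallel

theorem exists_forall_steers_of_le_norm_sub (hp : IsParallel A B e β ν c)
    (h : SystemBounds F G A B C) (hT : IsSmallTime C c T) (hT0 : 0 < T)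
    (hX : IsExtremal F G β T X) (hY : IsExtremal F G (-β) T Y) {ε : ℝ} (hε : 0 < ε) :
    ∃ ρ > 0, ∃ K : ℝ, 0 ≤ K ∧ ∀ t ≤ T, ∀ a, Steers F G a t →
      ε ≤ ‖a - X t‖ → ε ≤ ‖a - Y t‖ → ∀ b, ‖b - a‖ ≤ ρ →
        ∃ s ≤ t + K * ‖b - a‖, Steers F G b s := by
  have hC := h.one_le
  obtain ⟨ρ, hρ, K, hK, hsteer⟩ := hp.exists_forall_steers h hT hT0
    (m := ε ^ 2 / (32 * C ^ 3)) (by positivity)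
  refine ⟨ρ, hρ, K, hK, fun t ht a ha haX haY b hb => ?_⟩
  obtain ⟨u, hu, y, hy, rfl⟩ := ha.exists_rev h
  have hmoment : ∀ {v : ℝ → Fin M → ℝ} {z : ℝ → Plane}, IsControl v →
      IsTrajectory (revDynamics F G) v 0 t z → ε ≤ ‖y t - z t‖ →
        ε ^ 2 / (32 * C ^ 3) ≤ moment u v t := by
    intro v z hv hz hyz
    rw [div_le_iff₀' (by positivity)]
    calc ε ^ 2 ≤ ‖y t - z t‖ ^ 2 := by gcongr
      _ ≤ 32 * C ^ 3 * moment u v t :=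
        h.norm_sub_sq_le_moment ha.1 (hT.mono hC ha.1 ht).mul_le hu hv hy hz
  exact hsteer t ⟨ha.1, ht⟩ u hu y hy (hmoment hp.isControl (hX.mono ht).isTrajectory haX)
    (hmoment hp.neg.isControl (hY.mono ht).isTrajectory haY) b hb

theorem steerStable (hp : IsParallel A B e β ν c) (h : SystemBounds F G A B C)
    (hT : IsSmallTime C c T) (hT0 : 0 < T) (hX : IsExtremal F G β T X)
    (hY : IsExtremal F G (-β) T Y) (hx : x ∉ X '' Icc 0 T ∪ Y '' Icc 0 T) :
    SteerStable F G T x := by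
  have hclosed : IsClosed (X '' Icc 0 T ∪ Y '' Icc 0 T) :=
    ((isCompact_Icc.image hX.continuous).union (isCompact_Icc.image hY.continuous)).isClosed
  obtain ⟨ε, hε, hball⟩ := Metric.isOpen_iff.1 hclosed.isOpen_compl x hx
  obtain ⟨ρ, hρ, K, hK, hsteer⟩ :=
    hp.exists_forall_steers_of_le_norm_sub h hT hT0 hX hY (half_pos hε)
  refine ⟨min (ε / 2) (ρ / 2), by positivity, K, hK, fun a b ha hb t ht hs => ?_⟩
  rw [lt_min_iff] at ha hb
  have hfar : ∀ z ∈ X '' Icc 0 T ∪ Y '' Icc 0 T, ε / 2 ≤ ‖a - z‖ := by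
    intro z hz
    have hεz : ε ≤ ‖x - z‖ := by
      by_contra! hlt
      exact hball (by rwa [Metric.mem_ball', dist_eq_norm]) hz
    linarith [norm_sub_le_norm_sub_add_norm_sub x a z, norm_sub_rev x a]
  refine hsteer t ht a hs (hfar _ (Or.inl ⟨t, ⟨hs.1, ht⟩, rfl⟩))
    (hfar _ (Or.inr ⟨t, ⟨hs.1, ht⟩, rfl⟩)) b ?_
  linarith [norm_sub_le_norm_sub_add_norm_sub b x a, norm_sub_rev x a]

/-- Points of the two extremals are covered as well: waiting at the origin turns the optimal
control of `x` into a control on `[0, T]` which is far from the constant ones. -/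
theorem exists_forall_minTime_ne_top (hp : IsParallel A B e β ν c) (h : SystemBounds F G A B C)
    (hT : IsSmallTime C c T) (hτT : τ < T) (hx : Steers F G x τ) :
    ∃ ρ > 0, ∀ b, ‖b - x‖ < ρ → minTime F G b ≠ ⊤ := by
  have hT0 : 0 < T := hx.1.trans_lt hτT
  obtain ⟨X, hX⟩ := hp.exists_isExtremal h hT
  obtain ⟨Y, hY⟩ := hp.neg.exists_isExtremal h hT
  have hpos : ∀ z, minTime F G z = ENNReal.ofReal T → 0 < ‖x - z‖ := by
    intro z hz
    rw [norm_sub_pos_iff]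
    rintro rfl
    have hTτ := hx.minTime_le
    rw [hz, ENNReal.ofReal_le_ofReal_iff hx.1] at hTτ
    exact hτT.not_ge hTτ
  obtain ⟨ρ, hρ, K, -, hsteer⟩ := hp.exists_forall_steers_of_le_norm_sub h hT hT0 hX hY
    (lt_min (hpos _ (hX.minTime_eq hp h hT)) (hpos _ (hY.minTime_eq hp.neg h hT)))
  refine ⟨ρ, hρ, fun b hb => ?_⟩
  obtain ⟨s, -, hs⟩ := hsteer T le_rfl x (hx.mono h hτT.le) (min_le_left _ _) (min_le_right _ _)
    b hb.le
  exact hs.minTime_ne_top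

theorem lipschitzNear (hp : IsParallel A B e β ν c) (h : SystemBounds F G A B C)
    (hT : IsSmallTime C c T) (hX : IsExtremal F G β T X) (hY : IsExtremal F G (-β) T Y)
    (hτT : τ < T) (hx : Steers F G x τ) (hxΓ : x ∉ X '' Icc 0 τ ∪ Y '' Icc 0 τ) :
    LipschitzNear (minTime F G) x := by
  have hmem : ∀ Z : ℝ → Plane, (∀ t ∈ Icc 0 T, minTime F G (Z t) = ENNReal.ofReal t) →
      x ∈ Z '' Icc 0 T → x ∈ Z '' Icc 0 τ := by
    rintro Z hZ ⟨t, ht, rfl⟩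
    have htτ := hx.minTime_le
    rw [hZ t ht, ENNReal.ofReal_le_ofReal_iff hx.1] at htτ
    exact ⟨t, ⟨ht.1, htτ⟩, rfl⟩
  have htime := fun t (ht : t ∈ Icc 0 T) => hT.mono h.one_le ht.1 ht.2
  refine (hp.steerStable h hT (hx.1.trans_lt hτT) hX hY fun hxT => hxΓ ?_).lipschitzNear hτT hx
  exact hxT.imp (hmem X fun t ht => (hX.mono ht.2).minTime_eq hp h (htime t ht))
    (hmem Y fun t ht => (hY.mono ht.2).minTime_eq hp.neg h (htime t ht))

theorem not_lipschitzNear (hp : IsParallel A B e β ν c) (h : SystemBounds F G A B C)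
    (hT : IsSmallTime C c T) (hτT : τ < T) (hx : x ∈ singularSet F G τ) :
    ¬LipschitzNear (minTime F G) x := by
  have hs := (mem_reachable_iff h).1 hx.1
  obtain ⟨ρ, hρ, hfin⟩ := hp.exists_forall_minTime_ne_top h hT hτT hs
  have hCτ := (hT.mono h.one_le hs.1 hτT.le).mul_le
  exact not_lipschitzNear_of_mem_singularSet h (by linarith) hx hρ hfin

theorem singularSet_eq (hp : IsParallel A B e β ν c) (h : SystemBounds F G A B C)
    (hT : IsSmallTime C c T) (hX : IsExtremal F G β T X) (hY : IsExtremal F G (-β) T Y)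
    (hτT : τ < T) : singularSet F G τ = X '' Icc 0 τ ∪ Y '' Icc 0 τ := by
  refine Subset.antisymm (fun x hx => ?_) ?_
  · by_contra hxΓ
    exact hp.not_lipschitzNear h hT hτT hx
      (hp.lipschitzNear h hT hX hY hτT ((mem_reachable_iff h).1 hx.1) hxΓ)
  · rintro x (⟨t, ht, rfl⟩ | ⟨t, ht, rfl⟩) <;> have htT := ht.2.trans hτT.le
    · exact (hX.mono htT).mem_singularSet hp h (hT.mono h.one_le ht.1 htT) ht.2
    · exact (hY.mono htT).mem_singularSet hp.neg h (hT.mono h.one_le ht.1 htT) ht.2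

theorem singularSet_eq_nonLipschitz (hp : IsParallel A B e β ν c) (h : SystemBounds F G A B C)
    (hT : IsSmallTime C c T) (hτT : τ < T) :
    singularSet F G τ = {x | x ∈ reachable F G τ ∧ NonLipschitzAt (minTime F G) x} := by
  obtain ⟨X, hX⟩ := hp.exists_isExtremal h hT
  obtain ⟨Y, hY⟩ := hp.neg.exists_isExtremal h hT
  ext x
  rw [mem_ofPred_eq, nonLipschitzAt_iff]
  refine ⟨fun hx => ⟨hx.1, hp.not_lipschitzNear h hT hτT hx⟩, fun ⟨hx, hnl⟩ => ?_⟩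
  rw [hp.singularSet_eq h hT hX hY hτT]
  by_contra hxΓ
  exact hnl (hp.lipschitzNear h hT hX hY hτT ((mem_reachable_iff h).1 hx) hxΓ)

end IsParallel

end Lipschitz

section Independent

variable {M : ℕ} {F : Plane → Plane} {G : Fin M → Plane → Plane} {A : Plane →L[ℝ] Plane}
  {B : Fin M → Plane} {C T : ℝ} {i j : Fin M}

theorem wedge_div_smul_add_wedge_div_smul {g k : Plane} (hgk : wedge g k ≠ 0) (v : Plane) :
    (wedge v k / wedge g k) • g + (wedge g v / wedge g k) • k = v := by
  ext l
  simp only [PiLp.add_apply, PiLp.smul_apply, smul_eq_mul, div_mul_eq_mul_div, ← add_div]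
  rw [div_eq_iff hgk]
  fin_cases l <;> simp only [wedge_apply, Fin.zero_eta, Fin.mk_one] <;> ring

theorem abs_single_add_single_le (hij : i ≠ j) {a b r : ℝ} (ha : |a| ≤ r) (hb : |b| ≤ r)
    (l : Fin M) : |(Pi.single i a + Pi.single j b : Fin M → ℝ) l| ≤ r := by
  rcases eq_or_ne l i with rfl | hli
  · simpa [hij] using ha
  · rcases eq_or_ne l j with rfl | hlj
    · simpa [hli] using hb
    · simpa [hli, hlj] using (abs_nonneg a).trans ha

/-- The feedback control along `y` with velocity `w` is found by Cramer's rule. -/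
theorem exists_isControl_dynamics_eq (hij : i ≠ j) (hF : Continuous F)
    (hG : ∀ l, Continuous (G l)) {y : ℝ → Plane} (hy : Continuous y) {δ : ℝ} (hδ : 0 < δ)
    (hδG : ∀ s, δ ≤ |wedge (G i (y s)) (G j (y s))|) (hGC : ∀ l s, ‖G l (y s)‖ ≤ C) {w : Plane}
    (hw : ∀ s, ‖w - F (y s)‖ * C ≤ δ) :
    ∃ u : ℝ → Fin M → ℝ, IsControl u ∧ ∀ s, dynamics F G (y s) (u s) = w := by
  have hD : ∀ s, wedge (G i (y s)) (G j (y s)) ≠ 0 := fun s => abs_pos.1 (hδ.trans_le (hδG s))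
  set a : ℝ → ℝ := fun s =>
    wedge (w - F (y s)) (G j (y s)) / wedge (G i (y s)) (G j (y s))
  set b : ℝ → ℝ := fun s =>
    wedge (G i (y s)) (w - F (y s)) / wedge (G i (y s)) (G j (y s))
  have ha : Continuous a := by fun_prop (disch := exact hD)
  have hb : Continuous b := by fun_prop (disch := exact hD)
  have hquot : ∀ s q, |q| ≤ ‖w - F (y s)‖ * C → |q / wedge (G i (y s)) (G j (y s))| ≤ 1 := by
    intro s q hq
    rw [abs_div, div_le_one (abs_pos.2 (hD s))]
    exact hq.trans ((hw s).trans (hδG s))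
  have ha1 : ∀ s, |a s| ≤ 1 := fun s => hquot s _
    ((abs_wedge_le _ _).trans (mul_le_mul_of_nonneg_left (hGC j s) (norm_nonneg _)))
  have hb1 : ∀ s, |b s| ≤ 1 := fun s => hquot s _ ((abs_wedge_le _ _).trans
    (by rw [mul_comm]; exact mul_le_mul_of_nonneg_left (hGC i s) (norm_nonneg _)))
  refine ⟨fun s => Pi.single i (a s) + Pi.single j (b s), ⟨?_, ?_⟩, fun s => ?_⟩
  · refine measurable_pi_iff.2 fun l => Continuous.measurable ?_
    simp only [Pi.add_apply, Pi.single_apply]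
    split_ifs <;> fun_prop
  · exact Eventually.of_forall fun s =>
      mem_cube_of_abs_le_one (abs_single_add_single_le hij (ha1 s) (hb1 s))
  · have hsum : ∑ l, (Pi.single i (a s) + Pi.single j (b s) : Fin M → ℝ) l • G l (y s) =
        a s • G i (y s) + b s • G j (y s) := by
      simp [add_smul, Finset.sum_add_distrib, Pi.single_apply, ite_smul]
    rw [dynamics, hsum, wedge_div_smul_add_wedge_div_smul (hD s), add_sub_cancel]

theorem SystemBounds.norm_F_le (h : SystemBounds F G A B C) {x : Plane} (hx : ‖x‖ ≤ 1) :
    ‖F x‖ ≤ 2 * C * ‖x‖ := by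
  have hsub := h.F_sub 1 le_rfl x 0 hx (by simp)
  rw [h.F_zero, sub_zero, sub_zero, mul_one] at hsub
  linarith [norm_sub_norm_le (F x) (A x), A.le_of_opNorm_le h.norm_A x]

theorem exists_continuous_eq_smul {t : ℝ} (ht : 0 < t) (p : Plane) :
    ∃ y : ℝ → Plane, Continuous y ∧ (∀ s, ‖y s‖ ≤ ‖p‖) ∧
      ∀ s ∈ Icc 0 t, y s = (1 - s / t) • p := by
  refine ⟨fun s => (1 - (projIcc (0 : ℝ) 1 zero_le_one (s / t) : ℝ)) • p, ?_, fun s => ?_,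
    fun s hs => ?_⟩
  · have : Continuous fun s : ℝ => (projIcc (0 : ℝ) 1 zero_le_one (s / t) : ℝ) :=
      continuous_subtype_val.comp (continuous_projIcc.comp (continuous_id.div_const t))
    fun_prop
  · have hproj := (projIcc (0 : ℝ) 1 zero_le_one (s / t)).2
    rw [norm_smul, Real.norm_eq_abs, abs_of_nonneg (sub_nonneg.2 hproj.2)]
    exact mul_le_of_le_one_left (norm_nonneg _) (sub_le_self _ hproj.1)
  · have : s / t ∈ Icc (0 : ℝ) 1 := ⟨div_nonneg hs.1 ht.le, (div_le_one ht).2 hs.2⟩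
    simp only [projIcc_of_mem zero_le_one this]

/-- The points are steered along segments with constant velocity. -/
theorem SystemBounds.steers_of_le_abs_wedge (h : SystemBounds F G A B C) (hij : i ≠ j) {δ : ℝ}
    (hδ : 0 < δ) {p : Plane} (hp : ‖p‖ ≤ 1) (hpδ : 4 * C ^ 2 * ‖p‖ ≤ δ)
    (hδG : ∀ z, ‖z‖ ≤ ‖p‖ → δ ≤ |wedge (G i z) (G j z)|) :
    Steers F G p (2 * C / δ * ‖p‖) := by
  have hC := h.one_le
  rcases eq_or_ne p 0 with rfl | hp0
  · simpa using steers_of_rev_zero h isControl_zero le_rfl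
      (isTrajectory_zero (by simp [revDynamics, dynamics, h.F_zero]) 0)
  set t := 2 * C / δ * ‖p‖
  have ht : 0 < t := mul_pos (by positivity) (norm_pos_iff.2 hp0)
  obtain ⟨y, hyc, hyp, hy_eq⟩ := exists_continuous_eq_smul ht p
  have hspeed : ∀ s, ‖-(t⁻¹ • p) - F (y s)‖ * C ≤ δ := by
    intro s
    have hp_speed : ‖-(t⁻¹ • p)‖ * C = δ / 2 := by
      rw [norm_neg, norm_smul, Real.norm_eq_abs, abs_of_pos (inv_pos.2 ht)]
      have := norm_pos_iff.2 hp0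
      simp only [t]
      field_simp
    have hF_speed : ‖F (y s)‖ * C ≤ δ / 2 :=
      calc ‖F (y s)‖ * C ≤ 2 * C * ‖p‖ * C := by
            gcongr
            exact (h.norm_F_le ((hyp s).trans hp)).trans (by gcongr; exact hyp s)
        _ ≤ δ / 2 := by linarith
    calc ‖-(t⁻¹ • p) - F (y s)‖ * C ≤ (‖-(t⁻¹ • p)‖ + ‖F (y s)‖) * C := by
          gcongr
          exact norm_sub_le _ _
      _ ≤ δ := by linarith
  obtain ⟨u, hu, hdyn⟩ := exists_isControl_dynamics_eq hij h.F_contDiff.continuous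
    (fun l => (h.G_contDiff l).continuous) hyc hδ (fun s => hδG _ (hyp s))
    (fun l s => h.norm_G l _ ((hyp s).trans hp)) hspeed
  refine ⟨ht.le, u, hu, y, ⟨hyc.continuousOn, fun r hr => ?_⟩, ?_⟩
  · simp only [hdyn]
    rw [intervalIntegral.integral_const, hy_eq r hr]
    module
  · rw [hy_eq t ⟨ht.le, le_rfl⟩, div_self ht.ne', sub_self, zero_smul]

theorem SystemBounds.exists_forall_steers (h : SystemBounds F G A B C)
    (hB : wedge (B i) (B j) ≠ 0) :
    ∃ ρ > 0, ∃ K : ℝ, 0 ≤ K ∧ ∀ p, ‖p‖ < ρ → Steers F G p (K * ‖p‖) := by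
  have hC := h.one_le
  have hij : i ≠ j := by
    rintro rfl
    exact hB (wedge_self _)
  set δ := |wedge (B i) (B j)| / 2
  have hδ : 0 < δ := by positivity
  have hev : ∀ᶠ z in 𝓝 (0 : Plane), δ < |wedge (G i z) (G j z)| := by
    have hGc := fun l => (h.G_contDiff l).continuous
    refine Continuous.continuousAt (by fun_prop) |>.eventually_const_lt ?_
    simpa only [h.G_zero] using half_lt_self (abs_pos.2 hB)
  obtain ⟨r, hr, hball⟩ := Metric.eventually_nhds_iff_ball.1 hev
  refine ⟨min (min r 1) (δ / (4 * C ^ 2)), by positivity, 2 * C / δ, by positivity,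
    fun p hp => ?_⟩
  simp only [lt_min_iff, lt_div_iff₀' (by positivity : 0 < 4 * C ^ 2)] at hp
  obtain ⟨⟨hpr, hp1⟩, hpδ⟩ := hp
  exact h.steers_of_le_abs_wedge hij hδ hp1.le hpδ.le fun z hz =>
    (hball z (by simpa using hz.trans_lt hpr)).le

theorem SystemBounds.steerStable (h : SystemBounds F G A B C) (hB : wedge (B i) (B j) ≠ 0)
    (hT : C * T ≤ 1 / 4) {x : Plane} (hx : ‖x‖ ≤ 1 / 4) : SteerStable F G T x := by
  have hC := h.one_le
  obtain ⟨ρ, hρ, K, hK, hsteer⟩ := h.exists_forall_steers hB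
  refine ⟨min (1 / 4) (ρ / 4), by positivity, K * 2, by positivity, fun a b ha hb t ht hs => ?_⟩
  rw [lt_min_iff] at ha hb
  obtain ⟨u, hu, y, hy, rfl⟩ := hs.exists_rev h
  have hCt : C * t ≤ 1 / 4 := le_trans (by gcongr) hT
  obtain ⟨z, hz, rfl, hz1⟩ := h.exists_trajectory_to (b := b) hu hs.1 (by linarith)
    (by linarith [norm_sub_norm_le b x])
  have hz0 : ‖z 0‖ ≤ 2 * ‖z t - y t‖ := by
    have hy0 := hy.apply_zero hs.1
    have := h.norm_sub_zero_le hs.1 hCt hu hu hz hz1 (by rwa [hy0])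
      (fun r hr => (hy.norm_lt_one h.isControlField_rev hu (by rw [norm_zero]; linarith) hr).le)
      le_rfl (Eventually.of_forall fun s => by simp [gap])
    simpa [hy0] using this
  have hzy : ‖z t - y t‖ < ρ / 2 := by
    linarith [norm_sub_le_norm_sub_add_norm_sub (z t) x (y t), norm_sub_rev x (y t)]
  refine ⟨_, ?_, steers_of_rev h hu hs.1 hz (hsteer (z 0) (by linarith))⟩
  have : K * ‖z 0‖ ≤ K * (2 * ‖z t - y t‖) := by gcongr
  linarith

end Independent

/-! ### Rectifiability and the structure of the singular set -/

section Rectifiability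

theorem countablyRectifiable_empty (k : ℕ) : CountablyRectifiable k ∅ :=
  ⟨le_toOuterMeasure_caratheodory _ _ .empty, fun _ _ => 0,
    fun _ => ⟨0, LipschitzWith.const 0⟩, by simp⟩

theorem exists_lipschitzWith_image_Icc_subset_range {E : Type*} [PseudoEMetricSpace E]
    {X : ℝ → E} {a b : ℝ} (hab : a ≤ b) {K : ℝ≥0} (hX : LipschitzOnWith K X (Icc a b)) :
    ∃ f : EuclideanSpace ℝ (Fin 1) → E, (∃ K : ℝ≥0, LipschitzWith K f) ∧
      X '' Icc a b ⊆ range f := by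
  have hext : LipschitzWith (K * 1) (IccExtend hab ((Icc a b).domRestrict X)) :=
    (lipschitzOnWith_iff_restrict.1 hX).comp (LipschitzWith.projIcc hab)
  refine ⟨_, ⟨_, hext.comp
    (EuclideanSpace.proj 0 : EuclideanSpace ℝ (Fin 1) →L[ℝ] ℝ).lipschitz⟩, ?_⟩
  rintro _ ⟨t, ht, rfl⟩
  exact ⟨EuclideanSpace.single 0 t, by simp [IccExtend_of_mem hab _ ht]⟩

theorem countablyRectifiable_image_union_image {X Y : ℝ → Plane} {a b : ℝ} (hab : a ≤ b)
    {K K' : ℝ≥0} (hX : LipschitzOnWith K X (Icc a b)) (hY : LipschitzOnWith K' Y (Icc a b)) :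
    CountablyRectifiable 1 (X '' Icc a b ∪ Y '' Icc a b) := by
  obtain ⟨f, hf, hXf⟩ := exists_lipschitzWith_image_Icc_subset_range hab hX
  obtain ⟨g, hg, hYg⟩ := exists_lipschitzWith_image_Icc_subset_range hab hY
  have hclosed : IsClosed (X '' Icc a b ∪ Y '' Icc a b) :=
    ((isCompact_Icc.image_of_continuousOn hX.continuousOn).union
      (isCompact_Icc.image_of_continuousOn hY.continuousOn)).isClosed
  refine ⟨le_toOuterMeasure_caratheodory _ _ hclosed.measurableSet,
    fun n => if n = 0 then f else g, fun n => ?_, ?_⟩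
  · dsimp only
    split_ifs
    exacts [hf, hg]
  · rw [sdiff_eq_empty.2, measure_empty]
    exact union_subset (hXf.trans (subset_iUnion_of_subset 0 (by simp)))
      (hYg.trans (subset_iUnion_of_subset 1 (by simp)))

/-- The distance to `X t` maps the curve, near `X t`, onto a nontrivial interval. -/
theorem hausdorffMeasure_inter_ball_pos {α E : Type*} [TopologicalSpace α] [MetricSpace E]
    [MeasurableSpace E] [BorelSpace E] {X : α → E} {I : Set α} (hI : IsPreconnected I)
    (hX : ContinuousOn X I) {S : Set E} (hS : X '' I ⊆ S) {t t' : α} (ht : t ∈ I) (ht' : t' ∈ I)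
    (hne : X t' ≠ X t) {δ : ℝ} (hδ : 0 < δ) :
    0 < Measure.hausdorffMeasure 1 (S ∩ Metric.ball (X t) δ) := by
  have hdist : 0 < dist (X t') (X t) := dist_pos.2 hne
  have hsub : Ico 0 (min δ (dist (X t') (X t))) ⊆
      (fun z => dist z (X t)) '' (S ∩ Metric.ball (X t) δ) := by
    intro r hr
    have hcont : ContinuousOn (fun s => dist (X s) (X t)) I :=
      (continuous_id.dist continuous_const).comp_continuousOn hX
    obtain ⟨s, hs, hsr⟩ := hI.intermediate_value ht ht' hcont
      ⟨by simpa using hr.1, (hr.2.trans_le (min_le_right _ _)).le⟩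
    exact ⟨X s, ⟨hS ⟨s, hs, rfl⟩, hsr.trans_lt (hr.2.trans_le (min_le_left _ _))⟩, hsr⟩
  have himage := (LipschitzWith.dist_left (X t)).hausdorffMeasure_image_le zero_le_one
    (S ∩ Metric.ball (X t) δ)
  rw [ENNReal.coe_one, ENNReal.one_rpow, one_mul, hausdorffMeasure_real] at himage
  refine lt_of_lt_of_le ?_ ((measure_mono hsub).trans himage)
  simp [hdist, hδ]

end Rectifiability

section Conclusions

variable {M : ℕ} {F : Plane → Plane} {G : Fin M → Plane → Plane} {A : Plane →L[ℝ] Plane}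
  {B : Fin M → Plane} {C : ℝ}

namespace SystemBounds

variable {i j : Fin M} {T τ : ℝ}

theorem lipschitzNear (h : SystemBounds F G A B C) (hB : wedge (B i) (B j) ≠ 0)
    (hT : C * T ≤ 1 / 4) (hτ : τ < T) {x : Plane} (hx : Steers F G x τ) :
    LipschitzNear (minTime F G) x := by
  have hC := h.one_le
  have hCτ : C * τ ≤ 1 / 4 := le_trans (by gcongr) hT
  exact (h.steerStable hB hT ((hx.norm_le h (by linarith)).trans hCτ)).lipschitzNear hτ hx

theorem setOf_nonLipschitzAt_eq_empty (h : SystemBounds F G A B C) (hB : wedge (B i) (B j) ≠ 0)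
    (hT : C * T ≤ 1 / 4) (hτ : τ < T) :
    {x | x ∈ reachable F G τ ∧ NonLipschitzAt (minTime F G) x} = ∅ :=
  eq_empty_of_forall_notMem fun _ hx =>
    nonLipschitzAt_iff.1 hx.2 (h.lipschitzNear hB hT hτ ((mem_reachable_iff h).1 hx.1))

theorem singularSet_eq_empty (h : SystemBounds F G A B C) (hB : wedge (B i) (B j) ≠ 0)
    (hT : C * T ≤ 1 / 4) (hτ : τ < T) : singularSet F G τ = ∅ := by
  have hC := h.one_le
  have hCτ : C * τ ≤ 1 / 4 := le_trans (by gcongr) hT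
  refine eq_empty_of_forall_notMem fun x hx => ?_
  have hs := (mem_reachable_iff h).1 hx.1
  have hstable := h.steerStable hB hT ((hs.norm_le h (by linarith)).trans hCτ)
  obtain ⟨ρ, hρ, hfin⟩ := hstable.exists_forall_minTime_ne_top hτ.le hs
  exact not_lipschitzNear_of_mem_singularSet h (by linarith) hx hρ hfin
    (h.lipschitzNear hB hT hτ hs)

end SystemBounds

theorem isSmallTime_min {c : ℝ} (hC : 0 < C) (hc : 0 < c) :
    IsSmallTime C c (min (1 / (4 * C)) (c ^ 3 / (256 * C ^ 5))) where
  nonneg := by positivity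
  mul_le := by
    calc C * min (1 / (4 * C)) (c ^ 3 / (256 * C ^ 5)) ≤ C * (1 / (4 * C)) := by
          gcongr
          exact min_le_left _ _
      _ = 1 / 4 := by field_simp
  pow_mul_le := by
    rw [← le_div_iff₀' (by positivity)]
    exact min_le_right _ _

variable {e : Plane} {β : Fin M → ℝ} {ν c t : ℝ} {X : ℝ → Plane}

namespace IsExtremal

theorem lipschitzOnWith (hX : IsExtremal F G β t X) (hp : IsParallel A B e β ν c)
    (h : SystemBounds F G A B C) (ht : IsSmallTime C c t) :
    LipschitzOnWith C.toNNReal X (Icc 0 t) := by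
  refine LipschitzOnWith.of_dist_le_mul fun r hr s hs => ?_
  rw [Real.coe_toNNReal _ (zero_le_one.trans h.one_le), dist_eq_norm, Real.dist_eq]
  exact hX.isTrajectory.norm_sub_le h.isControlField_rev hp.isControl ht.norm_zero_add_lt hs hr

theorem injOn (hX : IsExtremal F G β t X) (hp : IsParallel A B e β ν c)
    (h : SystemBounds F G A B C) (ht : IsSmallTime C c t) : InjOn X (Icc 0 t) := by
  have htime : ∀ r ∈ Icc 0 t, minTime F G (X r) = ENNReal.ofReal r := fun r hr =>
    (hX.mono hr.2).minTime_eq hp h (ht.mono h.one_le hr.1 hr.2)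
  intro r hr s hs hrs
  rw [← ENNReal.ofReal_eq_ofReal_iff hr.1 hs.1, ← htime r hr, ← htime s hs, hrs]

theorem hausdorffMeasure_pos (hX : IsExtremal F G β t X) (hp : IsParallel A B e β ν c)
    (h : SystemBounds F G A B C) (ht : IsSmallTime C c t) (ht0 : 0 < t) {S : Set Plane}
    (hS : X '' Icc 0 t ⊆ S) {r : ℝ} (hr : r ∈ Icc 0 t) {δ : ℝ} (hδ : 0 < δ) :
    0 < Measure.hausdorffMeasure 1 (S ∩ Metric.ball (X r) δ) := by
  obtain ⟨r', hr', hne⟩ := (Icc_infinite ht0).nontrivial.exists_ne r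
  exact hausdorffMeasure_inter_ball_pos isPreconnected_Icc hX.continuous.continuousOn hS hr hr'
    (fun heq => hne (hX.injOn hp h ht hr' hr heq)) hδ

end IsExtremal

namespace IsParallel

variable {T τ : ℝ}

theorem countablyRectifiable_singularSet (hp : IsParallel A B e β ν c)
    (h : SystemBounds F G A B C) (hT : IsSmallTime C c T) (hτ : 0 ≤ τ) (hτT : τ < T) :
    CountablyRectifiable 1 (singularSet F G τ) := by
  obtain ⟨X, hX⟩ := hp.exists_isExtremal h hT
  obtain ⟨Y, hY⟩ := hp.neg.exists_isExtremal h hT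
  have hsmall := hT.mono h.one_le hτ hτT.le
  rw [hp.singularSet_eq h hT hX hY hτT]
  exact countablyRectifiable_image_union_image hτ
    ((hX.mono hτT.le).lipschitzOnWith hp h hsmall)
    ((hY.mono hτT.le).lipschitzOnWith hp.neg h hsmall)

theorem exists_isOptimalReversed (hp : IsParallel A B e β ν c)
    (h : SystemBounds F G A B C) (hT : IsSmallTime C c T) (hτ : 0 < τ) (hτT : τ < T) :
    ∃ x₁ x₂ : ℝ → Plane, IsOptimalReversed F G τ x₁ ∧ IsOptimalReversed F G τ x₂ ∧
      (∃ t ∈ Icc 0 τ, x₁ t ≠ x₂ t) ∧ singularSet F G τ = x₁ '' Icc 0 τ ∪ x₂ '' Icc 0 τ := by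
  obtain ⟨X, hX⟩ := hp.exists_isExtremal h hT
  obtain ⟨Y, hY⟩ := hp.neg.exists_isExtremal h hT
  have hsmall := hT.mono h.one_le hτ.le hτT.le
  have hXτ := hX.mono hτT.le
  have hYτ := hY.mono hτT.le
  exact ⟨X, Y, ⟨⟨_, hp.isControl, hXτ.isTrajectory⟩, hXτ.minTime_eq hp h hsmall⟩,
    ⟨⟨_, hp.neg.isControl, hYτ.isTrajectory⟩, hYτ.minTime_eq hp.neg h hsmall⟩,
    ⟨τ, ⟨hτ.le, le_rfl⟩, hXτ.apply_ne hYτ hp h hsmall hτ⟩, hp.singularSet_eq h hT hX hY hτT⟩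

theorem hausdorffMeasure_singularSet_inter_ball_pos (hp : IsParallel A B e β ν c)
    (h : SystemBounds F G A B C) (hT : IsSmallTime C c T) (hτ : 0 < τ) (hτT : τ < T) {x : Plane}
    (hx : x ∈ singularSet F G τ) {δ : ℝ} (hδ : 0 < δ) :
    0 < Measure.hausdorffMeasure 1 (singularSet F G τ ∩ Metric.ball x δ) := by
  obtain ⟨X, hX⟩ := hp.exists_isExtremal h hT
  obtain ⟨Y, hY⟩ := hp.neg.exists_isExtremal h hT
  have hsmall := hT.mono h.one_le hτ.le hτT.le
  rw [hp.singularSet_eq h hT hX hY hτT] at hx ⊢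
  rcases hx with ⟨t, ht, rfl⟩ | ⟨t, ht, rfl⟩
  · exact (hX.mono hτT.le).hausdorffMeasure_pos hp h hsmall hτ subset_union_left ht hδ
  · exact (hY.mono hτT.le).hausdorffMeasure_pos hp.neg h hsmall hτ subset_union_right ht hδ

end IsParallel

theorem exists_isParallel (hM : 0 < M) (hAB : ∀ i, wedge (B i) (A (B i)) ≠ 0)
    (hB : ∀ i j, wedge (B i) (B j) = 0) :
    ∃ (e : Plane) (β : Fin M → ℝ) (ν c : ℝ), IsParallel A B e β ν c := by
  have : Nonempty (Fin M) := ⟨⟨0, hM⟩⟩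
  set b := B ⟨0, hM⟩
  have hB0 : ∀ i, B i ≠ 0 := fun i hi => hAB i (by simp [hi])
  have hb : ‖b‖ ≠ 0 := norm_ne_zero_iff.2 (hB0 _)
  set e := ‖b‖⁻¹ • b
  have hen : ‖e‖ = 1 := by rw [norm_smul, norm_inv, norm_norm, inv_mul_cancel₀ hb]
  have hBe : ∀ i, B i = (inner ℝ e (B i) : ℝ) • e := fun i =>
    eq_inner_smul_of_wedge_eq_zero hen (by simp [e, b, hB])
  have hAe : wedge e (A e) ≠ 0 := by
    simpa [e, hb] using hAB ⟨0, hM⟩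
  have hβ : ∀ i, (inner ℝ e (B i) : ℝ) ≠ 0 := fun i hi =>
    hB0 i (by rw [hBe i, hi, zero_smul])
  obtain ⟨k, hk⟩ := Finite.exists_min fun i => |(inner ℝ e (B i) : ℝ)|
  refine ⟨e, fun i => inner ℝ e (B i), wedge e (A e) / |wedge e (A e)|,
    min 1 (min |(inner ℝ e (B k) : ℝ)| |wedge e (A e)|), hM, hen, hBe,
    lt_min one_pos (lt_min (abs_pos.2 (hβ k)) (abs_pos.2 hAe)), min_le_left _ _,
    fun i => (min_le_right _ _).trans ((min_le_left _ _).trans (hk i)), ?_, ?_⟩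
  · rw [abs_div, abs_abs, div_self (abs_ne_zero.2 hAe)]
  · rw [div_mul_eq_mul_div, ← abs_mul_abs_self, mul_self_div_self]
    exact (min_le_right _ _).trans (min_le_right _ _)

end Conclusions

end MinTime

end

theorem theorem5p2_general (M : ℕ) (hM : 0 < M) (L : ℝ≥0)
    (A : MinTime.Plane →L[ℝ] MinTime.Plane) (B : Fin M → MinTime.Plane)
    (hAB : ∀ i, (MinTime.columns (B i) (A (B i))).rank = 2) :
    ∃ T₀ : ℝ, 0 < T₀ ∧
      ∀ (F : MinTime.Plane → MinTime.Plane) (G : Fin M → MinTime.Plane → MinTime.Plane),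
        MinTime.IsC11 L F → (∀ i, MinTime.IsC11 L (G i)) →
        F 0 = 0 → fderiv ℝ F 0 = A →
        (∀ i, G i 0 = B i) → (∀ i, fderiv ℝ (G i) 0 = 0) →
        ∀ τ : ℝ, 0 < τ → τ < T₀ →
          MinTime.singularSet F G τ =
            {x | x ∈ MinTime.reachable F G τ ∧
              MinTime.NonLipschitzAt (MinTime.minTime F G) x} ∧
          MinTime.CountablyRectifiable 1 (MinTime.singularSet F G τ) ∧
          (MinTime.singularSet F G τ = ∅ ∨
            ∃ x₁ x₂ : ℝ → MinTime.Plane,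
              MinTime.IsOptimalReversed F G τ x₁ ∧ MinTime.IsOptimalReversed F G τ x₂ ∧
              (∃ t ∈ Icc 0 τ, x₁ t ≠ x₂ t) ∧
              MinTime.singularSet F G τ = x₁ '' Icc 0 τ ∪ x₂ '' Icc 0 τ) ∧
          ∀ x ∈ MinTime.singularSet F G τ, ∃ δ : ℝ, 0 < δ ∧
            0 < Measure.hausdorffMeasure 1 (MinTime.singularSet F G τ ∩ Metric.ball x δ) := by
  have hwedge := fun i => MinTime.wedge_ne_zero_of_rank_columns (hAB i)
  have hbounds := fun F G => MinTime.systemBounds_of_isC11 (L := L) (F := F) (G := G) (A := A)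
    (B := B)
  set C : ℝ := 1 + M + ‖A‖ + 4 * L + ∑ i, ‖B i‖ + M * (∑ i, ‖B i‖ + 4 * L)
  have hC : 0 < C := by positivity
  by_cases hpar : ∀ i j, MinTime.wedge (B i) (B j) = 0
  · obtain ⟨e, β, ν, c, hp⟩ := MinTime.exists_isParallel hM hwedge hpar
    have hc := hp.c_pos
    have hT := MinTime.isSmallTime_min hC hc
    refine ⟨min (1 / (4 * C)) (c ^ 3 / (256 * C ^ 5)), by positivity,
      fun F G hF hG hF0 hDF hG0 hDG τ hτ hτT => ?_⟩
    have h := hbounds F G hF hG hF0 hDF hG0 hDG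
    exact ⟨hp.singularSet_eq_nonLipschitz h hT hτT,
      hp.countablyRectifiable_singularSet h hT hτ.le hτT,
      Or.inr (hp.exists_isOptimalReversed h hT hτ hτT), fun x hx =>
      ⟨1, one_pos, hp.hausdorffMeasure_singularSet_inter_ball_pos h hT hτ hτT hx one_pos⟩⟩
  · push Not at hpar
    obtain ⟨i, j, hij⟩ := hpar
    have hT : C * (1 / (4 * C)) ≤ 1 / 4 := by field_simp; rfl
    refine ⟨1 / (4 * C), by positivity, fun F G hF hG hF0 hDF hG0 hDG τ _ hτT => ?_⟩
    have h := hbounds F G hF hG hF0 hDF hG0 hDG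
    rw [h.singularSet_eq_empty hij hT hτT, h.setOf_nonLipschitzAt_eq_empty hij hT hτT]
    exact ⟨rfl, MinTime.countablyRectifiable_empty 1, Or.inl rfl, fun x hx => hx.elim⟩

theorem theorem5p2 (M : ℕ) (hM : M = 1 ∨ M = 2) (L : ℝ≥0)
    (A : MinTime.Plane →L[ℝ] MinTime.Plane) (B : Fin M → MinTime.Plane)
    (hAB : ∀ i, (MinTime.columns (B i) (A (B i))).rank = 2) :
    -- the time bound depends only on `L`, `A = DF(0)` and `B = G(0)`
    ∃ T₀ : ℝ, 0 < T₀ ∧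
      ∀ (F : MinTime.Plane → MinTime.Plane) (G : Fin M → MinTime.Plane → MinTime.Plane),
        MinTime.IsC11 L F → (∀ i, MinTime.IsC11 L (G i)) →
        F 0 = 0 → fderiv ℝ F 0 = A →
        (∀ i, G i 0 = B i) → (∀ i, fderiv ℝ (G i) 0 = 0) →
        ∀ τ : ℝ, 0 < τ → τ < T₀ →
          -- `S` is exactly the set of non-Lipschitz points of `T` in `R_τ`
          MinTime.singularSet F G τ =
            {x | x ∈ MinTime.reachable F G τ ∧
              MinTime.NonLipschitzAt (MinTime.minTime F G) x} ∧
          MinTime.CountablyRectifiable 1 (MinTime.singularSet F G τ) ∧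
          -- `S` is empty or consists of exactly two optimal trajectories
          (MinTime.singularSet F G τ = ∅ ∨
            ∃ x₁ x₂ : ℝ → MinTime.Plane,
              MinTime.IsOptimalReversed F G τ x₁ ∧ MinTime.IsOptimalReversed F G τ x₂ ∧
              (∃ t ∈ Icc 0 τ, x₁ t ≠ x₂ t) ∧
              MinTime.singularSet F G τ = x₁ '' Icc 0 τ ∪ x₂ '' Icc 0 τ) ∧
          ∀ x ∈ MinTime.singularSet F G τ, ∃ δ : ℝ, 0 < δ ∧
            0 < Measure.hausdorffMeasure 1 (MinTime.singularSet F G τ ∩ Metric.ball x δ) := by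
  exact theorem5p2_general M (by omega) L A B hAB
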